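/- Graphs are finite, undirected and connected, have at least two vertices, and may have loops and parallel edges. A graph $G=(V,E)$ is the \emph{homomorphic image} of a graph $H=(W,F)$ by an onto map $\phi:W\to V$ if for all $u,v\in V$ (possibly $u=v$) the number of edges of $G$ between $u$ and $v$ equals the number of edges of $H$ whose endpoints are mapped by $\phi$ to $\{u,v\}$. A vector $\mu\in\mathbb{Z}_{\ge 0}^V$ is a \emph{feasible split vector} of $G$ if there are a connected graph $H=(W,F)$ and an onto map $\phi:W\to V$ such that $G$ is the homomorphic image of $H$ by $\phi$ and $|\phi^{-1}(v)|=\mu(v)+1$ for all $v\in V$. A \emph{polymatroid} over a finite set $N$ is a polytope of the form $\{x\in\mathbb{R}^N_{\ge 0} \mid x(S)\le f(S)\ \forall S\subseteq N\}$, where $f:2^N\to\mathbb{Z}_{\ge 0}$ is submodular. \textbf{Theorem.} For every graph $G=(V,E)$, the polytope $$P_G:=\operatorname{conv}\{\mu\in\mathbb{Z}_{\ge 0}^V \mid \mu \text{ is a feasible split vector of } G\}$$ is a polymatroid, and its integral points are exactly the feasible split vectors of $G$. Furthermore, there is a polynomial-time algorithm that, given $G$ and weights $w\in\mathbb{Z}^V$,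 returns an integral point of $P_G$ that maximizes $w^\top x$ over $x\in P_G$; and there is a polynomial-time algorithm that, given $G$ and a feasible split vector $\mu$ of $G$, returns a connected graph $H=(W,F)$ and an onto map $\phi:W\to V$ such that $G$ is the homomorphic image of $H$ by $\phi$ and $|\phi^{-1}(v)|=\mu(v)+1$ for all $v\in V$. -/

import Mathlib

open scoped Graph

/-! ## Homomorphic images and split vectors

Graphs are Mathlib's multigraphs `Graph α β`: loops and parallel edges are allowed. -/

namespace KTrail

/-- A graph is connected if its underlying simple graph (loops and multiplicities of edges
forgotten) is connected. -/
def Connected {α β : Type*} (G : Graph α β) : Prop :=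
  G.toSimpleGraph.Connected

/-- The graphs under consideration: finite, connected, with at least two vertices. -/
structure IsAdmissible {α β : Type*} (G : Graph α β) : Prop where
  finite_vertexSet : V(G).Finite
  finite_edgeSet : E(G).Finite
  connected : Connected G
  two_le : 2 ≤ V(G).ncard

/-- `G` is the homomorphic image of `H` by `φ`: the map `φ` is onto, and for all vertices `u`, `v`
of `G` (possibly equal), the number of edges of `G` between `u` and `v` equals the number of edges
of `H` whose endpoints get mapped to `{u, v}`. -/
def IsHomImage {α β α' β' : Type*} (G : Graph α β) (H : Graph α' β') (φ : V(H) → V(G)) : Prop :=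
  Function.Surjective φ ∧
    ∀ u v : V(G), {e : β | G.IsLink e u v}.encard =
      {f : β' | ∃ x y : V(H), H.IsLink f x y ∧ φ x = u ∧ φ y = v}.encard

/-- `H` and `φ` certify the multiplicity vector `mult`: the graph `H` is connected, `G` is the
homomorphic image of `H` by `φ`, and every vertex `v` of `G` has exactly `mult v` preimages. -/
def Certifies {α β α' β' : Type*} (G : Graph α β) (mult : V(G) → ℕ) (H : Graph α' β')
    (φ : V(H) → V(G)) : Prop :=
  Connected H ∧ IsHomImage G H φ ∧ ∀ v : V(G), (φ ⁻¹' {v}).encard = mult v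

/-- Feasible multiplicity vectors. If `G` is finite, every certifying `H` is finite, so it is
enough to let `H` range over graphs whose vertices and edges are taken from types in `Type`. -/
def IsFeasibleMultiplicity {α β : Type*} (G : Graph α β) (mult : V(G) → ℕ) : Prop :=
  ∃ (α' β' : Type) (H : Graph α' β') (φ : V(H) → V(G)), Certifies G mult H φ

/-- Feasible split vectors: adding one to every entry gives a feasible multiplicity vector. -/
def IsFeasibleSplit {α β : Type*} (G : Graph α β) (μ : V(G) → ℕ) : Prop :=
  IsFeasibleMultiplicity G (fun v => μ v + 1)

/-- The feasible split vectors as points of `ℝ^V(G)`. -/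
def splitPoints {α β : Type*} (G : Graph α β) : Set (V(G) → ℝ) :=
  {x | ∃ μ : V(G) → ℕ, IsFeasibleSplit G μ ∧ ∀ v, x v = (μ v : ℝ)}

/-- The polytope `P_G`: the convex hull of the feasible split vectors. -/
def splitPolytope {α β : Type*} (G : Graph α β) : Set (V(G) → ℝ) :=
  convexHull ℝ (splitPoints G)

/-- The integral points of a set of real vectors. -/
def integralPoints {N : Type*} (P : Set (N → ℝ)) : Set (N → ℝ) :=
  {x ∈ P | ∀ i, ∃ k : ℤ, x i = (k : ℝ)}

/-- `P` is a polymatroid: `P = {x ≥ 0 | x(S) ≤ f(S) for all S}` for some submodular set function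
`f` with values in the nonnegative integers. -/
def IsPolymatroid {N : Type*} (P : Set (N → ℝ)) : Prop :=
  open scoped Classical in
  ∃ f : Finset N → ℕ, (∀ S T : Finset N, f (S ∪ T) + f (S ∩ T) ≤ f S + f T) ∧
    P = {x : N → ℝ | (∀ i, 0 ≤ x i) ∧ ∀ S : Finset N, ∑ i ∈ S, x i ≤ (f S : ℝ)}

/-! ## Random access machines and polynomial time

The machine model is a structured random access machine. Its memory consists of arrays numbered
by `ℕ` (a fixed program uses only finitely many of them), whose cells are addressed by integers
and hold integers. Arithmetic is addition and subtraction; there is no multiplication, so that in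
`t` steps the bit lengths of numbers grow by `O(t)` only, and polynomial running time with unit
costs is the same as polynomial running time on a Turing machine. -/

/-- Memory contents: `s a k` is the content of cell `k` of array `a`. -/
abbrev Store := ℕ → ℤ → ℤ

/-- Integer expressions of the programming language. -/
inductive Expr : Type
  | const (k : ℤ)
  | read (a : ℕ) (i : Expr)
  | add (e₁ e₂ : Expr)
  | sub (e₁ e₂ : Expr)

/-- The value of an expression. -/
def Expr.eval (s : Store) : Expr → ℤ
  | .const k => k
  | .read a i => s a (i.eval s)
  | .add e₁ e₂ => e₁.eval s + e₂.eval s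
  | .sub e₁ e₂ => e₁.eval s - e₂.eval s

/-- Programs. Tests have the form `0 < e`. -/
inductive Program : Type
  | skip
  | write (a : ℕ) (i e : Expr)
  | seq (c₁ c₂ : Program)
  | ite (e : Expr) (c₁ c₂ : Program)
  | loop (e : Expr) (c : Program)

/-- The store with cell `k` of array `a` overwritten by `x`. -/
def Store.set (s : Store) (a : ℕ) (k x : ℤ) : Store :=
  fun b j => if b = a ∧ j = k then x else s b j

/-- `Exec c s s' t`: started in `s`, the program `c` halts in `s'` after `t` steps. A step is the
execution of `skip`, an assignment, or the evaluation of a test; the expressions in a fixed program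
have bounded size. -/
inductive Exec : Program → Store → Store → ℕ → Prop
  | skip (s : Store) : Exec .skip s s 1
  | write (a : ℕ) (i e : Expr) (s : Store) :
      Exec (.write a i e) s (s.set a (i.eval s) (e.eval s)) 1
  | seq {c₁ c₂ : Program} {s₁ s₂ s₃ : Store} {t₁ t₂ : ℕ} :
      Exec c₁ s₁ s₂ t₁ → Exec c₂ s₂ s₃ t₂ → Exec (.seq c₁ c₂) s₁ s₃ (t₁ + t₂)
  | ite_pos {e : Expr} {c₁ c₂ : Program} {s s' : Store} {t : ℕ} :
      0 < e.eval s → Exec c₁ s s' t → Exec (.ite e c₁ c₂) s s' (t + 1)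
  | ite_neg {e : Expr} {c₁ c₂ : Program} {s s' : Store} {t : ℕ} :
      ¬ 0 < e.eval s → Exec c₂ s s' t → Exec (.ite e c₁ c₂) s s' (t + 1)
  | loop_done {e : Expr} {c : Program} {s : Store} :
      ¬ 0 < e.eval s → Exec (.loop e c) s s 1
  | loop_step {e : Expr} {c : Program} {s₁ s₂ s₃ : Store} {t₁ t₂ : ℕ} :
      0 < e.eval s₁ → Exec c s₁ s₂ t₁ → Exec (.loop e c) s₂ s₃ t₂ →
      Exec (.loop e c) s₁ s₃ (t₁ + t₂ + 1)

/-- The initial store: the input is written to array `0`, all other cells are `0`. -/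
def inputStore (l : List ℤ) : Store :=
  fun a k => if a = 0 ∧ 0 ≤ k then l.getD k.toNat 0 else 0

/-- The output `l` is found in the first cells of array `1`. -/
def HasOutput (s : Store) (l : List ℤ) : Prop :=
  ∀ k : Fin l.length, s 1 ((k : ℕ) : ℤ) = l.get k

/-- Number of bits needed to write down a list of integers: binary digits, and for each entry
a sign and a separator. -/
def bitLength (l : List ℤ) : ℕ :=
  (l.map fun x => x.natAbs.size + 2).sum

/-- A search problem with instances in `ι` is solvable in polynomial time: a single program
halts on each (valid) instance within a number of steps that is bounded by a fixed polynomial in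
the bit length of the encoded instance, and outputs a solution of that instance. -/
def SolvableInPolyTime {ι : Type*} (encode : ι → List ℤ) (valid : ι → Prop)
    (IsSolution : ι → List ℤ → Prop) : Prop :=
  ∃ (c : Program) (p : Polynomial ℕ), ∀ i : ι, valid i →
    ∃ (s : Store) (t : ℕ) (out : List ℤ),
      Exec c (inputStore (encode i)) s t ∧ t ≤ p.eval (bitLength (encode i)) ∧
      HasOutput s out ∧ IsSolution i out

/-! ## Graphs as inputs and outputs of programs -/

/-- A graph given by the list of its edges: the vertices are `0, …, n - 1`, the edges are
`0, …, m - 1`, and `ends j` are the endpoints of edge `j`. -/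
structure EdgeList : Type where
  n : ℕ
  m : ℕ
  ends : Fin m → Fin n × Fin n

/-- The graph given by an edge list. -/
def EdgeList.toGraph (I : EdgeList) : Graph (Fin I.n) (Fin I.m) where
  vertexSet := Set.univ
  edgeSet := Set.univ
  IsLink e x y := I.ends e = (x, y) ∨ I.ends e = (y, x)
  isLink_symm := fun _ _ => ⟨fun _ _ h => h.symm⟩
  eq_or_eq_of_isLink_of_isLink := by
    intro e x y v w h h'
    rcases h with h | h <;> rcases h' with h' | h' <;> rw [h] at h' <;>
      simp only [Prod.mk.injEq] at h' <;> tauto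
  edge_mem_iff_exists_isLink := fun e =>
    ⟨fun _ => ⟨(I.ends e).1, (I.ends e).2, Or.inl rfl⟩, fun _ => Set.mem_univ _⟩
  left_mem_of_isLink := fun _ _ _ _ => Set.mem_univ _

/-- A number below `n`, as a vertex of the graph. -/
def EdgeList.vert (I : EdgeList) (v : Fin I.n) : V(I.toGraph) :=
  ⟨v, Set.mem_univ v⟩

/-- A vector given by the list of its entries, as a vector indexed by the vertices of the graph. -/
def EdgeList.vec (I : EdgeList) {R : Type*} (x : Fin I.n → R) : V(I.toGraph) → R :=
  fun v => x v.1

/-- The encoding `n, m, a₀, b₀, …, aₘ₋₁, bₘ₋₁` of an edge list. -/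
def EdgeList.encode (I : EdgeList) : List ℤ :=
  [(I.n : ℤ), (I.m : ℤ)] ++
    (List.ofFn I.ends).flatMap fun e => [((e.1 : ℕ) : ℤ), ((e.2 : ℕ) : ℤ)]

/-- Instances of the optimization problem: a graph and an integral weight for each vertex. -/
structure OptInstance : Type where
  graph : EdgeList
  weight : Fin graph.n → ℤ

def OptInstance.encode (i : OptInstance) : List ℤ :=
  i.graph.encode ++ List.ofFn i.weight

/-- The output lists the entries of a vector `x` in `P_G` (indeed an integral one) that maximizes
the weight over `P_G`. -/
def OptInstance.IsSolution (i : OptInstance) (out : List ℤ) : Prop :=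
  ∃ x : Fin i.graph.n → ℤ, out = List.ofFn x ∧
    i.graph.vec (fun v => (x v : ℝ)) ∈ splitPolytope i.graph.toGraph ∧
    ∀ y ∈ splitPolytope i.graph.toGraph,
      ∑ v, (i.weight v : ℝ) * y (i.graph.vert v) ≤ ∑ v, (i.weight v : ℝ) * (x v : ℝ)

/-- Instances of the construction problem: a graph and a nonnegative integral vector. -/
structure SplitInstance : Type where
  graph : EdgeList
  split : Fin graph.n → ℕ

def SplitInstance.encode (i : SplitInstance) : List ℤ :=
  i.graph.encode ++ List.ofFn fun v => (i.split v : ℤ)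

/-- The output describes a connected graph `H` (as an edge list) and the list of values of a map
`φ` on the vertices of `H`, which certify that the given vector is a feasible split vector. -/
def SplitInstance.IsSolution (i : SplitInstance) (out : List ℤ) : Prop :=
  ∃ (H : EdgeList) (φ : Fin H.n → Fin i.graph.n),
    out = H.encode ++ List.ofFn (fun w => ((φ w : ℕ) : ℤ)) ∧
    Certifies i.graph.toGraph (i.graph.vec fun v => i.split v + 1) H.toGraph
      (H.vec fun w => i.graph.vert (φ w))

end KTrail

set_option linter.unusedSectionVars false

/-! The theorem rests on a translation into orientations. Fix a root `r`. A vector `μ` is a feasible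
split vector iff the edges of `G` can be oriented so that every vertex is reachable from `r` and
every `v` has `μ v` entering arcs in addition to the one needed to reach it (`Orientable`). Given a
certificate `H`, orient a breadth first search tree of `H` away from a copy of `r`: every other copy
of `v` has its own tree edge, and the image of this edge enters `v` (`Coding.orientable`).
Conversely, choose a tree of arcs directed away from `r`, and let `μ v` of the other arcs entering
`v` end in new copies of `v`, all tails staying at the main copies. The tree connects the main
copies, and each new copy hangs on one of them (`Splitting.certifies`).

The number of arcs entering a set is submodular and the required number is modular, so intersecting
tight sets can be uncrossed. If `μ` cannot be increased at `v`, every vertex with an entering arc to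
spare is separated from `v` by a tight set, for otherwise reversing a path would move the spare arc
to `v`. Uncrossing turns these sets into disjoint tight sets that cover all spare arcs; outside
their union, no orientable vector has a larger sum than `μ` (`exists_saturated_superset`).

This saturation property (`IsSaturable`) already implies everything polyhedral: the rank function is
submodular, an integral vector that obeys the rank inequalities belongs to the set, and greedy
vectors are optimal over the polyhedron given by these inequalities. By separation, this polyhedron
is the convex hull.

The algorithms use one subroutine, `augment`, which tries path reversals to gain one more entering
arc at a given vertex; if all of them fail, the resulting tight sets prove that no orientation does
better. Optimization applies it greedily by decreasing weight, construction applies it until `μ` is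
reached and then splits heads. All loops are bounded by the bit length of the input, so nesting them
costs polynomially many steps. The existence of a root-connected orientation and the passage from
orientations to certificates are read off from the correctness of the programs. -/

namespace KTrail

/-! ## Orientations with prescribed lower bounds on the in-degrees -/

section Orientation

variable {V E : Type*} [Fintype E] [DecidableEq V]

/-- The map `D` assigns to each edge a tail and a head; the endpoints are those given by `ends`. -/
def IsOrientation (ends D : E → V × V) : Prop :=
  ∀ e, D e = ends e ∨ D e = (ends e).swap

/-- The number of arcs with head `v`. -/
def indeg (D : E → V × V) (v : V) : ℕ :=
  (Finset.univ.filter fun e => (D e).2 = v).card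

/-- There is a directed path from `u` to `v`. -/
def Reaches (D : E → V × V) : V → V → Prop :=
  Relation.ReflTransGen fun x y => ∃ e, D e = (x, y)

/-- All vertices can be reached from `r`. -/
def RootConnected (D : E → V × V) (r : V) : Prop :=
  ∀ v, Reaches D r v

/-- The number of arcs entering `X`. -/
def entering (D : E → V × V) (X : Finset V) : ℕ :=
  (Finset.univ.filter fun e => (D e).1 ∉ X ∧ (D e).2 ∈ X).card

/-- The number of edges with both endpoints in `X`. -/
def inside (D : E → V × V) (X : Finset V) : ℕ :=
  (Finset.univ.filter fun e => (D e).1 ∈ X ∧ (D e).2 ∈ X).card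

/-- The number of arcs that have to enter a nonempty set in a root-connected orientation. -/
def demand (r : V) (X : Finset V) : ℕ := if r ∈ X then 0 else 1

/-- There is a root-connected orientation in which every vertex `v` has at least `μ v` entering
arcs in addition to the one that reaches it from the root. -/
def Orientable (ends : E → V × V) (r : V) (μ : V → ℕ) : Prop :=
  ∃ D, IsOrientation ends D ∧ RootConnected D r ∧
    ∀ v, μ v + (if v = r then 0 else 1) ≤ indeg D v

/-- A nonempty set that is entered by as few arcs as possible. -/
def Tight (D : E → V × V) (r : V) (X : Finset V) : Prop :=
  X.Nonempty ∧ entering D X = demand r X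

theorem Reaches.refl (D : E → V × V) (v : V) : Reaches D v v :=
  Relation.ReflTransGen.refl

/-- An arc with its head in `X` either enters `X` or lies inside. As the second number is the same
for all orientations (`inside_eq`), in-degree sums over `X` differ between orientations exactly as
the numbers of entering arcs do. -/
theorem sum_indeg (D : E → V × V) (X : Finset V) :
    ∑ v ∈ X, indeg D v = entering D X + inside D X := by
  have h : ∑ v ∈ X, indeg D v = (Finset.univ.filter fun e => (D e).2 ∈ X).card := by
    rw [Finset.card_eq_sum_card_fiberwise (f := fun e => (D e).2) (t := X)]
    · refine Finset.sum_congr rfl fun v hv => ?_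
      unfold indeg
      congr 1
      ext e
      simp only [Finset.mem_filter, Finset.mem_univ, true_and]
      exact ⟨fun h => ⟨h ▸ hv, h⟩, fun h => h.2⟩
    · intro e he
      simpa using he
  classical
  rw [h, entering, inside, ← Finset.card_union_of_disjoint]
  · congr 1
    ext e
    simp only [Finset.mem_filter, Finset.mem_univ, true_and, Finset.mem_union]
    tauto
  · rw [Finset.disjoint_filter]
    tauto

theorem inside_eq {ends D : E → V × V} (h : IsOrientation ends D) (X : Finset V) :
    inside D X = inside ends X := by
  unfold inside
  congr 1
  ext e
  simp only [Finset.mem_filter, Finset.mem_univ, true_and]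
  rcases h e with h | h <;> rw [h]
  simp [and_comm]

theorem exists_arc_leaving {D : E → V × V} {P : V → Prop} {a b : V} (h : Reaches D a b)
    (ha : P a) (hb : ¬ P b) : ∃ e, P (D e).1 ∧ ¬ P (D e).2 := by
  induction h with
  | refl => exact absurd ha hb
  | @tail c d _ hcd ih =>
    by_cases hc : P c
    · obtain ⟨e, he⟩ := hcd
      exact ⟨e, by simpa [he] using hc, by simpa [he] using hb⟩
    · exact ih hc

theorem demand_le_entering {D : E → V × V} {r : V} (h : RootConnected D r) {X : Finset V}
    (hX : X.Nonempty) : demand r X ≤ entering D X := by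
  unfold demand
  split_ifs with hr
  · exact Nat.zero_le _
  · obtain ⟨x, hx⟩ := hX
    obtain ⟨e, h1, h2⟩ := exists_arc_leaving (P := fun v => v ∉ X) (h x) hr (by simpa using hx)
    exact Finset.card_pos.2 ⟨e, by simpa using ⟨h1, not_not.1 h2⟩⟩

/-! ### Uncrossing tight sets -/

theorem entering_submodular (D : E → V × V) (X Y : Finset V) :
    entering D (X ∩ Y) + entering D (X ∪ Y) ≤ entering D X + entering D Y := by
  simp only [entering, Finset.card_filter, ← Finset.sum_add_distrib]
  refine Finset.sum_le_sum fun e _ => ?_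
  by_cases h1 : (D e).1 ∈ X <;> by_cases h2 : (D e).2 ∈ X <;> by_cases h3 : (D e).1 ∈ Y <;>
    by_cases h4 : (D e).2 ∈ Y <;> simp [h1, h2, h3, h4]

theorem demand_modular (r : V) (X Y : Finset V) :
    demand r (X ∩ Y) + demand r (X ∪ Y) = demand r X + demand r Y := by
  by_cases h1 : r ∈ X <;> by_cases h2 : r ∈ Y <;> simp [demand, h1, h2]

/-- Submodularity of the entering arcs against modularity of the demand leaves no room: both
nonempty sets must attain their lower bounds. -/
theorem Tight.inter_union {D : E → V × V} {r : V} (h : RootConnected D r) {X Y : Finset V}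
    (hX : Tight D r X) (hY : Tight D r Y) (hXY : (X ∩ Y).Nonempty) :
    Tight D r (X ∩ Y) ∧ Tight D r (X ∪ Y) := by
  have hU : (X ∪ Y).Nonempty := hX.1.mono Finset.subset_union_left
  have h1 := demand_le_entering h hXY
  have h2 := demand_le_entering h hU
  have h3 := entering_submodular D X Y
  have h4 := demand_modular r X Y
  have h5 := hX.2
  have h6 := hY.2
  exact ⟨⟨hXY, by omega⟩, ⟨hU, by omega⟩⟩

variable [Fintype V]

theorem tight_univ [Nonempty V] (D : E → V × V) (r : V) : Tight D r Finset.univ :=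
  ⟨Finset.univ_nonempty, by simp [entering, demand]⟩

/-- Tight sets that separate a vertex from each vertex of `U` yield one that separates it from
`U`. -/
theorem exists_tight_disjoint {D : E → V × V} {r : V} (h : RootConnected D r) {u : V}
    {U : Finset V} (hU : ∀ v ∈ U, ∃ Y, Tight D r Y ∧ u ∈ Y ∧ v ∉ Y) :
    ∃ Y, Tight D r Y ∧ u ∈ Y ∧ Disjoint U Y := by
  have : Nonempty V := ⟨u⟩
  -- A minimal tight set around `u` is contained in every tight `Y` that contains `u`, since `T ∩ Y`
  -- is tight as well. So it avoids every vertex that some such `Y` avoids.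
  obtain ⟨T, hT⟩ := Set.Finite.exists_minimal (Set.toFinite {T : Finset V | Tight D r T ∧ u ∈ T})
    ⟨Finset.univ, tight_univ D r, Finset.mem_univ u⟩
  refine ⟨T, hT.prop.1, hT.prop.2, Finset.disjoint_left.2 fun v hv hvT => ?_⟩
  obtain ⟨Y, hY, huY, hvY⟩ := hU v hv
  have huTY : u ∈ T ∩ Y := Finset.mem_inter.2 ⟨hT.prop.2, huY⟩
  have := hT.le_of_le ⟨(hT.prop.1.inter_union h hY ⟨u, huTY⟩).1, huTY⟩ Finset.inter_subset_left
  exact hvY (Finset.mem_inter.1 (this hvT)).2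

/-- If tight sets separate the vertices whose in-degree is larger than needed from `U`, then `μ` is
maximal on some superset of `U`. -/
theorem exists_saturated_superset {ends D : E → V × V} {r : V} {μ : V → ℕ}
    (hD : IsOrientation ends D) (h : RootConnected D r) (U : Finset V)
    (hU : ∀ v ∈ U, ∀ u, μ u + (if u = r then 0 else 1) < indeg D u →
      ∃ Y, Tight D r Y ∧ u ∈ Y ∧ v ∉ Y) :
    ∃ Z, U ⊆ Z ∧ ∀ μ', Orientable ends r μ' → ∑ v ∈ Z, μ' v ≤ ∑ v ∈ Z, μ v := by
  classical
  let 𝒯 : Finset (Finset V) := Finset.univ.filter fun Y => Tight D r Y ∧ Disjoint U Y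
  let 𝓜 : Finset (Finset V) := 𝒯.filter fun Y => ∀ Y' ∈ 𝒯, Y ⊆ Y' → Y' ⊆ Y
  have h𝓜 : ∀ Y ∈ 𝓜, Tight D r Y ∧ Disjoint U Y := fun Y hY => by
    simpa [𝒯] using (Finset.mem_filter.1 hY).1
  -- If two maximal members of `𝒯` met, their union would be a larger tight set that avoids `U`.
  have hdisj : (𝓜 : Set (Finset V)).PairwiseDisjoint id := by
    intro X hX Y hY hXY
    by_contra hne
    have hne : (X ∩ Y).Nonempty := by
      rw [← Finset.not_disjoint_iff_nonempty_inter]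
      exact hne
    obtain ⟨hX1, hX2⟩ := h𝓜 X hX
    obtain ⟨hY1, hY2⟩ := h𝓜 Y hY
    have hmem : X ∪ Y ∈ 𝒯 := by
      simp only [𝒯, Finset.mem_filter, Finset.mem_univ, true_and]
      exact ⟨(hX1.inter_union h hY1 hne).2, Finset.disjoint_union_right.2 ⟨hX2, hY2⟩⟩
    have e1 := (Finset.mem_filter.1 hX).2 _ hmem Finset.subset_union_left
    have e2 := (Finset.mem_filter.1 hY).2 _ hmem Finset.subset_union_right
    exact hXY (Finset.Subset.antisymm (Finset.subset_union_left.trans e2)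
      (Finset.subset_union_right.trans e1))
  set C : Finset V := 𝓜.biUnion id with hC
  have hcover : ∀ u ∉ C, indeg D u ≤ μ u + (if u = r then 0 else 1) := by
    intro u hu
    by_contra! hlt
    obtain ⟨Y, hY, huY, hYU⟩ := exists_tight_disjoint h (fun v hv => hU v hv u hlt)
    have hY𝒯 : Y ∈ 𝒯 := by simpa [𝒯] using ⟨hY, hYU⟩
    obtain ⟨M, hYM, hM⟩ := 𝒯.exists_le_maximal hY𝒯
    refine hu (Finset.mem_biUnion.2 ⟨M, Finset.mem_filter.2 ⟨hM.prop, ?_⟩, hYM huY⟩)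
    exact fun Y' hY' hle => hM.le_of_ge hY' hle
  refine ⟨Cᶜ, ?_, ?_⟩
  · intro v hv
    simp only [hC, Finset.mem_compl, Finset.mem_biUnion, not_exists, not_and, id]
    exact fun Y hY hvY => Finset.disjoint_left.1 (h𝓜 Y hY).2 hv hvY
  -- The disjoint tight sets give `C` the smallest possible in-degree sum, so `Cᶜ` has the largest
  -- possible one, as the total is fixed. Outside `C` the orientation `D` wastes no entering arc on
  -- more than `μ` needs, so `μ` uses up this maximum.
  · rintro μ' ⟨D', hD', h', hμ'⟩
    have hin : ∑ v ∈ C, indeg D v ≤ ∑ v ∈ C, indeg D' v := by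
      rw [hC, Finset.sum_biUnion hdisj, Finset.sum_biUnion hdisj]
      refine Finset.sum_le_sum fun Y hY => ?_
      have hY' := (h𝓜 Y hY).1
      rw [id, sum_indeg, sum_indeg, inside_eq hD, inside_eq hD', hY'.2]
      exact Nat.add_le_add_right (demand_le_entering h' hY'.1) _
    have htot : ∑ v, indeg D v = ∑ v, indeg D' v := by
      rw [sum_indeg, sum_indeg, inside_eq hD, inside_eq hD']
      simp [entering]
    rw [← Finset.sum_add_sum_compl C, ← Finset.sum_add_sum_compl C (indeg D')] at htot
    have hle : ∑ v ∈ Cᶜ, (μ' v + (if v = r then 0 else 1)) ≤ ∑ v ∈ Cᶜ, indeg D' v :=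
      Finset.sum_le_sum fun v _ => hμ' v
    have hge : ∑ v ∈ Cᶜ, indeg D v ≤ ∑ v ∈ Cᶜ, (μ v + (if v = r then 0 else 1)) :=
      Finset.sum_le_sum fun v hv => hcover v (Finset.mem_compl.1 hv)
    rw [Finset.sum_add_distrib] at hle hge
    omega

/-! ### Tight sets from failed exchanges -/

/-- No arc enters the set of vertices that `v` does not reach, so its demand must be zero as well.
-/
theorem exists_tight_of_not_reaches {D : E → V × V} {r u v : V} (h : RootConnected D r)
    (huv : ¬ Reaches D v u) : ∃ Y, Tight D r Y ∧ u ∈ Y ∧ v ∉ Y := by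
  classical
  refine ⟨Finset.univ.filter fun x => ¬ Reaches D v x, ⟨⟨u, by simpa using huv⟩, ?_⟩,
    by simpa using huv, by simpa using Reaches.refl D v⟩
  have h0 : entering D (Finset.univ.filter fun x => ¬ Reaches D v x) = 0 := by
    rw [entering, Finset.card_eq_zero, Finset.filter_eq_empty_iff]
    intro e _ he
    simp only [Finset.mem_filter, Finset.mem_univ, true_and, not_not] at he
    exact he.2 (he.1.tail ⟨e, rfl⟩)
  have h1 := demand_le_entering h (X := Finset.univ.filter fun x => ¬ Reaches D v x)
    ⟨u, by simpa using huv⟩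
  omega

/-- Let `Y` be the set of vertices that `r` does not reach in `D'`. It is entered by no arc of `D'`
but by at least one of `D`. Moving one unit of in-degree from `u` to `v` can only explain this if `u
∈ Y`, `v ∉ Y` and exactly one arc of `D` enters `Y`. -/
theorem exists_tight_of_not_rootConnected {ends D D' : E → V × V} {r u v : V}
    (hD : IsOrientation ends D) (h : RootConnected D r) (hD' : IsOrientation ends D')
    (hdeg : ∀ x, indeg D' x + (if x = u then 1 else 0) = indeg D x + (if x = v then 1 else 0))
    (h' : ¬ RootConnected D' r) : ∃ Y, Tight D r Y ∧ u ∈ Y ∧ v ∉ Y := by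
  classical
  set Y : Finset V := Finset.univ.filter fun x => ¬ Reaches D' r x with hY
  have hne : Y.Nonempty := by
    obtain ⟨x, hx⟩ := not_forall.1 h'
    exact ⟨x, by simpa [hY] using hx⟩
  have hr : r ∉ Y := by simpa [hY] using Reaches.refl D' r
  have h0 : entering D' Y = 0 := by
    rw [entering, Finset.card_eq_zero, Finset.filter_eq_empty_iff]
    intro e _ he
    simp only [hY, Finset.mem_filter, Finset.mem_univ, true_and, not_not] at he
    exact he.2 (he.1.tail ⟨e, rfl⟩)
  have h1 := demand_le_entering h hne
  have hs : ∑ x ∈ Y, (indeg D' x + (if x = u then 1 else 0)) =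
      ∑ x ∈ Y, (indeg D x + (if x = v then 1 else 0)) := Finset.sum_congr rfl fun x _ => hdeg x
  rw [Finset.sum_add_distrib, Finset.sum_add_distrib, sum_indeg, sum_indeg, inside_eq hD,
    inside_eq hD', Finset.sum_ite_eq', Finset.sum_ite_eq'] at hs
  have hd : demand r Y = 1 := by simp [demand, hr]
  by_cases hu : u ∈ Y <;> by_cases hv : v ∈ Y <;> simp only [hu, hv, if_true, if_false] at hs
  · omega
  · exact ⟨Y, ⟨hne, by omega⟩, hu, hv⟩
  · omega
  · omega

/-! ### Reversing paths -/

/-- Cut the path at its last departure from `v`. -/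
theorem reflTransGen_avoiding {r : V → V → Prop} (v : V) {a u : V}
    (h : Relation.ReflTransGen r a u) :
    Relation.ReflTransGen (fun x y => x ≠ v ∧ r x y) a u ∨
      ∃ w, r v w ∧ Relation.ReflTransGen (fun x y => x ≠ v ∧ r x y) w u := by
  induction h using Relation.ReflTransGen.head_induction_on with
  | refl => exact Or.inl .refl
  | @head a b hab _ ih =>
    rcases ih with ih | ih
    · by_cases ha : a = v
      · exact Or.inr ⟨b, ha ▸ hab, ih⟩
      · exact Or.inl (ih.head ⟨ha, hab⟩)
    · exact Or.inr ih

theorem indeg_update [DecidableEq E] (D : E → V × V) (e : E) (x : V) :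
    indeg (Function.update D e (D e).swap) x + (if x = (D e).2 then 1 else 0) =
      indeg D x + (if x = (D e).1 then 1 else 0) := by
  simp only [indeg, Finset.card_filter]
  rw [← Finset.add_sum_erase _ _ (Finset.mem_univ e),
    ← Finset.add_sum_erase (a := e) _ (fun i => if (D i).2 = x then 1 else 0) (Finset.mem_univ e)]
  have : ∑ i ∈ Finset.univ.erase e, (if (Function.update D e (D e).swap i).2 = x then 1 else 0) =
      ∑ i ∈ Finset.univ.erase e, (if (D i).2 = x then 1 else 0) :=
    Finset.sum_congr rfl fun i hi => by rw [Function.update_of_ne (Finset.ne_of_mem_erase hi)]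
  rw [this]
  simp only [Function.update_self, Prod.snd_swap, eq_comm (a := x)]
  omega

theorem IsOrientation.update [DecidableEq E] {ends D : E → V × V} (h : IsOrientation ends D)
    (e : E) : IsOrientation ends (Function.update D e (D e).swap) := by
  intro i
  by_cases hi : i = e
  · subst hi
    rcases h i with h | h <;> simp [h]
  · rw [Function.update_of_ne hi]
    exact h i

/-- Reversing a directed path from `v` to `u`. -/
theorem exists_reversal {ends D : E → V × V} (hD : IsOrientation ends D) {u v : V}
    (h : Reaches D v u) : ∃ D', IsOrientation ends D' ∧
      ∀ x, indeg D' x + (if x = u then 1 else 0) = indeg D x + (if x = v then 1 else 0) := by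
  classical
  -- `F` contains the arcs that the path may still use. After its last departure from `v`, the path
  -- cannot use the arc of that departure again, so this arc is dropped from `F`, the rest is
  -- reversed by induction, and the arc is reversed at the end.
  have key : ∀ (k : ℕ) (F : Finset E) (v : V), F.card = k →
      Relation.ReflTransGen (fun x y => ∃ e ∈ F, D e = (x, y)) v u →
      ∃ D', IsOrientation ends D' ∧ (∀ e ∉ F, D' e = D e) ∧
        ∀ x, indeg D' x + (if x = u then 1 else 0) = indeg D x + (if x = v then 1 else 0) := by
    intro k
    induction k using Nat.strong_induction_on with
    | _ k ih =>
      intro F v hF hr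
      by_cases huv : v = u
      · exact ⟨D, hD, fun _ _ => rfl, fun x => by rw [huv]⟩
      obtain ⟨w, ⟨e, heF, he⟩, hw⟩ : ∃ w, (∃ e ∈ F, D e = (v, w)) ∧
          Relation.ReflTransGen (fun x y => x ≠ v ∧ ∃ e ∈ F, D e = (x, y)) w u := by
        rcases reflTransGen_avoiding v hr with h | h
        · rcases Relation.ReflTransGen.cases_head h with h | ⟨c, hc, _⟩
          · exact absurd h huv
          · exact absurd rfl hc.1
        · exact h
      have hlt : (F.erase e).card < k := hF ▸ Finset.card_erase_lt_of_mem heF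
      obtain ⟨D', hD', hF', hdeg⟩ := ih _ hlt (F.erase e) w rfl (hw.lift id (by
        rintro x y ⟨hx, i, hi, hxy⟩
        refine ⟨i, Finset.mem_erase.2 ⟨?_, hi⟩, hxy⟩
        rintro rfl
        rw [he] at hxy
        exact hx (congrArg Prod.fst hxy).symm))
      have hD'e : D' e = (v, w) := by rw [hF' e (Finset.notMem_erase e F), he]
      refine ⟨Function.update D' e (D' e).swap, hD'.update e, fun i hi => ?_, fun x => ?_⟩
      · rw [Function.update_of_ne (by rintro rfl; exact hi heF)]
        exact hF' i fun hi' => hi (Finset.mem_of_mem_erase hi')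
      · have h1 := indeg_update D' e x
        have h2 := hdeg x
        rw [hD'e] at h1 ⊢
        simp only at h1
        omega
  obtain ⟨D', h1, -, h2⟩ := key _ Finset.univ v rfl (by simpa [Reaches] using h)
  exact ⟨D', h1, h2⟩

theorem Orientable.mono {ends : E → V × V} {r : V} {μ ν : V → ℕ} (h : Orientable ends r μ)
    (hle : ν ≤ μ) : Orientable ends r ν := by
  obtain ⟨D, h1, h2, h3⟩ := h
  exact ⟨D, h1, h2, fun v => (Nat.add_le_add_right (hle v) _).trans (h3 v)⟩

theorem Orientable.le_card {ends : E → V × V} {r : V} {μ : V → ℕ} (h : Orientable ends r μ)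
    (v : V) : μ v ≤ Fintype.card E := by
  obtain ⟨D, -, -, h3⟩ := h
  exact (Nat.le_add_right _ _).trans ((h3 v).trans (Finset.card_le_univ _))

/-- A vector whose entries cannot be increased individually on `U` is maximal on some superset
of `U`. -/
theorem Orientable.exists_saturated {ends : E → V × V} {r : V} {μ : V → ℕ}
    (h : Orientable ends r μ) (U : Finset V)
    (hU : ∀ v ∈ U, ¬ Orientable ends r (μ + Pi.single v 1)) :
    ∃ Z, U ⊆ Z ∧ ∀ μ', Orientable ends r μ' → ∑ v ∈ Z, μ' v ≤ ∑ v ∈ Z, μ v := by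
  obtain ⟨D, hD, hr, hdeg⟩ := h
  refine exists_saturated_superset hD hr U fun v hv u hu => ?_
  -- If `v` reaches `u`, reversing a path moves a spare entering arc from `u` to `v`. Since `μ`
  -- cannot be increased at `v`, the new orientation is not root-connected.
  by_cases huv : Reaches D v u
  · obtain ⟨D', hD', hdeg'⟩ := exists_reversal hD huv
    refine exists_tight_of_not_rootConnected hD hr hD' hdeg' fun hr' => ?_
    refine hU v hv ⟨D', hD', hr', fun x => ?_⟩
    have h1 := hdeg x
    have h2 := hdeg' x
    simp only [Pi.add_apply, Pi.single_apply]
    by_cases hxu : x = u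
    · subst hxu
      split_ifs at * <;> omega
    · simp only [hxu, if_false] at h2
      split_ifs at * <;> omega
  · exact exists_tight_of_not_reaches hr huv

end Orientation

/-! ## Integral vectors with the saturation property form polymatroids -/

section Saturable

variable {N : Type*} [Fintype N] [DecidableEq N]

/-- A finite down-closed set of nonnegative integral vectors such that a vector whose entries
cannot be increased individually on `U` is maximal on some superset of `U`. -/
structure IsSaturable (F : Set (N → ℕ)) : Prop where
  zero_mem : 0 ∈ F
  lower : ∀ ⦃μ⦄, μ ∈ F → ∀ ⦃ν⦄, ν ≤ μ → ν ∈ F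
  bounded : ∃ B, ∀ μ ∈ F, ∀ v, μ v ≤ B
  saturated : ∀ μ ∈ F, ∀ U : Finset N, (∀ v ∈ U, μ + Pi.single v 1 ∉ F) →
    ∃ Z, U ⊆ Z ∧ ∀ μ' ∈ F, ∑ v ∈ Z, μ' v ≤ ∑ v ∈ Z, μ v

/-- The largest total value on `S` of a vector in `F`. -/
noncomputable def rank (F : Set (N → ℕ)) (S : Finset N) : ℕ :=
  sSup ((fun μ => ∑ v ∈ S, μ v) '' F)

/-! ### The rank function -/

variable {F : Set (N → ℕ)}

theorem IsSaturable.finite (hF : IsSaturable F) : F.Finite := by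
  obtain ⟨B, hB⟩ := hF.bounded
  exact (Set.finite_Iic (fun _ : N => B)).subset fun μ hμ v => hB μ hμ v

theorem IsSaturable.sum_le_rank (hF : IsSaturable F) {μ : N → ℕ} (hμ : μ ∈ F) (S : Finset N) :
    ∑ v ∈ S, μ v ≤ rank F S :=
  le_csSup (hF.finite.image _).bddAbove ⟨μ, hμ, rfl⟩

theorem IsSaturable.exists_sum_eq_rank (hF : IsSaturable F) (S : Finset N) :
    ∃ μ ∈ F, ∑ v ∈ S, μ v = rank F S :=
  Set.Nonempty.csSup_mem (Set.Nonempty.image _ ⟨0, hF.zero_mem⟩) (hF.finite.image _)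

theorem sum_add_single (μ : N → ℕ) (v : N) (S : Finset N) :
    ∑ u ∈ S, (μ + Pi.single v 1 : N → ℕ) u = ∑ u ∈ S, μ u + if v ∈ S then 1 else 0 := by
  simp [Finset.sum_add_distrib, Pi.single_apply]

/-- Vectors can be extended on `U` until they cannot be increased there. -/
theorem IsSaturable.exists_extension (hF : IsSaturable F) {ν : N → ℕ} (hν : ν ∈ F)
    (U : Finset N) : ∃ ν' ∈ F, ν ≤ ν' ∧ (∀ v ∉ U, ν' v = ν v) ∧
      ∀ v ∈ U, ν' + Pi.single v 1 ∉ F := by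
  obtain ⟨ν', h⟩ := Set.Finite.exists_maximal
    (hF.finite.subset (Set.sep_subset F fun ν' => ν ≤ ν' ∧ ∀ v ∉ U, ν' v = ν v))
    ⟨ν, hν, le_rfl, fun _ _ => rfl⟩
  refine ⟨ν', h.prop.1, h.prop.2.1, h.prop.2.2, fun v hv hmem => ?_⟩
  have hle : ν' ≤ ν' + Pi.single v 1 := le_self_add
  have := h.le_of_ge ⟨hmem, h.prop.2.1.trans hle, fun u hu => ?_⟩ hle v
  · simp at this
  · have : u ≠ v := fun h => hu (h ▸ hv)
    simpa [this] using h.prop.2.2 u hu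

/-- Saturation makes `ν` maximal only on some `Z ⊇ U`; as `ν` vanishes outside `U`, its sums over
`Z` and `U` coincide. -/
theorem IsSaturable.rank_eq (hF : IsSaturable F) {ν : N → ℕ} (hν : ν ∈ F) {U : Finset N}
    (h0 : ∀ v ∉ U, ν v = 0) (hU : ∀ v ∈ U, ν + Pi.single v 1 ∉ F) :
    rank F U = ∑ v ∈ U, ν v := by
  obtain ⟨Z, hZ, hmax⟩ := hF.saturated ν hν U hU
  obtain ⟨μ, hμ, h⟩ := hF.exists_sum_eq_rank U
  refine le_antisymm ?_ (hF.sum_le_rank hν U)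
  calc rank F U = ∑ v ∈ U, μ v := h.symm
    _ ≤ ∑ v ∈ Z, μ v := Finset.sum_le_sum_of_subset hZ
    _ ≤ ∑ v ∈ Z, ν v := hmax μ hμ
    _ = ∑ v ∈ U, ν v := (Finset.sum_subset hZ fun v _ hv => h0 v hv).symm

/-- A vector that is saturated on `S ∩ T` is extended to one that is saturated on `S ∪ T`. This
single vector attains both ranks on the left-hand side, and its sums over `S` and `T` are at most
the ranks on the right. -/
theorem IsSaturable.rank_submodular (hF : IsSaturable F) (S T : Finset N) :
    rank F (S ∪ T) + rank F (S ∩ T) ≤ rank F S + rank F T := by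
  obtain ⟨ν, hν, -, h0, hI⟩ := hF.exists_extension hF.zero_mem (S ∩ T)
  obtain ⟨ν', hν', hle, h0', hU⟩ := hF.exists_extension hν (S ∪ T)
  have e1 : rank F (S ∩ T) = ∑ v ∈ S ∩ T, ν v := hF.rank_eq hν h0 hI
  have e2 : rank F (S ∪ T) = ∑ v ∈ S ∪ T, ν' v := hF.rank_eq hν' (fun v hv => by
    rw [h0' v hv]
    exact h0 v fun h => hv (Finset.mem_union_left _ (Finset.mem_inter.1 h).1)) hU
  have e3 : ∑ v ∈ S ∩ T, ν v ≤ ∑ v ∈ S ∩ T, ν' v := Finset.sum_le_sum fun v _ => hle v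
  have e4 := Finset.sum_union_inter (s₁ := S) (s₂ := T) (f := ν')
  have e5 := hF.sum_le_rank hν' S
  have e6 := hF.sum_le_rank hν' T
  omega

/-- Take a maximal `ν ≤ μ` in `F`. If `ν v < μ v`, then `ν` is saturated at `v`, hence attains the
rank of some `Z` containing `v`, and `μ` violates the inequality for `Z`. -/
theorem IsSaturable.mem_of_sum_le (hF : IsSaturable F) {μ : N → ℕ}
    (h : ∀ S, ∑ v ∈ S, μ v ≤ rank F S) : μ ∈ F := by
  obtain ⟨ν, hν⟩ := Set.Finite.exists_maximal
    (hF.finite.subset (Set.sep_subset F fun ν => ν ≤ μ)) ⟨0, hF.zero_mem, fun _ => Nat.zero_le _⟩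
  by_contra hμ
  obtain ⟨v, hv⟩ : ∃ v, ν v < μ v := by
    by_contra! hle
    exact hμ (hF.lower hν.prop.1 hle)
  have hnot : ν + Pi.single v 1 ∉ F := fun hmem => by
    have := hν.le_of_ge ⟨hmem, fun u => ?_⟩ le_self_add v
    · simp at this
    · by_cases huv : u = v
      · subst huv
        simpa using hv
      · simpa [huv] using hν.prop.2 u
  obtain ⟨Z, hZ, hmax⟩ := hF.saturated ν hν.prop.1 {v} (by simpa using hnot)
  obtain ⟨μ', hμ', h'⟩ := hF.exists_sum_eq_rank Z
  have h1 := hmax μ' hμ'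
  have h2 := h Z
  have h3 : ∑ v ∈ Z, ν v < ∑ v ∈ Z, μ v :=
    Finset.sum_lt_sum (fun u _ => hν.prop.2 u) ⟨v, hZ (Finset.mem_singleton_self v), hv⟩
  omega

/-! ### Optimality of the greedy algorithm -/

/-- Nonpositivity on level sets carries over to weighted sums. -/
theorem sum_mul_nonpos_of_levels (w z : N → ℝ) (hw : ∀ v, 0 ≤ w v)
    (h : ∀ t, 0 < t → ∑ v with t ≤ w v, z v ≤ 0) : ∑ v, w v * z v ≤ 0 := by
  generalize hk : (Finset.univ.filter fun v => 0 < w v).card = k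
  induction k using Nat.strong_induction_on generalizing w with
  | _ k ih =>
    rcases (Finset.univ.filter fun v => 0 < w v).eq_empty_or_nonempty with he | hne
    · refine (Finset.sum_eq_zero fun v _ => ?_).le
      have : ¬ 0 < w v := fun hv => by
        have : v ∈ (Finset.univ.filter fun v => 0 < w v) := by simpa using hv
        simp [he] at this
      rw [le_antisymm (not_lt.1 this) (hw v), zero_mul]
    -- Subtracting the smallest positive weight from all positive weights splits off a multiple of
    -- one level sum; the level sets that remain are those of `w`, shifted.
    · obtain ⟨a, ha, hmin⟩ := Finset.exists_min_image _ w hne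
      have ha : 0 < w a := by simpa using ha
      have hmin : ∀ v, 0 < w v → w a ≤ w v := fun v hv => hmin v (by simpa using hv)
      have hlt : (Finset.univ.filter fun v => 0 < max (w v - w a) 0).card < k := by
        rw [← hk]
        refine Finset.card_lt_card (Finset.ssubset_iff_of_subset ?_ |>.2 ⟨a, ?_, ?_⟩)
        · intro v hv
          simp only [Finset.mem_filter, Finset.mem_univ, true_and, lt_max_iff, lt_self_iff_false,
            or_false] at hv ⊢
          linarith
        · simpa using ha
        · simp
      have h1 := ih _ hlt (fun v => max (w v - w a) 0) (fun v => le_max_right _ _)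
        (fun t ht => by
          refine le_trans (le_of_eq (Finset.sum_congr ?_ fun _ _ => rfl)) (h (t + w a) (by linarith))
          ext v
          simp only [Finset.mem_filter, Finset.mem_univ, true_and, le_max_iff]
          constructor
          · rintro (h | h) <;> linarith
          · intro h
            left
            linarith) rfl
      have h2 := mul_nonpos_of_nonneg_of_nonpos ha.le (h _ ha)
      have h3 : ∑ v, w v * z v =
          ∑ v, max (w v - w a) 0 * z v + w a * ∑ v with w a ≤ w v, z v := by
        rw [Finset.sum_filter, Finset.mul_sum, ← Finset.sum_add_distrib]
        refine Finset.sum_congr rfl fun v _ => ?_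
        split_ifs with hv
        · rw [max_eq_left (by linarith)]
          ring
        · have : w v = 0 := le_antisymm (not_lt.1 fun h => hv (hmin v h)) (hw v)
          rw [this, max_eq_right (by linarith)]
          ring
      linarith

/-- Optimality of greedy vectors: the entries with nonpositive weight vanish, and no entry with
positive weight can be increased if the entries of smaller weight are erased. -/
theorem IsSaturable.greedy_optimal (hF : IsSaturable F) {w : N → ℝ} {ν : N → ℕ} (hν : ν ∈ F)
    (h0 : ∀ v, w v ≤ 0 → ν v = 0)
    (hsat : ∀ v, 0 < w v → (fun u => if w v ≤ w u then ν u else 0) + Pi.single v 1 ∉ F)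
    {x : N → ℝ} (hx0 : ∀ v, 0 ≤ x v) (hx : ∀ S, ∑ v ∈ S, x v ≤ rank F S) :
    ∑ v, w v * x v ≤ ∑ v, w v * ν v := by
  have hlev : ∀ t, 0 < t → ∑ v with t ≤ w v, x v ≤ ∑ v with t ≤ w v, (ν v : ℝ) := by
    intro t ht
    -- The entries below level `t` being erased, no entry on the level set can be increased: erasing
    -- further, up to the level of that entry, would contradict `hsat`.
    have hr := hF.rank_eq (ν := fun u => if t ≤ w u then ν u else 0)
      (U := Finset.univ.filter fun v => t ≤ w v)
      (hF.lower hν fun u => by dsimp only; split_ifs <;> simp)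
      (fun v hv => if_neg (by simpa using hv))
      (fun v hv hmem => by
        have hv : t ≤ w v := by simpa using hv
        refine hsat v (ht.trans_le hv) (hF.lower hmem ?_)
        refine add_le_add (fun u => ?_) le_rfl
        dsimp only
        split_ifs with h1 h2
        · exact le_rfl
        · exact absurd (hv.trans h1) h2
        · exact Nat.zero_le _
        · exact le_rfl)
    refine (hx _).trans (le_of_eq ?_)
    rw [hr]
    push_cast
    refine Finset.sum_congr rfl fun v hv => ?_
    rw [if_pos (by simpa using hv)]
  have h := sum_mul_nonpos_of_levels (fun v => max (w v) 0) (fun v => x v - ν v)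
    (fun v => le_max_right _ _) (fun t ht => by
      have e : (Finset.univ.filter fun v => t ≤ max (w v) 0) =
          Finset.univ.filter fun v => t ≤ w v := by
        ext v
        simp only [Finset.mem_filter, Finset.mem_univ, true_and, le_max_iff]
        exact ⟨fun h => h.resolve_right (not_le.2 ht), Or.inl⟩
      rw [e, Finset.sum_sub_distrib]
      exact sub_nonpos.2 (hlev t ht))
  -- Raising a negative weight to `0` only helps here, because `ν` vanishes there and `x` is
  -- nonnegative.
  have h' : ∑ v, w v * (x v - ν v) ≤ ∑ v, max (w v) 0 * (x v - ν v) := by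
    refine Finset.sum_le_sum fun v _ => ?_
    rcases le_total (w v) 0 with hv | hv
    · rw [h0 v hv, max_eq_right hv, zero_mul]
      exact mul_nonpos_of_nonpos_of_nonneg hv (by simpa using hx0 v)
    · rw [max_eq_left hv]
  have : ∑ v, w v * (x v - ν v) = ∑ v, w v * x v - ∑ v, w v * ν v := by
    rw [← Finset.sum_sub_distrib]
    exact Finset.sum_congr rfl fun v _ => by ring
  linarith

/-- The vertices are inserted by decreasing weight, and the vector is extended at each one as far as
possible. Entries saturated earlier stay saturated, since the vectors only grow and `F` is
down-closed. -/
theorem IsSaturable.exists_greedy (hF : IsSaturable F) (w : N → ℝ) :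
    ∃ ν ∈ F, (∀ v, w v ≤ 0 → ν v = 0) ∧
      ∀ v, 0 < w v → (fun u => if w v ≤ w u then ν u else 0) + Pi.single v 1 ∉ F := by
  have key : ∀ A : Finset N, ∃ ν ∈ F, (∀ v ∉ A, ν v = 0) ∧
      ∀ v ∈ A, (fun u => if w v ≤ w u then ν u else 0) + Pi.single v 1 ∉ F := by
    intro A
    induction A using Finset.induction_on_min_value w with
    | empty => exact ⟨0, hF.zero_mem, by simp, by simp⟩
    | insert a A haA hmin ih =>
      obtain ⟨ν, hν, h0, hsat⟩ := ih
      obtain ⟨ν', hν', hle, h0', hsat'⟩ := hF.exists_extension hν {a}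
      refine ⟨ν', hν', fun v hv => ?_, fun v hv hmem => ?_⟩
      · rw [Finset.mem_insert, not_or] at hv
        rw [h0' v (by simpa using hv.1), h0 v hv.2]
      · rcases Finset.mem_insert.1 hv with rfl | hv
        · refine hsat' v (Finset.mem_singleton_self v) (hF.lower hmem (add_le_add (fun u => ?_) le_rfl))
          dsimp only
          split_ifs with hu
          · exact le_rfl
          · have huv : u ≠ v := fun h => hu (h ▸ le_rfl)
            have huA : u ∉ A := fun h => hu (hmin u h)
            rw [h0' u (by simpa using huv), h0 u huA]
        · refine hsat v hv (hF.lower hmem (add_le_add (fun u => ?_) le_rfl))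
          dsimp only
          split_ifs
          · exact hle u
          · exact le_rfl
  obtain ⟨ν, hν, h0, hsat⟩ := key (Finset.univ.filter fun v => 0 < w v)
  exact ⟨ν, hν, fun v hv => h0 v (by simpa using hv), fun v hv => hsat v (by simpa using hv)⟩

/-! ### The convex hull and its integral points -/

/-- The points of `ℝ^N` with the entries of a vector in `F`. -/
def realPoints (F : Set (N → ℕ)) : Set (N → ℝ) :=
  {x | ∃ μ ∈ F, ∀ v, x v = (μ v : ℝ)}

/-- A point of the polyhedron outside the hull would be strictly separated from it by a linear
function; but the greedy vector for the coefficients of this function does at least as well as the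
point. -/
theorem IsSaturable.convexHull_eq (hF : IsSaturable F) :
    convexHull ℝ (realPoints F) =
      {x : N → ℝ | (∀ i, 0 ≤ x i) ∧ ∀ S : Finset N, ∑ i ∈ S, x i ≤ (rank F S : ℝ)} := by
  apply Set.Subset.antisymm
  · refine convexHull_min ?_ ?_
    · rintro x ⟨μ, hμ, hx⟩
      refine ⟨fun i => by rw [hx]; positivity, fun S => ?_⟩
      simp only [hx]
      exact_mod_cast hF.sum_le_rank hμ S
    · rintro x ⟨hx0, hx⟩ y ⟨hy0, hy⟩ a b ha hb hab
      refine ⟨fun i => ?_, fun S => ?_⟩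
      · have := mul_nonneg ha (hx0 i)
        have := mul_nonneg hb (hy0 i)
        simp only [Pi.add_apply, Pi.smul_apply, smul_eq_mul]
        linarith
      · simp only [Pi.add_apply, Pi.smul_apply, smul_eq_mul, Finset.sum_add_distrib,
          ← Finset.mul_sum]
        calc a * ∑ i ∈ S, x i + b * ∑ i ∈ S, y i ≤ a * rank F S + b * rank F S :=
              add_le_add (mul_le_mul_of_nonneg_left (hx S) ha) (mul_le_mul_of_nonneg_left (hy S) hb)
          _ = rank F S := by rw [← add_mul, hab, one_mul]
  · rintro x ⟨hx0, hx⟩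
    by_contra hnot
    have hfin : (realPoints F).Finite := by
      refine (hF.finite.image fun μ v => (μ v : ℝ)).subset ?_
      rintro y ⟨μ, hμ, hy⟩
      exact ⟨μ, hμ, (funext hy).symm⟩
    obtain ⟨f, u, hfu, hu⟩ := geometric_hahn_banach_closed_point (convex_convexHull ℝ _)
      (hfin.isCompact_convexHull ℝ).isClosed hnot
    have hf : ∀ y, f y = ∑ v, f (Pi.single v 1) * y v := fun y => by
      have := f.toLinearMap.pi_apply_eq_sum_univ y
      simp only [ContinuousLinearMap.coe_coe, smul_eq_mul] at this
      rw [this]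
      refine Finset.sum_congr rfl fun v _ => ?_
      rw [mul_comm]
      congr 2
      ext i
      simp [Pi.single_apply, eq_comm]
    obtain ⟨ν, hν, h0, hsat⟩ := hF.exists_greedy fun v => f (Pi.single v 1)
    have h1 := hF.greedy_optimal hν h0 hsat hx0 hx
    have h2 := hfu (fun v => (ν v : ℝ)) (subset_convexHull ℝ _ ⟨ν, hν, fun _ => rfl⟩)
    rw [hf] at hu h2
    linarith

theorem IsSaturable.integralPoints_eq (hF : IsSaturable F) :
    integralPoints (convexHull ℝ (realPoints F)) = realPoints F := by
  apply Set.Subset.antisymm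
  · rintro x ⟨hx, hint⟩
    rw [hF.convexHull_eq] at hx
    choose k hk using hint
    have hk0 : ∀ v, 0 ≤ k v := fun v => by
      have := hx.1 v
      rw [hk] at this
      exact_mod_cast this
    have hxk : ∀ v, x v = ((k v).toNat : ℝ) := fun v => by
      rw [hk]
      exact_mod_cast (Int.toNat_of_nonneg (hk0 v)).symm
    refine ⟨fun v => (k v).toNat, hF.mem_of_sum_le fun S => ?_, hxk⟩
    have := hx.2 S
    simp only [hxk] at this
    exact_mod_cast this
  · rintro x ⟨μ, hμ, hx⟩
    exact ⟨subset_convexHull ℝ _ ⟨μ, hμ, hx⟩, fun v => ⟨μ v, by simpa using hx v⟩⟩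

theorem IsSaturable.isPolymatroid (hF : IsSaturable F) :
    IsPolymatroid (convexHull ℝ (realPoints F)) := by
  refine ⟨rank F, fun S T => ?_, hF.convexHull_eq⟩
  convert hF.rank_submodular S T

theorem IsSaturable.comp_equiv {M : Type*} [Fintype M] [DecidableEq M] (hF : IsSaturable F)
    (e : N ≃ M) : IsSaturable {μ : M → ℕ | μ ∘ e ∈ F} where
  zero_mem := hF.zero_mem
  lower := fun _ hμ _ hle => hF.lower hμ fun v => hle (e v)
  bounded := by
    obtain ⟨B, hB⟩ := hF.bounded
    exact ⟨B, fun μ hμ v => by simpa using hB _ hμ (e.symm v)⟩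
  saturated := by
    intro μ hμ U hU
    obtain ⟨Z, hZ, hmax⟩ := hF.saturated _ hμ (U.map e.symm.toEmbedding) (by
      intro v hv hmem
      refine hU (e v) (by simpa using hv) ?_
      have : (μ + Pi.single (e v) 1) ∘ e = μ ∘ e + Pi.single v 1 := by
        ext u
        simp [Pi.single_apply]
      rw [Set.mem_ofPred_eq, this]
      exact hmem)
    refine ⟨Z.map e.toEmbedding, fun v hv => ?_, fun μ' hμ' => ?_⟩
    · have := hZ (Finset.mem_map_of_mem e.symm.toEmbedding hv)
      simpa [Finset.mem_map_equiv] using this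
    · simpa using hmax _ hμ'

end Saturable

theorem Orientable.isSaturable {V E : Type*} [Fintype V] [Fintype E] [DecidableEq V]
    {ends : E → V × V} {r : V} (h : Orientable ends r 0) :
    IsSaturable {μ | Orientable ends r μ} where
  zero_mem := h
  lower := fun _ hμ _ hle => hμ.mono hle
  bounded := ⟨Fintype.card E, fun _ hμ v => hμ.le_card v⟩
  saturated := fun _ hμ U hU => hμ.exists_saturated U hU

/-! ## Feasible split vectors and orientations -/

section Coding

variable {α β α' β' : Type*}

/-- Numberings of the vertices and edges of `G` that identify it with the edge list `I`. -/
structure Coding (G : Graph α β) (I : EdgeList) where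
  vert : Fin I.n ≃ V(G)
  edge : Fin I.m ≃ E(G)
  isLink_iff : ∀ e u v,
    G.IsLink (edge e) (vert u) (vert v) ↔ I.ends e = (u, v) ∨ I.ends e = (v, u)

/-- The graph of an edge list is coded by that edge list. -/
def EdgeList.coding (I : EdgeList) : Coding I.toGraph I where
  vert := (Equiv.Set.univ _).symm
  edge := (Equiv.Set.univ _).symm
  isLink_iff := fun _ _ _ => Iff.rfl

theorem exists_coding {G : Graph α β} (hV : V(G).Finite) (hE : E(G).Finite) :
    ∃ I, Nonempty (Coding G I) := by
  have := hV.fintype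
  have := hE.fintype
  let v := (Fintype.equivFin V(G)).symm
  let e := (Fintype.equivFin E(G)).symm
  have h : ∀ j, ∃ p : Fin (Fintype.card V(G)) × Fin (Fintype.card V(G)),
      G.IsLink (e j) (v p.1) (v p.2) := by
    intro j
    obtain ⟨x, y, hxy⟩ := Graph.exists_isLink_of_mem_edgeSet (e j).2
    exact ⟨(v.symm ⟨x, hxy.left_mem⟩, v.symm ⟨y, hxy.right_mem⟩), by simpa using hxy⟩
  choose ends hends using h
  refine ⟨⟨_, _, ends⟩, ⟨⟨v, e, fun j x y => ⟨fun h => ?_, ?_⟩⟩⟩⟩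
  · rcases (hends j).eq_and_eq_or_eq_and_eq h with ⟨h1, h2⟩ | ⟨h1, h2⟩
    · left
      exact Prod.ext (v.injective (Subtype.ext h1)) (v.injective (Subtype.ext h2))
    · right
      exact Prod.ext (v.injective (Subtype.ext h1)) (v.injective (Subtype.ext h2))
  · have := hends j
    rintro (h | h) <;> dsimp only at h
    · rwa [h] at this
    · rw [h] at this
      exact this.symm

variable {G : Graph α β} {I : EdgeList}

/-- The edges of `H` are mapped injectively to edges of `G` with the corresponding endpoints. -/
theorem Coding.exists_edge_map (C : Coding G I) {H : Graph α' β'} {φ : V(H) → V(G)}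
    (h : IsHomImage G H φ) : ∃ g : E(H) → Fin I.m, Function.Injective g ∧
      ∀ (f : E(H)) (x y : V(H)), H.IsLink f x y →
        I.ends (g f) = (C.vert.symm (φ x), C.vert.symm (φ y)) ∨
          I.ends (g f) = (C.vert.symm (φ y), C.vert.symm (φ x)) := by
  classical
  let ψ : V(H) → Fin I.n := fun x => C.vert.symm (φ x)
  let A : Sym2 (Fin I.n) → Set (Fin I.m) := fun s => {e | s((I.ends e).1, (I.ends e).2) = s}
  let B : Sym2 (Fin I.n) → Set β' := fun s =>
    {f | ∃ x y : V(H), H.IsLink f x y ∧ s(ψ x, ψ y) = s}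
  have hcard : ∀ s, (B s).encard = (A s).encard := by
    intro s
    induction s using Sym2.ind with
    | _ u v =>
      have hB : B s(u, v) =
          {f | ∃ x y : V(H), H.IsLink f x y ∧ φ x = C.vert u ∧ φ y = C.vert v} := by
        ext f
        constructor
        · rintro ⟨x, y, hxy, h⟩
          rw [Sym2.eq_iff] at h
          rcases h with ⟨h1, h2⟩ | ⟨h1, h2⟩
          · exact ⟨x, y, hxy, by simp [← h1, ψ], by simp [← h2, ψ]⟩
          · exact ⟨y, x, hxy.symm, by simp [← h2, ψ], by simp [← h1, ψ]⟩
        · rintro ⟨x, y, hxy, h1, h2⟩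
          exact ⟨x, y, hxy, by simp [ψ, h1, h2]⟩
      have hA : {e | G.IsLink e (C.vert u) (C.vert v)} =
          (fun j => (C.edge j : β)) '' A s(u, v) := by
        ext e
        constructor
        · intro he
          refine ⟨C.edge.symm ⟨e, he.edge_mem⟩, ?_, by simp⟩
          have := (C.isLink_iff (C.edge.symm ⟨e, he.edge_mem⟩) u v).1 (by simpa using he)
          rcases this with h | h <;> simp [A, h]
        · rintro ⟨j, hj, rfl⟩
          refine (C.isLink_iff j u v).2 ?_
          simp only [A, Set.mem_ofPred_eq, Sym2.eq_iff] at hj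
          rcases hj with ⟨h1, h2⟩ | ⟨h1, h2⟩
          · exact Or.inl (Prod.ext h1 h2)
          · exact Or.inr (Prod.ext h1 h2)
      rw [hB, ← h.2, hA, Function.Injective.encard_image]
      exact fun i j hij => C.edge.injective (Subtype.ext hij)
  -- A homomorphic image prescribes only the sizes of the classes of edges with given ends, so an
  -- injection is chosen for each class. The ends of an edge of `G` determine its class, hence the
  -- injections combine to one.
  have hemb : ∀ s, ∃ k : B s → A s, Function.Injective k := by
    intro s
    have hfin : (B s).Finite := by
      rw [← Set.encard_lt_top_iff, hcard]
      exact (Set.toFinite (A s)).encard_lt_top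
    have := hfin.fintype
    have hle : Fintype.card (B s) ≤ Fintype.card (A s) := by
      have := hcard s
      rw [Set.encard_eq_coe_toFinset_card, Set.encard_eq_coe_toFinset_card, Set.toFinset_card,
        Set.toFinset_card] at this
      exact_mod_cast this.le
    obtain ⟨k⟩ := Function.Embedding.nonempty_of_card_le hle
    exact ⟨k, k.injective⟩
  choose k hk using hemb
  have hcls : ∀ f : E(H), ∃ s, (f : β') ∈ B s := fun f => by
    obtain ⟨x, y, hxy⟩ := Graph.exists_isLink_of_mem_edgeSet f.2
    exact ⟨_, ⟨x, hxy.left_mem⟩, ⟨y, hxy.right_mem⟩, hxy, rfl⟩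
  choose c hc using hcls
  have hkA : ∀ s b, s((I.ends (k s b)).1, (I.ends (k s b)).2) = s := fun s b => (k s b).2
  have hinj : ∀ s s' (b : B s) (b' : B s'), s = s' → (k s b : Fin I.m) = k s' b' →
      (b : β') = b' := by
    rintro s _ b b' rfl h
    exact congrArg Subtype.val (hk s (Subtype.ext h))
  refine ⟨fun f => k (c f) ⟨f, hc f⟩, fun f f' hff' => ?_, fun f x y hxy => ?_⟩
  · refine Subtype.ext (hinj _ _ ⟨f, hc f⟩ ⟨f', hc f'⟩ ?_ hff')
    rw [← hkA (c f) ⟨f, hc f⟩, ← hkA (c f') ⟨f', hc f'⟩]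
    dsimp only at hff'
    rw [hff']
  · have h1 := hkA (c f) ⟨f, hc f⟩
    obtain ⟨x', y', hxy', h2⟩ := hc f
    have h3 : s(ψ x', ψ y') = s(ψ x, ψ y) := by
      rcases hxy'.eq_and_eq_or_eq_and_eq hxy with ⟨h1, h2⟩ | ⟨h1, h2⟩
      · rw [Subtype.ext h1, Subtype.ext h2]
      · rw [Subtype.ext h1, Subtype.ext h2, Sym2.eq_swap]
    replace h1 := h1.trans (h2.symm.trans h3)
    rw [Sym2.eq_iff] at h1
    rcases h1 with ⟨h1, h2⟩ | ⟨h1, h2⟩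
    · exact Or.inl (Prod.ext h1 h2)
    · exact Or.inr (Prod.ext h1 h2)

/-! ### From certificates to orientations -/

theorem exists_adj_dist_lt {W : Type*} {S : SimpleGraph W} (hS : S.Connected) {r w : W}
    (h : w ≠ r) : ∃ p, S.Adj p w ∧ S.dist r p < S.dist r w := by
  obtain ⟨q, hq⟩ := hS.exists_walk_length_eq_dist w r
  cases q with
  | nil => exact absurd rfl h
  | @cons _ p _ hp q =>
    refine ⟨p, hp.symm, ?_⟩
    rw [S.dist_comm, S.dist_comm (u := r), ← hq, SimpleGraph.Walk.length_cons]
    exact Nat.lt_succ_of_le (SimpleGraph.dist_le q)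

/-- A certificate yields an orientation: orient the edges of a breadth first search tree of `H`
away from its root. -/
theorem Coding.orientable (C : Coding G I) {μ : V(G) → ℕ} (h : IsFeasibleSplit G μ)
    (r : Fin I.n) : Orientable I.ends r fun v => μ (C.vert v) := by
  classical
  obtain ⟨α', β', H, φ, hconn, hhom, hmult⟩ := h
  obtain ⟨g, hg, hends⟩ := C.exists_edge_map hhom
  obtain ⟨r₀, hr₀⟩ := hhom.1 (C.vert r)
  have hpar : ∀ w : {w // w ≠ r₀}, ∃ (p : V(H)) (f : E(H)), H.IsLink f p w.1 ∧
      H.toSimpleGraph.dist r₀ p < H.toSimpleGraph.dist r₀ w.1 := by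
    rintro ⟨w, hw⟩
    obtain ⟨p, ⟨-, f, hf⟩, hlt⟩ := exists_adj_dist_lt hconn hw
    exact ⟨p, ⟨f, hf.edge_mem⟩, hf, hlt⟩
  choose p f hf hlt using hpar
  let ψ : V(H) → Fin I.n := fun x => C.vert.symm (φ x)
  have hinj : Function.Injective fun w => g (f w) := by
    intro w w' h
    have hff := hg h
    have h1 := hf w
    rw [hff] at h1
    rcases h1.eq_and_eq_or_eq_and_eq (hf w') with ⟨-, h⟩ | ⟨h2, h3⟩
    · exact Subtype.ext (Subtype.ext h)
    -- Here the common edge would make `w` and `w'` parents of each other, each closer to `r₀` than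
    -- the other.
    · have e1 := hlt w
      have e2 := hlt w'
      rw [Subtype.ext h2] at e1
      rw [← Subtype.ext h3] at e2
      omega
  -- Edges that are not images of parent edges keep the orientation given by `ends`.
  let D := Function.extend (fun w => g (f w)) (fun w => (ψ (p w), ψ w.1)) I.ends
  have hD : ∀ w, D (g (f w)) = (ψ (p w), ψ w.1) := fun w => hinj.extend_apply _ _ w
  have hreach : ∀ (k : ℕ) (w : V(H)), H.toSimpleGraph.dist r₀ w = k → Reaches D r (ψ w) := by
    intro k
    induction k using Nat.strong_induction_on with
    | _ k ih =>
      intro w hw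
      by_cases hwr : w = r₀
      · have : ψ w = r := by simp [ψ, hwr, hr₀]
        rw [this]
        exact Reaches.refl D r
      · have := ih _ (hw ▸ hlt ⟨w, hwr⟩) _ rfl
        exact this.tail ⟨_, hD ⟨w, hwr⟩⟩
  refine ⟨D, fun e => ?_, fun v => ?_, fun v => ?_⟩
  · by_cases he : ∃ w, g (f w) = e
    · obtain ⟨w, rfl⟩ := he
      rw [hD]
      rcases hends (f w) _ _ (hf w) with h | h <;> simp [h, ψ]
    · exact Or.inl (Function.extend_apply' _ _ _ he)
  · obtain ⟨w, hw⟩ := hhom.1 (C.vert v)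
    have := hreach _ w rfl
    simpa [ψ, hw] using this
  · have hm := hmult (C.vert v)
    have hfin : (φ ⁻¹' {C.vert v}).Finite := by
      rw [← Set.encard_lt_top_iff, hm]
      exact ENat.natCast_lt_top _
    have hcard : hfin.toFinset.card = μ (C.vert v) + 1 := by
      rw [hfin.encard_eq_coe_toFinset_card] at hm
      exact_mod_cast hm
    -- All copies of `v` except `r₀` have their own parent edges, whose images enter `v`. Only the
    -- root `r` loses a copy in this way, and `r` is the one vertex that needs no arc to be reached.
    have hle : (hfin.toFinset.erase r₀).card ≤ indeg D v := by
      have hne : ∀ w ∈ hfin.toFinset.erase r₀, w ≠ r₀ := fun w hw => Finset.ne_of_mem_erase hw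
      rw [← Finset.filter_true_of_mem hne, ← Finset.card_subtype]
      refine Finset.card_le_card_of_injOn (fun w => g (f w)) (fun w hw => ?_) hinj.injOn
      have : φ w.1 = C.vert v := by simpa using Finset.mem_of_mem_erase (Finset.mem_subtype.1 hw)
      simp [hD, ψ, this]
    rw [Finset.card_erase_eq_ite, hcard] at hle
    by_cases hv : v = r
    · subst hv
      simp only [if_true]
      split_ifs at hle <;> omega
    · have : r₀ ∉ hfin.toFinset := by
        simpa [hr₀] using fun h => hv h.symm
      rw [if_neg this] at hle
      simpa [hv] using hle

/-- Certificates for the graph of an edge list are certificates for every graph coded by it. -/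
theorem Coding.isFeasibleSplit (C : Coding G I) {μ : V(G) → ℕ}
    (h : IsFeasibleSplit I.toGraph fun v => μ (C.vert v.1)) : IsFeasibleSplit G μ := by
  obtain ⟨α', β', H, φ, hconn, ⟨hsurj, hlink⟩, hmult⟩ := h
  refine ⟨α', β', H, fun w => C.vert (φ w).1, hconn, ⟨fun v => ?_, fun u v => ?_⟩, fun v => ?_⟩
  · obtain ⟨w, hw⟩ := hsurj (I.vert (C.vert.symm v))
    exact ⟨w, by simp [hw, EdgeList.vert]⟩
  · have h1 := hlink (I.vert (C.vert.symm u)) (I.vert (C.vert.symm v))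
    have h2 : {e | G.IsLink e u v} = (fun j => (C.edge j : β)) ''
        {e | I.toGraph.IsLink e (C.vert.symm u) (C.vert.symm v)} := by
      ext e
      constructor
      · intro he
        refine ⟨C.edge.symm ⟨e, he.edge_mem⟩, ?_, by simp⟩
        exact (C.isLink_iff _ _ _).1 (by simpa using he)
      · rintro ⟨j, hj, rfl⟩
        simpa using (C.isLink_iff j _ _).2 hj
    rw [h2, Function.Injective.encard_image]
    · refine h1.trans (congrArg Set.encard ?_)
      ext f
      simp only [Set.mem_ofPred_eq]
      refine exists_congr fun x => exists_congr fun y => and_congr_right fun _ => ?_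
      rw [Subtype.ext_iff, Subtype.ext_iff (a1 := φ y)]
      simp [EdgeList.vert, Equiv.eq_symm_apply]
    · exact fun i j hij => C.edge.injective (Subtype.ext hij)
  · have := hmult (I.vert (C.vert.symm v))
    dsimp only [EdgeList.vert] at this
    rw [Equiv.apply_symm_apply] at this
    rw [← this]
    congr 1
    ext w
    change C.vert (φ w).1 = v ↔ φ w = I.vert (C.vert.symm v)
    exact ⟨fun h => Subtype.ext ((Equiv.eq_symm_apply C.vert).2 h),
      fun h => (Equiv.eq_symm_apply C.vert).1 (congrArg Subtype.val h)⟩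

end Coding

/-! ## Program logic -/

/-- A bound on the number of steps of a program all of whose loops are iterated at most `X`
times. -/
noncomputable def Program.cost : Program → Polynomial ℕ
  | .skip => 1
  | .write _ _ _ => 1
  | .seq c₁ c₂ => c₁.cost + c₂.cost
  | .ite _ c₁ c₂ => c₁.cost + c₂.cost + 1
  | .loop _ c => Polynomial.X * (c.cost + 1) + 1

/-- Started in `s`, the program `c` halts in a store that satisfies `Q`, and it takes no more steps
than if all loops were iterated `N` times. -/
def Runs (N : ℕ) (c : Program) (s : Store) (Q : Store → Prop) : Prop :=
  ∃ s' t, Exec c s s' t ∧ t ≤ c.cost.eval N ∧ Q s'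

notation:60 c₁:61 " ;; " c₂:60 => Program.seq c₁ c₂

/-- Run `c` with cell `0` of array `i` counting from `0` to `e - 1`. -/
def Program.for (i : ℕ) (e : Expr) (c : Program) : Program :=
  .write i (.const 0) (.const 0) ;;
    .loop (.sub e (.read i (.const 0)))
      (c ;; .write i (.const 0) (.add (.read i (.const 0)) (.const 1)))

section Runs

variable {N : ℕ} {s : Store} {Q Q' : Store → Prop}

theorem Runs.mono {c : Program} (h : Runs N c s Q) (hQ : ∀ s', Q s' → Q' s') : Runs N c s Q' := by
  obtain ⟨s', t, h1, h2, h3⟩ := h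
  exact ⟨s', t, h1, h2, hQ s' h3⟩

theorem Runs.skip (h : Q s) : Runs N .skip s Q :=
  ⟨s, 1, .skip s, by simp [Program.cost], h⟩

theorem Runs.write {a : ℕ} {i e : Expr} (h : Q (s.set a (i.eval s) (e.eval s))) :
    Runs N (.write a i e) s Q :=
  ⟨_, 1, .write a i e s, by simp [Program.cost], h⟩

theorem Runs.seq {c₁ c₂ : Program} (h : Runs N c₁ s fun s' => Runs N c₂ s' Q) :
    Runs N (c₁ ;; c₂) s Q := by
  obtain ⟨s', t, h1, h2, s'', t', h1', h2', h3⟩ := h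
  refine ⟨s'', t + t', .seq h1 h1', ?_, h3⟩
  rw [Program.cost, Polynomial.eval_add]
  omega

theorem Runs.ite {e : Expr} {c₁ c₂ : Program} (h₁ : 0 < e.eval s → Runs N c₁ s Q)
    (h₂ : ¬ 0 < e.eval s → Runs N c₂ s Q) : Runs N (.ite e c₁ c₂) s Q := by
  by_cases he : 0 < e.eval s
  · obtain ⟨s', t, h1, h2, h3⟩ := h₁ he
    refine ⟨s', t + 1, .ite_pos he h1, ?_, h3⟩
    simp only [Program.cost, Polynomial.eval_add, Polynomial.eval_one]
    omega
  · obtain ⟨s', t, h1, h2, h3⟩ := h₂ he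
    refine ⟨s', t + 1, .ite_neg he h1, ?_, h3⟩
    simp only [Program.cost, Polynomial.eval_add, Polynomial.eval_one]
    omega

/-- The rule for loops: `k` bounds the number of remaining iterations. -/
theorem Runs.loop {e : Expr} {c : Program} (J : ℕ → Store → Prop) {k : ℕ} (hk : k ≤ N)
    (h0 : J k s)
    (hstep : ∀ k s, J k s → 0 < e.eval s → Runs N c s fun s' => ∃ k' < k, J k' s')
    (hQ : ∀ k s, J k s → ¬ 0 < e.eval s → Q s) : Runs N (.loop e c) s Q := by
  have key : ∀ k s, J k s →
      ∃ s' t, Exec (.loop e c) s s' t ∧ t ≤ k * (c.cost.eval N + 1) + 1 ∧ Q s' := by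
    intro k
    induction k using Nat.strong_induction_on with
    | _ k ih =>
      intro s hs
      by_cases he : 0 < e.eval s
      · obtain ⟨s', t, h1, h2, k', hk', hs'⟩ := hstep k s hs he
        obtain ⟨s'', t', h1', h2', h3⟩ := ih k' hk' s' hs'
        refine ⟨s'', t + t' + 1, .loop_step he h1 h1', ?_, h3⟩
        have := Nat.mul_le_mul_right (c.cost.eval N + 1) hk'
        rw [Nat.succ_mul] at this
        omega
      · exact ⟨s, 1, .loop_done he, by omega, hQ k s hs he⟩
  obtain ⟨s', t, h1, h2, h3⟩ := key k s h0
  refine ⟨s', t, h1, h2.trans ?_, h3⟩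
  simp only [Program.cost, Polynomial.eval_add, Polynomial.eval_mul, Polynomial.eval_X,
    Polynomial.eval_one]
  exact Nat.add_le_add_right (Nat.mul_le_mul_right _ hk) _

@[simp] theorem Store.set_apply (s : Store) (a : ℕ) (k x : ℤ) (b : ℕ) :
    s.set a k x b = if b = a then Function.update (s a) k x else s b := by
  funext j
  by_cases hb : b = a
  · subst hb
    by_cases hj : j = k <;> simp [Store.set, hj]
  · simp [Store.set, hb]

theorem Store.set_ne (s : Store) {a b : ℕ} (k x : ℤ) (h : b ≠ a) : s.set a k x b = s b := by
  simp [h]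

/-- The rule for counting loops. -/
theorem Runs.for {i : ℕ} {e : Expr} {c : Program} (J : ℕ → Store → Prop) {K : ℕ} (hK : K ≤ N)
    (he : ∀ k s, J k s → e.eval s = K) (h0 : J 0 (s.set i 0 0))
    (hstep : ∀ k < K, ∀ s, J k s → s i 0 = k →
      Runs N c s fun s' => s' i 0 = k ∧ J (k + 1) (s'.set i 0 (k + 1)))
    (hQ : ∀ s, J K s → Q s) : Runs N (.for i e c) s Q := by
  refine .seq (.write ?_)
  -- `l` is the counter and `k` the number of remaining rounds.
  refine .loop (fun k s => ∃ l, l + k = K ∧ J l s ∧ s i 0 = l) hK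
    ⟨0, by simp, h0, by simp [Expr.eval]⟩ ?_ ?_
  · rintro k s ⟨l, hl, hJ, hs⟩ hpos
    have hlK : l < K := by
      rw [Expr.eval, he l s hJ] at hpos
      simp only [Expr.eval, hs] at hpos
      omega
    refine .seq ((hstep l hlK s hJ hs).mono ?_)
    rintro s' ⟨hs', hJ'⟩
    refine .write ⟨k - 1, by omega, l + 1, by omega, ?_, ?_⟩
    · simpa [Expr.eval, hs'] using hJ'
    · simp [Expr.eval, hs']
  · rintro k s ⟨l, hl, hJ, hs⟩ hpos
    rw [Expr.eval, he l s hJ] at hpos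
    simp only [Expr.eval, hs] at hpos
    obtain rfl : l = K := by omega
    exact hQ s hJ

/-- Polynomial running time follows from a bound on the iterations of the loops. -/
theorem solvableInPolyTime_of_runs {ι : Type*} {encode : ι → List ℤ} {valid : ι → Prop}
    {IsSolution : ι → List ℤ → Prop} (c : Program)
    (h : ∀ i, valid i → Runs (bitLength (encode i)) c (inputStore (encode i)) fun s =>
      ∃ out, HasOutput s out ∧ IsSolution i out) :
    SolvableInPolyTime encode valid IsSolution := by
  refine ⟨c, c.cost, fun i hi => ?_⟩
  obtain ⟨s, t, h1, h2, out, h3, h4⟩ := h i hi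
  exact ⟨s, t, out, h1, h2, h3, h4⟩

end Runs

/-! ## Stores that hold vectors and orientations -/

/-- The stores agree outside the listed arrays. -/
def Agree (L : List ℕ) (s s' : Store) : Prop :=
  ∀ a, a ∉ L → s' a = s a

theorem Agree.refl (L : List ℕ) (s : Store) : Agree L s s := fun _ _ => rfl

theorem Agree.trans {L : List ℕ} {s s' s'' : Store} (h : Agree L s s') (h' : Agree L s' s'') :
    Agree L s s'' := fun a ha => (h' a ha).trans (h a ha)

theorem Agree.mono {L L' : List ℕ} {s s' : Store} (h : Agree L s s') (hL : ∀ a ∈ L, a ∈ L') :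
    Agree L' s s' := fun a ha => h a fun h' => ha (hL a h')

theorem Agree.set {L : List ℕ} {s s' : Store} (h : Agree L s s') {a : ℕ} (ha : a ∈ L) (k x : ℤ) :
    Agree L s (s'.set a k x) := fun b hb => by
  rw [Store.set_ne _ _ _ (by rintro rfl; exact hb ha), h b hb]

/-- The array `a` holds the vector `f`. -/
def Holds {k : ℕ} (a : ℤ → ℤ) (f : Fin k → ℤ) : Prop :=
  ∀ i : Fin k, a ((i : ℕ) : ℤ) = f i

theorem Holds.update {k : ℕ} {a : ℤ → ℤ} {f : Fin k → ℤ} (h : Holds a f) (i : Fin k) (x : ℤ) :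
    Holds (Function.update a ((i : ℕ) : ℤ) x) (Function.update f i x) := by
  intro j
  by_cases hj : j = i
  · simp [hj]
  · have : ((j : ℕ) : ℤ) ≠ ((i : ℕ) : ℤ) := by
      exact_mod_cast fun h => hj (Fin.ext h)
    rw [Function.update_of_ne hj, Function.update_of_ne this, h j]

/-- The arrays `a` and `b` hold the tails and the heads of the arcs of `D`. -/
def HoldsArcs {n m : ℕ} (a b : ℤ → ℤ) (D : Fin m → Fin n × Fin n) : Prop :=
  Holds a (fun e => (((D e).1 : ℕ) : ℤ)) ∧ Holds b (fun e => (((D e).2 : ℕ) : ℤ))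

theorem HoldsArcs.swap {n m : ℕ} {a b : ℤ → ℤ} {D : Fin m → Fin n × Fin n} (h : HoldsArcs a b D)
    (e : Fin m) : HoldsArcs (Function.update a ((e : ℕ) : ℤ) (((D e).2 : ℕ) : ℤ))
      (Function.update b ((e : ℕ) : ℤ) (((D e).1 : ℕ) : ℤ))
      (Function.update D e (D e).swap) := by
  constructor
  · convert h.1.update e _ using 1
    funext i
    by_cases hi : i = e
    · subst hi
      simp
    · simp [hi]
  · convert h.2.update e _ using 1
    funext i
    by_cases hi : i = e
    · subst hi
      simp
    · simp [hi]

/-! ## Search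

The programs below use the following arrays. Scalars are kept in cell `0`.
* `2`, `3`: the numbers of vertices and edges
* `4`, `5`: tails and heads of the arcs of the current orientation
* `6`, `7`: marks and parent arcs of the search, `8`: its start vertex
* `9`: if positive, the search reorients arcs to reach more vertices
* `10`, `11`: counters, `20`: temporary
-/

/-- Cell `0` of array `a`. -/
abbrev Expr.cell (a : ℕ) : Expr := .read a (.const 0)

/-- Mark the head of the arc whose index is in array `11`. -/
def markHead : Program :=
  .write 7 (.read 5 (.cell 11)) (.cell 11) ;;
    .write 6 (.read 5 (.cell 11)) (.add (.read 6 (.read 4 (.cell 11))) (.const 1))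

/-- Reverse the arc whose index is in array `j`. -/
def swapArc (j : ℕ) : Program :=
  .write 20 (.const 0) (.read 4 (.cell j)) ;;
    .write 4 (.cell j) (.read 5 (.cell j)) ;;
    .write 5 (.cell j) (.cell 20)

/-- Extend the search along the arc whose index is in array `11`. -/
def searchStep : Program :=
  .ite (.read 6 (.read 4 (.cell 11)))
    (.ite (.sub (.const 1) (.read 6 (.read 5 (.cell 11)))) markHead .skip)
    (.ite (.cell 9)
      (.ite (.read 6 (.read 5 (.cell 11))) (swapArc 11 ;; markHead) .skip) .skip)

/-- Mark the vertices that can be reached from the vertex in array `8`. -/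
def search : Program :=
  .for 10 (.cell 2) (.write 6 (.cell 10) (.const 0)) ;;
    .write 6 (.cell 8) (.const 1) ;;
    -- A round over all arcs marks a new vertex unless the search is already complete, so as many
    -- rounds as there are vertices suffice.
    .for 10 (.cell 2) (.for 11 (.cell 3) searchStep)

section Search

variable {n m : ℕ}

/-- The vertices with positive mark. -/
def marked (mk : Fin n → ℕ) : Finset (Fin n) :=
  Finset.univ.filter fun v => 0 < mk v

/-- Every marked vertex except `src` has a parent arc that comes from a vertex with a smaller
mark. -/
structure SearchTree (D : Fin m → Fin n × Fin n) (src : Fin n) (mk : Fin n → ℕ) (pr : ℤ → ℤ) :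
    Prop where
  root : mk src = 1
  -- Marks are thus bounded by the number of vertices, which bounds the iterations of `reversePath`.
  le_card : ∀ v, mk v ≤ (marked mk).card
  parent : ∀ v, v ≠ src → 0 < mk v → ∃ e : Fin m, pr ((v : ℕ) : ℤ) = ((e : ℕ) : ℤ) ∧
    (D e).2 = v ∧ 0 < mk (D e).1 ∧ mk (D e).1 < mk v

/-- Among marked vertices only the start has mark `1`, which is how `reversePath` recognizes its
end. -/
theorem SearchTree.two_le {D : Fin m → Fin n × Fin n} {src : Fin n} {mk : Fin n → ℕ} {pr : ℤ → ℤ}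
    (h : SearchTree D src mk pr) {v : Fin n} (hv : v ≠ src) (h0 : 0 < mk v) : 2 ≤ mk v := by
  obtain ⟨e, -, -, h1, h2⟩ := h.parent v hv h0
  omega

theorem SearchTree.reaches {D : Fin m → Fin n × Fin n} {src : Fin n} {mk : Fin n → ℕ} {pr : ℤ → ℤ}
    (h : SearchTree D src mk pr) {v : Fin n} (hv : 0 < mk v) : Reaches D src v := by
  generalize hk : mk v = k
  induction k using Nat.strong_induction_on generalizing v with
  | _ k ih =>
    by_cases hvs : v = src
    · rw [hvs]
      exact Reaches.refl D src
    · obtain ⟨e, -, h1, h2, h3⟩ := h.parent v hvs hv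
      exact (ih _ (hk ▸ h3) h2 rfl).tail ⟨e, Prod.ext rfl h1⟩

theorem marked_update {mk : Fin n → ℕ} {v : Fin n} {x : ℕ} (hx : 0 < x) :
    marked (Function.update mk v x) = insert v (marked mk) := by
  ext u
  by_cases hu : u = v
  · simp [marked, hu, hx]
  · simp [marked, hu]

theorem SearchTree.mark {D : Fin m → Fin n × Fin n} {src : Fin n} {mk : Fin n → ℕ} {pr : ℤ → ℤ}
    (h : SearchTree D src mk pr) {e : Fin m} (h1 : 0 < mk (D e).1) (h2 : mk (D e).2 = 0) :
    SearchTree D src (Function.update mk (D e).2 (mk (D e).1 + 1))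
        (Function.update pr (((D e).2 : ℕ) : ℤ) ((e : ℕ) : ℤ)) ∧
      (marked mk).card < (marked (Function.update mk (D e).2 (mk (D e).1 + 1))).card := by
  have hcard : (marked (Function.update mk (D e).2 (mk (D e).1 + 1))).card =
      (marked mk).card + 1 := by
    rw [marked_update (Nat.succ_pos _), Finset.card_insert_of_notMem]
    simp [marked, h2]
  have hne : ∀ v, 0 < mk v → v ≠ (D e).2 := by
    rintro v hv rfl
    omega
  refine ⟨⟨?_, fun v => ?_, fun v hv h0 => ?_⟩, by omega⟩
  · rw [Function.update_of_ne (hne _ (by rw [h.root]; exact Nat.one_pos)), h.root]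
  · rw [hcard]
    by_cases hv : v = (D e).2
    · subst hv
      rw [Function.update_self]
      exact Nat.add_le_add_right (h.le_card _) _
    · rw [Function.update_of_ne hv]
      exact (h.le_card v).trans (Nat.le_succ _)
  · by_cases hve : v = (D e).2
    · subst hve
      refine ⟨e, by simp, rfl, ?_⟩
      rw [Function.update_of_ne (hne _ h1), Function.update_self]
      omega
    · have hcast : ((v : ℕ) : ℤ) ≠ (((D e).2 : ℕ) : ℤ) := by
        exact_mod_cast fun h => hve (Fin.ext h)
      rw [Function.update_of_ne hve] at h0
      obtain ⟨i, h3, h4, h5, h6⟩ := h.parent v hv h0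
      refine ⟨i, by rw [Function.update_of_ne hcast, h3], h4, ?_⟩
      rw [Function.update_of_ne hve, Function.update_of_ne (hne _ h5)]
      exact ⟨h5, h6⟩

/-- Parent arcs of marked vertices have marked tails, so an arc with an unmarked tail can be
reversed without touching the tree. -/
theorem SearchTree.swap {D : Fin m → Fin n × Fin n} {src : Fin n} {mk : Fin n → ℕ} {pr : ℤ → ℤ}
    (h : SearchTree D src mk pr) {e : Fin m} (he : mk (D e).1 = 0) :
    SearchTree (Function.update D e (D e).swap) src mk pr := by
  refine ⟨h.root, h.le_card, fun v hv h0 => ?_⟩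
  obtain ⟨i, h1, h2, h3, h4⟩ := h.parent v hv h0
  have hi : i ≠ e := by
    rintro rfl
    omega
  exact ⟨i, h1, by rwa [Function.update_of_ne hi], by rwa [Function.update_of_ne hi],
    by rwa [Function.update_of_ne hi]⟩

/-- The state of the search: `D` results from `D₀` by reversing arcs, where `0 < sw` if arcs may be
reversed. -/
structure SearchState (D₀ : Fin m → Fin n × Fin n) (src : Fin n) (sw : ℤ) (s : Store)
    (D : Fin m → Fin n × Fin n) (mk : Fin n → ℕ) : Prop where
  arcs : HoldsArcs (s 4) (s 5) D
  marks : Holds (s 6) (fun v => (mk v : ℤ))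
  tree : SearchTree D src mk (s 7)
  orientation : IsOrientation D₀ D
  fixed : sw ≤ 0 → D = D₀

theorem SearchState.set {D₀ D : Fin m → Fin n × Fin n} {src : Fin n} {sw : ℤ} {s : Store}
    {mk : Fin n → ℕ} (h : SearchState D₀ src sw s D mk) {a : ℕ} (ha : a ∉ [4, 5, 6, 7]) (k x : ℤ) :
    SearchState D₀ src sw (s.set a k x) D mk := by
  have hne : ∀ b ∈ [4, 5, 6, 7], s.set a k x b = s b := fun b hb =>
    Store.set_ne _ _ _ (by rintro rfl; exact ha hb)
  refine ⟨?_, ?_, ?_, h.orientation, h.fixed⟩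
  · rw [hne 4 (by simp), hne 5 (by simp)]
    exact h.arcs
  · rw [hne 6 (by simp)]
    exact h.marks
  · rw [hne 7 (by simp)]
    exact h.tree

/-- The search cannot be extended along the arc `e`. -/
def ClosedAt (sw : ℤ) (D : Fin m → Fin n × Fin n) (mk : Fin n → ℕ) (e : Fin m) : Prop :=
  (0 < mk (D e).1 → 0 < mk (D e).2) ∧ (0 < sw → 0 < mk (D e).2 → 0 < mk (D e).1)

variable {N : ℕ} {s : Store} {D₀ D : Fin m → Fin n × Fin n} {src : Fin n} {sw : ℤ}
  {mk : Fin n → ℕ}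

theorem swapArc_runs (h : HoldsArcs (s 4) (s 5) D) {j : ℕ} (hj4 : j ≠ 4)
    (hj20 : j ≠ 20) {e : Fin m} (hj : s j 0 = ((e : ℕ) : ℤ)) :
    Runs N (swapArc j) s fun s' => Agree [4, 5, 20] s s' ∧
      HoldsArcs (s' 4) (s' 5) (Function.update D e (D e).swap) := by
  refine .seq (.write (.seq (.write (.write ⟨?_, ?_⟩))))
  · exact (((Agree.refl _ s).set (by simp) _ _).set (by simp) _ _).set (by simp) _ _
  · have := h.swap e
    simpa [Expr.eval, hj4, hj20, hj, h.1 e, h.2 e] using this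

theorem markHead_runs (h : SearchState D₀ src sw s D mk) {e : Fin m}
    (hj : s 11 0 = ((e : ℕ) : ℤ)) (h1 : 0 < mk (D e).1) (h2 : mk (D e).2 = 0) :
    Runs N markHead s fun s' => Agree [6, 7] s s' ∧
      ∃ mk', SearchState D₀ src sw s' D mk' ∧ (marked mk).card < (marked mk').card := by
  refine .seq (.write (.write ⟨?_, ?_⟩))
  · exact ((Agree.refl _ s).set (by simp) _ _).set (by simp) _ _
  · refine ⟨Function.update mk (D e).2 (mk (D e).1 + 1), ⟨?_, ?_, ?_, h.orientation, h.fixed⟩,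
      (h.tree.mark h1 h2).2⟩
    · simpa using h.arcs
    · have := h.marks.update (D e).2 ((mk (D e).1 : ℤ) + 1)
      have hf : (fun v => ((Function.update mk (D e).2 (mk (D e).1 + 1) v : ℕ) : ℤ)) =
          Function.update (fun v => (mk v : ℤ)) (D e).2 ((mk (D e).1 : ℤ) + 1) := by
        funext v
        by_cases hv : v = (D e).2 <;> simp [hv]
      rw [hf]
      simpa [Expr.eval, hj, h.arcs.1 e, h.arcs.2 e, h.marks _] using this
    · simpa [Expr.eval, hj, h.arcs.1 e, h.arcs.2 e] using (h.tree.mark h1 h2).1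

/-- The alternative measures progress: more vertices are marked, or nothing changes. Recording that
the first case needs an arc that is not closed shows that a completed search stays completed. -/
theorem searchStep_runs (h : SearchState D₀ src sw s D mk) {e : Fin m}
    (hj : s 11 0 = ((e : ℕ) : ℤ)) (hsw : s 9 0 = sw) :
    Runs N searchStep s fun s' => Agree [4, 5, 6, 7, 20] s s' ∧
      ∃ D' mk', SearchState D₀ src sw s' D' mk' ∧
        ((marked mk).card < (marked mk').card ∧ ¬ ClosedAt sw D mk e ∨
          D' = D ∧ mk' = mk ∧ ClosedAt sw D mk e) := by
  have hskip : ClosedAt sw D mk e → Agree [4, 5, 6, 7, 20] s s ∧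
      ∃ D' mk', SearchState D₀ src sw s D' mk' ∧
        ((marked mk).card < (marked mk').card ∧ ¬ ClosedAt sw D mk e ∨
          D' = D ∧ mk' = mk ∧ ClosedAt sw D mk e) :=
    fun hc => ⟨Agree.refl _ s, D, mk, h, Or.inr ⟨rfl, rfl, hc⟩⟩
  refine .ite (fun h1 => .ite (fun h2 => ?_) (fun h2 => .skip (hskip ?_)))
    (fun h1 => .ite (fun h2 => .ite (fun h3 => ?_) (fun h3 => .skip (hskip ?_)))
      (fun h2 => .skip (hskip ?_))) <;>
    simp only [Expr.eval, hj, h.arcs.1 e, h.arcs.2 e, h.marks _, hsw] at h1 h2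
  · refine (markHead_runs h hj (by omega) (by omega)).mono fun s' ⟨ha, mk', h', hlt⟩ =>
      ⟨ha.mono (by simp), D, mk', h', Or.inl ⟨hlt, fun hc => ?_⟩⟩
    have := hc.1 (by omega)
    omega
  · exact ⟨fun _ => by omega, fun _ _ => by omega⟩
  · simp only [Expr.eval, hj, h.arcs.2 e, h.marks _] at h3
    refine .seq ((swapArc_runs h.arcs (by simp) (by simp) hj).mono fun s' ⟨ha, harcs⟩ => ?_)
    have hD' := h.orientation.update e
    have hst : SearchState D₀ src sw s' (Function.update D e (D e).swap) mk := by
      refine ⟨harcs, ?_, ?_, hD', fun h => absurd h (by omega)⟩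
      · rw [ha 6 (by simp)]
        exact h.marks
      · rw [ha 7 (by simp)]
        exact h.tree.swap (by omega)
    refine (markHead_runs (e := e) hst (by rw [ha 11 (by simp), hj]) (by simp; omega)
      (by simp; omega)).mono fun s'' ⟨ha', mk', h', hlt⟩ =>
        ⟨(ha.mono (by simp)).trans (ha'.mono (by simp)), _, mk', h', Or.inl ⟨hlt, fun hc => ?_⟩⟩
    have := hc.2 (by omega) (by omega)
    omega
  · simp only [Expr.eval, hj, h.arcs.2 e, h.marks _] at h3
    exact ⟨fun _ => by omega, fun _ _ => by omega⟩
  · exact ⟨fun _ => by omega, fun _ => by omega⟩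

theorem search_runs (hn : n ≤ N) (hm : m ≤ N) (hs2 : s 2 0 = n) (hs3 : s 3 0 = m)
    (harcs : HoldsArcs (s 4) (s 5) D₀) (hsrc : s 8 0 = ((src : ℕ) : ℤ)) :
    Runs N search s fun s' => Agree [4, 5, 6, 7, 10, 11, 20] s s' ∧
      ∃ D mk, SearchState D₀ src (s 9 0) s' D mk ∧ ∀ e, ClosedAt (s 9 0) D mk e := by
  refine .seq (.for (fun k s' => Agree [6, 10] s s' ∧
    ∀ v : Fin n, (v : ℕ) < k → s' 6 ((v : ℕ) : ℤ) = 0) hn ?_ ?_ ?_ ?_)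
  · rintro k s' ⟨ha, -⟩
    simp [Expr.eval, ha 2 (by simp), hs2]
  · exact ⟨(Agree.refl _ s).set (by simp) _ _, by simp⟩
  · rintro k hk s' ⟨ha, h0⟩ hs'
    refine .write ⟨by simpa using hs', (ha.set (by simp) _ _).set (by simp) _ _, ?_⟩
    intro v hv
    by_cases hvk : (v : ℕ) = k
    · simp [Expr.eval, hs', hvk]
    · have : ((v : ℕ) : ℤ) ≠ (k : ℤ) := by exact_mod_cast hvk
      simpa [Expr.eval, hs', this] using h0 v (by omega)
  rintro s₁ ⟨ha₁, h0₁⟩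
  have hsrc₁ : s₁ 8 0 = ((src : ℕ) : ℤ) := by rw [ha₁ 8 (by simp), hsrc]
  refine .seq (.write ?_)
  set s₂ := s₁.set 6 ((Expr.cell 8).eval s₁) ((Expr.const 1).eval s₁) with hs₂
  have ha₂ : Agree [4, 5, 6, 7, 10, 11, 20] s s₂ := (ha₁.mono (by simp)).set (by simp) _ _
  have hst₂ : SearchState D₀ src (s 9 0) s₂ D₀ (Function.update 0 src 1) := by
    have h6 : Holds (s₁ 6) (fun _ : Fin n => 0) := fun v => h0₁ v v.2
    refine ⟨?_, ?_, ⟨by simp, fun v => ?_, fun v hv h0 => ?_⟩, fun e => Or.inl rfl, fun _ => rfl⟩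
    · simpa [hs₂, ha₁ 4, ha₁ 5] using harcs
    · have := h6.update src 1
      simp only [hs₂, Store.set_apply, if_true, Expr.eval, hsrc₁]
      convert this using 1
      funext v
      by_cases hv : v = src <;> simp [hv]
    · rw [marked_update Nat.one_pos]
      by_cases hv : v = src
      · subst hv
        simp
      · simp [hv]
    · simp [hv] at h0
  refine .for (fun k s' => Agree [4, 5, 6, 7, 10, 11, 20] s s' ∧
    ∃ D mk, SearchState D₀ src (s 9 0) s' D mk ∧
      (k + 1 ≤ (marked mk).card ∨ ∀ e, ClosedAt (s 9 0) D mk e)) hn ?_ ?_ ?_ ?_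
  · rintro k s' ⟨ha, -⟩
    simp [Expr.eval, ha 2 (by simp), hs2]
  · refine ⟨ha₂.set (by simp) _ _, D₀, _, hst₂.set (by simp) _ _,
      Or.inl (Finset.card_pos.2 ⟨src, ?_⟩)⟩
    simp [marked]
  · rintro k hk s' ⟨ha, D, mk, hst, hprog⟩ hs'
    -- During a round, the search is complete, or the round has marked its vertex, or all arcs seen
    -- so far are closed. In the last case nothing has changed since they were seen.
    refine .for (fun j t => t 10 0 = k ∧ Agree [4, 5, 6, 7, 10, 11, 20] s t ∧
      ∃ D mk, SearchState D₀ src (s 9 0) t D mk ∧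
        ((∀ e, ClosedAt (s 9 0) D mk e) ∨ k + 2 ≤ (marked mk).card ∨
          k + 1 ≤ (marked mk).card ∧ ∀ e : Fin m, (e : ℕ) < j → ClosedAt (s 9 0) D mk e))
      hm ?_ ?_ ?_ ?_
    · rintro j t ⟨-, ha, -⟩
      simp [Expr.eval, ha 3 (by simp), hs3]
    · refine ⟨by simpa using hs', ha.set (by simp) _ _, D, mk, hst.set (by simp) _ _, ?_⟩
      · rcases hprog with h | h
        · exact Or.inr (Or.inr ⟨h, by simp⟩)
        · exact Or.inl h
    · rintro j hj t ⟨ht, ha, D, mk, hst, hprog⟩ htj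
      refine (searchStep_runs (e := ⟨j, hj⟩) hst htj (ha 9 (by simp) ▸ rfl)).mono ?_
      rintro t' ⟨ha', D', mk', hst', h⟩
      refine ⟨by rw [ha' 11 (by simp), htj], by simpa [ha' 10] using ht,
        (ha.trans (ha'.mono (by simp))).set (by simp) _ _, D', mk', hst'.set (by simp) _ _, ?_⟩
      · rcases h with ⟨hlt, hnc⟩ | ⟨rfl, rfl, hc⟩
        · right; left
          rcases hprog with h | h | h
          · exact absurd (h _) hnc
          · omega
          · omega
        · rcases hprog with h | h | h
          · exact Or.inl h
          · exact Or.inr (Or.inl h)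
          · refine Or.inr (Or.inr ⟨h.1, fun e he => ?_⟩)
            by_cases hej : (e : ℕ) = j
            · convert hc
            · exact h.2 e (by omega)
    · rintro t ⟨ht, ha, D, mk, hst, hprog⟩
      refine ⟨ht, ha.set (by simp) _ _, D, mk, hst.set (by simp) _ _, ?_⟩
      · rcases hprog with h | h | h
        · exact Or.inr h
        · exact Or.inl h
        · exact Or.inr fun e => h.2 e e.2
  · rintro s' ⟨ha, D, mk, hst, hprog⟩
    refine ⟨ha, D, mk, hst, hprog.resolve_left fun h => ?_⟩
    have := (marked mk).card_le_univ
    rw [Fintype.card_fin] at this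
    omega

/-- Without reversing arcs, the search marks precisely the vertices that can be reached. -/
theorem SearchState.pos_iff_reaches (h : SearchState D₀ src sw s D mk) (hsw : sw ≤ 0)
    (hc : ∀ e, ClosedAt sw D mk e) (v : Fin n) : 0 < mk v ↔ Reaches D₀ src v := by
  obtain rfl := h.fixed hsw
  refine ⟨h.tree.reaches, fun hr => ?_⟩
  by_contra hv
  obtain ⟨e, h1, h2⟩ := exists_arc_leaving (P := fun v => 0 < mk v) hr
    (by rw [h.tree.root]; exact Nat.one_pos) hv
  exact h2 ((hc e).1 h1)

end Search

/-! ## Augmentation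

Further arrays:
* `12`, `13`: tails and heads of the arcs of a root-connected orientation
* `14`: the numbers of arcs that the vertices could spare
* `15`: the vertex for which another entering arc is wanted, `17`: whether it has been found
* `16`, `18`, `19`, `21`: temporary
-/

/-- Copy the first cells of array `a` to array `b`. -/
def copyArray (a b : ℕ) : Program :=
  .for 11 (.cell 3) (.write b (.cell 11) (.read a (.cell 11)))

/-- Follow the parent arcs from the vertex in array `19` to the start of the search, and reverse
them. -/
def reversePath : Program :=
  .loop (.sub (.read 6 (.cell 19)) (.const 1))
    (.write 21 (.const 0) (.read 7 (.cell 19)) ;; swapArc 21 ;;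
      .write 19 (.const 0) (.read 5 (.cell 21)))

/-- Test whether all vertices are marked. -/
def allMarked : Program :=
  .write 18 (.const 0) (.const 1) ;;
    .for 11 (.cell 2)
      (.ite (.sub (.const 1) (.read 6 (.cell 11))) (.write 18 (.const 0) (.const 0)) .skip)

/-- Accept the current orientation, in which the vertex in array `16` has lost an arc. -/
def accept : Program :=
  copyArray 4 12 ;; copyArray 5 13 ;;
    .write 14 (.cell 16) (.sub (.read 14 (.cell 16)) (.const 1)) ;;
    .write 17 (.const 0) (.const 1)

/-- Try to move an arc from the vertex in array `16` to the vertex in array `15`. -/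
def exchange : Program :=
  copyArray 12 4 ;; copyArray 13 5 ;; .write 8 (.const 0) (.cell 15) ;; search ;;
    .ite (.read 6 (.cell 16))
      (.write 19 (.const 0) (.cell 16) ;; reversePath ;; .write 8 (.const 0) (.const 0) ;;
        search ;; allMarked ;; .ite (.cell 18) accept .skip)
      .skip

/-- Try to find another entering arc for the vertex in array `15`. -/
def augment : Program :=
  .write 17 (.const 0) (.const 0) ;;
    .for 16 (.cell 2)
      (.ite (.sub (.const 1) (.cell 17)) (.ite (.read 14 (.cell 16)) exchange .skip) .skip)

section Augment

variable {n m N : ℕ} {s : Store} {ends D D₀ : Fin m → Fin n × Fin n} {r src u v : Fin n}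
  {ν sl mk : Fin n → ℕ}

theorem copyArray_runs {a b : ℕ} (hm : m ≤ N) (hs3 : s 3 0 = m) {f : Fin m → ℤ}
    (h : Holds (s a) f) (ha : a ≠ b) (ha' : a ≠ 11) (hb : b ≠ 11) (hb' : b ≠ 3) :
    Runs N (copyArray a b) s fun s' => Agree [b, 11] s s' ∧ Holds (s' b) f := by
  have hab : a ∉ [b, 11] := by simp [ha, ha']
  have h3b : 3 ∉ [b, 11] := by simp [hb'.symm]
  refine .for (fun k s' => Agree [b, 11] s s' ∧
    ∀ i : Fin m, (i : ℕ) < k → s' b ((i : ℕ) : ℤ) = f i) hm ?_ ?_ ?_ ?_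
  · rintro k s' ⟨h', -⟩
    simp [Expr.eval, h' 3 h3b, hs3]
  · exact ⟨(Agree.refl _ s).set (by simp) _ _, by simp⟩
  · rintro k hk s' ⟨h', hf⟩ hs'
    refine .write ⟨by simpa [hb.symm] using hs',
      (h'.set (by simp) _ _).set (by simp) _ _, fun i hi => ?_⟩
    by_cases hik : (i : ℕ) = k
    · simp [Expr.eval, hs', ← hik, hb, h' a hab, h i]
    · have : ((i : ℕ) : ℤ) ≠ (k : ℤ) := by exact_mod_cast hik
      simpa [Expr.eval, hs', this, hb] using hf i (by omega)
  · exact fun s' ⟨h', hf⟩ => ⟨h', fun i => hf i i.2⟩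

/-- Marks decrease along the path, so the mark of the current vertex `x` bounds the remaining
iterations, and arcs whose heads have at most this mark are still unreversed. The part already
reversed has moved one entering arc from `u` to `x`. -/
theorem reversePath_runs (hn : n ≤ N) {sw : ℤ} (h : SearchState D₀ src sw s D mk)
    (hu : s 19 0 = ((u : ℕ) : ℤ)) (hmk : 0 < mk u) :
    Runs N reversePath s fun s' => Agree [4, 5, 19, 20, 21] s s' ∧
      ∃ D', HoldsArcs (s' 4) (s' 5) D' ∧ IsOrientation D₀ D' ∧
        ∀ x, indeg D' x + (if x = u then 1 else 0) = indeg D x + (if x = src then 1 else 0) := by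
  have hle : mk u ≤ N :=
    ((h.tree.le_card u).trans (by simpa using (marked mk).card_le_univ)).trans hn
  refine .loop (fun k t => Agree [4, 5, 19, 20, 21] s t ∧ ∃ (x : Fin n) (D' : Fin m → Fin n × Fin n),
    t 19 0 = ((x : ℕ) : ℤ) ∧ 0 < mk x ∧ mk x = k ∧ HoldsArcs (t 4) (t 5) D' ∧
    IsOrientation D₀ D' ∧ (∀ e, mk (D e).2 ≤ mk x → D' e = D e) ∧
    ∀ y, indeg D' y + (if y = u then 1 else 0) = indeg D y + (if y = x then 1 else 0)) hle
    ⟨Agree.refl _ s, u, D, hu, hmk, rfl, h.arcs, h.orientation, fun _ _ => rfl, fun _ => rfl⟩ ?_ ?_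
  · rintro _ t ⟨ha, x, D', hx, hx0, rfl, harcs, hor, hkeep, hdeg⟩ hpos
    have hpos : 1 < mk x := by
      simp only [Expr.eval, hx, ha 6 (by simp), h.marks x] at hpos
      omega
    have hxs : x ≠ src := by
      rintro rfl
      rw [h.tree.root] at hpos
      omega
    obtain ⟨e, h1, h2, h3, h4⟩ := h.tree.parent x hxs hx0
    have hDe : D' e = D e := hkeep e (by rw [h2])
    refine .seq (.write (.seq ?_))
    have h21 : (t.set 21 ((Expr.const 0).eval t) ((Expr.read 7 (.cell 19)).eval t)) 21 0 =
        ((e : ℕ) : ℤ) := by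
      simp [Expr.eval, hx, ha 7 (by simp), h1]
    refine (swapArc_runs (D := D') (by simpa using harcs) (by simp) (by simp) h21).mono ?_
    rintro t' ⟨ha', harcs'⟩
    have ha'' : Agree [4, 5, 19, 20, 21] s t' :=
      (ha.set (by simp) _ _).trans (ha'.mono (by simp))
    refine .write ⟨mk (D e).1, h4, ha''.set (by simp) _ _, (D e).1,
      Function.update D' e (D' e).swap, ?_, h3, rfl, by simpa using harcs', hor.update e,
      fun i hi => ?_, fun y => ?_⟩
    · have : t' 21 0 = ((e : ℕ) : ℤ) := by rw [ha' 21 (by simp), h21]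
      simp [Expr.eval, this, harcs'.2 e, hDe]
    · have hie : i ≠ e := by
        rintro rfl
        rw [h2] at hi
        omega
      rw [Function.update_of_ne hie, hkeep i (by omega)]
    · have e1 := hdeg y
      have e2 := indeg_update D' e y
      rw [hDe, h2] at e2
      rw [hDe]
      omega
  · rintro _ t ⟨ha, x, D', hx, hx0, rfl, harcs, hor, hkeep, hdeg⟩ hpos
    have hxs : x = src := by
      by_contra hxs
      have := h.tree.two_le hxs hx0
      simp only [Expr.eval, hx, ha 6 (by simp), h.marks x] at hpos
      omega
    exact ⟨ha, D', harcs, hor, hxs ▸ hdeg⟩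

theorem allMarked_runs (hn : n ≤ N) (hs2 : s 2 0 = n) (h : Holds (s 6) (fun v => (mk v : ℤ))) :
    Runs N allMarked s fun s' => Agree [11, 18] s s' ∧ (0 < s' 18 0 ↔ ∀ v, 0 < mk v) := by
  refine .seq (.write (.for (fun k s' => Agree [11, 18] s s' ∧
    (0 < s' 18 0 ↔ ∀ v : Fin n, (v : ℕ) < k → 0 < mk v)) hn ?_ ?_ ?_ ?_))
  · rintro k s' ⟨ha, -⟩
    simp [Expr.eval, ha 2 (by simp), hs2]
  · exact ⟨((Agree.refl _ s).set (by simp) _ _).set (by simp) _ _, by simp [Expr.eval]⟩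
  · rintro k hk s' ⟨ha, h18⟩ hs'
    have hval : s' 6 k = mk ⟨k, hk⟩ := by rw [ha 6 (by simp)]; exact h ⟨k, hk⟩
    refine .ite (fun h1 => .write ⟨by simpa using hs', ?_, ?_⟩)
      (fun h1 => .skip ⟨hs', ha.set (by simp) _ _, ?_⟩) <;>
      simp only [Expr.eval, hs', hval] at h1
    · exact (ha.set (by simp) _ _).set (by simp) _ _
    · simp only [Store.set_apply, Expr.eval]
      simp only [Nat.reduceEqDiff, if_false, if_true, Function.update_self, lt_irrefl, false_iff]
      intro hall
      have := hall ⟨k, hk⟩ (Nat.lt_succ_self k)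
      omega
    · rw [Store.set_ne _ _ _ (by simp), h18]
      refine ⟨fun hall v hv => ?_, fun hall v hv => hall v (by omega)⟩
      by_cases hvk : (v : ℕ) = k
      · have : v = ⟨k, hk⟩ := Fin.ext hvk
        rw [this]
        omega
      · exact hall v (by omega)
  · exact fun s' ⟨ha, h18⟩ => ⟨ha, h18.trans ⟨fun hall v => hall v v.2, fun hall v _ => hall v⟩⟩

/-- The store holds a root-connected orientation `D` in which each vertex `v` has `sl v` arcs more
than needed for `ν`. -/
structure AugState (ends : Fin m → Fin n × Fin n) (r : Fin n) (s : Store) (ν : Fin n → ℕ)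
    (D : Fin m → Fin n × Fin n) (sl : Fin n → ℕ) : Prop where
  vertices : s 2 0 = n
  edges : s 3 0 = m
  noSwap : s 9 0 = 0
  arcs : HoldsArcs (s 12) (s 13) D
  slack : Holds (s 14) (fun v => (sl v : ℤ))
  orientation : IsOrientation ends D
  rootConnected : RootConnected D r
  degree : ∀ v, ν v + (if v = r then 0 else 1) + sl v = indeg D v

theorem AugState.orientable (h : AugState ends r s ν D sl) : Orientable ends r ν :=
  ⟨D, h.orientation, h.rootConnected, fun v => by
    have := h.degree v
    omega⟩

theorem AugState.of_agree (h : AugState ends r s ν D sl) {L : List ℕ} {s' : Store}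
    (ha : Agree L s s') (hL : ∀ a ∈ L, a ∉ [2, 3, 9, 12, 13, 14]) : AugState ends r s' ν D sl := by
  have heq : ∀ a ∈ [2, 3, 9, 12, 13, 14], s' a = s a := fun a h => ha a fun h' => hL a h' h
  refine ⟨?_, ?_, ?_, ?_, ?_, h.orientation, h.rootConnected, h.degree⟩
  · rw [heq 2 (by simp), h.vertices]
  · rw [heq 3 (by simp), h.edges]
  · rw [heq 9 (by simp), h.noSwap]
  · rw [heq 12 (by simp), heq 13 (by simp)]
    exact h.arcs
  · rw [heq 14 (by simp)]
    exact h.slack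

theorem accept_runs (hm : m ≤ N) (h : AugState ends r s ν D sl) {D' : Fin m → Fin n × Fin n}
    (harcs : HoldsArcs (s 4) (s 5) D') (hor : IsOrientation ends D') (hroot : RootConnected D' r)
    (hdeg : ∀ x, indeg D' x + (if x = u then 1 else 0) = indeg D x + (if x = v then 1 else 0))
    (hu : s 16 0 = ((u : ℕ) : ℤ)) (hsl : 0 < sl u) :
    Runs N accept s fun s' => Agree [11, 12, 13, 14, 17] s s' ∧ s' 17 0 = 1 ∧
      ∃ sl', AugState ends r s' (ν + Pi.single v 1) D' sl' := by
  refine .seq ((copyArray_runs hm h.edges harcs.1 (by simp) (by simp) (by simp)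
    (by simp)).mono fun s₁ ⟨ha₁, h12⟩ => .seq ?_)
  refine (copyArray_runs (f := fun e => (((D' e).2 : ℕ) : ℤ)) hm (by rw [ha₁ 3 (by simp), h.edges])
    (by rw [ha₁ 5 (by simp)]; exact harcs.2) (by simp) (by simp) (by simp) (by simp)).mono ?_
  rintro s₂ ⟨ha₂, h13⟩
  have ha : Agree [11, 12, 13] s s₂ := (ha₁.mono (by simp)).trans (ha₂.mono (by simp))
  refine .seq (.write (.write ⟨?_, by simp [Expr.eval], Function.update sl u (sl u - 1), ?_⟩))
  · exact ((ha.mono (by simp)).set (by simp) _ _).set (by simp) _ _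
  refine ⟨?_, ?_, ?_, ⟨?_, ?_⟩, ?_, hor, hroot, fun x => ?_⟩
  · simp [ha 2, h.vertices]
  · simp [ha 3, h.edges]
  · simp [ha 9, h.noSwap]
  · simpa [ha₂ 12] using h12
  · simpa using h13
  · have hf : (fun x => ((Function.update sl u (sl u - 1) x : ℕ) : ℤ)) =
        Function.update (fun x => (sl x : ℤ)) u ((sl u : ℤ) - 1) := by
      funext x
      by_cases hx : x = u
      · subst hx
        simp only [Function.update_self]
        omega
      · simp [hx]
    rw [hf]
    have := h.slack.update u ((sl u : ℤ) - 1)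
    simpa [Expr.eval, ha 14, ha 16, hu, h.slack u] using this
  -- The case `u = v` is included: the in-degrees agree, and the larger demand is paid from the
  -- slack of `u`.
  · have e1 := hdeg x
    have e2 := h.degree x
    rw [Pi.add_apply, Pi.single_apply]
    by_cases hx : x = u
    · subst hx
      rw [Function.update_self]
      rw [if_pos rfl] at e1
      omega
    · rw [Function.update_of_ne hx]
      rw [if_neg hx] at e1
      omega

/-- The reversal is carried out on a working copy, so `D` survives a failure. There are two ways to
fail, `v` not reaching `u` and loss of root-connectedness, and each yields a tight set of `D`. -/
theorem exchange_runs (hn : n ≤ N) (hm : m ≤ N) (h : AugState ends r s ν D sl)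
    (hr : (r : ℕ) = 0) (hv : s 15 0 = ((v : ℕ) : ℤ)) (hu : s 16 0 = ((u : ℕ) : ℤ))
    (hsl : 0 < sl u) (h17 : s 17 0 = 0) :
    Runs N exchange s fun s' =>
      Agree [4, 5, 6, 7, 8, 10, 11, 12, 13, 14, 17, 18, 19, 20, 21] s s' ∧
      ((s' 17 0 = 1 ∧ ∃ D' sl', AugState ends r s' (ν + Pi.single v 1) D' sl') ∨
        (s' 17 0 = 0 ∧ AugState ends r s' ν D sl ∧ ∃ Y, Tight D r Y ∧ u ∈ Y ∧ v ∉ Y)) := by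
  refine .seq ((copyArray_runs hm h.edges h.arcs.1 (by simp) (by simp) (by simp)
    (by simp)).mono fun s₁ ⟨ha₁, h4⟩ => .seq ?_)
  refine (copyArray_runs (f := fun e => (((D e).2 : ℕ) : ℤ)) hm (by rw [ha₁ 3 (by simp), h.edges])
    (by rw [ha₁ 13 (by simp)]; exact h.arcs.2) (by simp) (by simp) (by simp) (by simp)).mono ?_
  rintro s₂ ⟨ha₂, h5⟩
  have ha : Agree [4, 5, 11] s s₂ := (ha₁.mono (by simp)).trans (ha₂.mono (by simp))
  have h4₂ : HoldsArcs (s₂ 4) (s₂ 5) D := ⟨by rw [ha₂ 4 (by simp)]; exact h4, h5⟩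
  refine .seq (.write (.seq ?_))
  have ha₃ : Agree [4, 5, 8, 11] s (s₂.set 8 ((Expr.const 0).eval s₂) ((Expr.cell 15).eval s₂)) :=
    (ha.mono (by simp)).set (by simp) _ _
  refine (search_runs (D₀ := D) (src := v) hn hm (by rw [ha₃ 2 (by simp), h.vertices])
    (by rw [ha₃ 3 (by simp), h.edges]) (by simpa using h4₂)
    (by simp [Expr.eval, ha 15, hv])).mono ?_
  rintro s₄ ⟨ha₄, D', mk, hst, hclosed⟩
  have ha₄ : Agree [4, 5, 6, 7, 8, 10, 11, 20] s s₄ := (ha₃.mono (by simp)).trans (ha₄.mono (by simp))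
  rw [ha₃ 9 (by simp), h.noSwap] at hst hclosed
  obtain rfl : D' = D := hst.fixed le_rfl
  have hu₄ : s₄ 16 0 = ((u : ℕ) : ℤ) := by rw [ha₄ 16 (by simp), hu]
  refine .ite (fun hpos => ?_) (fun hpos => .skip ⟨ha₄.mono (by simp), Or.inr
    ⟨by rw [ha₄ 17 (by simp), h17], h.of_agree ha₄ (by simp), exists_tight_of_not_reaches
      h.rootConnected fun hreach => hpos ?_⟩⟩)
  swap
  · have := (hst.pos_iff_reaches le_rfl hclosed u).2 hreach
    simpa [Expr.eval, hu₄, hst.marks u] using this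
  have hmk : 0 < mk u := by simpa [Expr.eval, hu₄, hst.marks u] using hpos
  refine .seq (.write (.seq ?_))
  refine (reversePath_runs (u := u) hn (hst.set (by simp) _ _) (by simp [Expr.eval, hu₄])
    hmk).mono ?_
  rintro s₅ ⟨ha₅, D₁, harcs, hor, hdeg⟩
  have ha₅ : Agree [4, 5, 6, 7, 8, 10, 11, 19, 20, 21] s s₅ :=
    ((ha₄.mono (by simp)).set (by simp) _ _).trans (ha₅.mono (by simp))
  have hor : IsOrientation ends D₁ := fun e => by
    rcases hor e with h1 | h1 <;> rcases h.orientation e with h2 | h2 <;> simp [h1, h2]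
  refine .seq (.write (.seq ?_))
  have ha₆ : Agree [4, 5, 6, 7, 8, 10, 11, 19, 20, 21] s
      (s₅.set 8 ((Expr.const 0).eval s₅) ((Expr.const 0).eval s₅)) := ha₅.set (by simp) _ _
  refine (search_runs (D₀ := D₁) (src := r) hn hm (by rw [ha₆ 2 (by simp), h.vertices])
    (by rw [ha₆ 3 (by simp), h.edges]) (by simpa using harcs) (by simp [Expr.eval, hr])).mono ?_
  rintro s₇ ⟨ha₇, D₂, mk₂, hst₂, hclosed₂⟩
  have ha₇ : Agree [4, 5, 6, 7, 8, 10, 11, 19, 20, 21] s s₇ := ha₆.trans (ha₇.mono (by simp))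
  rw [ha₆ 9 (by simp), h.noSwap] at hst₂ hclosed₂
  obtain rfl : D₂ = D₁ := hst₂.fixed le_rfl
  refine .seq ((allMarked_runs hn (by rw [ha₇ 2 (by simp), h.vertices]) hst₂.marks).mono ?_)
  rintro s₈ ⟨ha₈, h18⟩
  have h4₈ : HoldsArcs (s₈ 4) (s₈ 5) D₂ := by
    rw [ha₈ 4 (by simp), ha₈ 5 (by simp)]
    exact hst₂.arcs
  have ha₈ : Agree [4, 5, 6, 7, 8, 10, 11, 18, 19, 20, 21] s s₈ :=
    (ha₇.mono (by simp)).trans (ha₈.mono (by simp))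
  have hroot : 0 < s₈ 18 0 ↔ RootConnected D₂ r :=
    h18.trans (forall_congr' fun x => hst₂.pos_iff_reaches le_rfl hclosed₂ x)
  refine .ite (fun hpos => ?_) (fun hpos => .skip ⟨ha₈.mono (by simp), Or.inr
    ⟨by rw [ha₈ 17 (by simp), h17], h.of_agree ha₈ (by simp), exists_tight_of_not_rootConnected
      h.orientation h.rootConnected hor hdeg fun hreach => hpos (hroot.2 hreach)⟩⟩)
  refine (accept_runs hm (h.of_agree ha₈ (by simp)) h4₈ hor (hroot.1 hpos) hdeg
    (by rw [ha₈ 16 (by simp), hu]) hsl).mono ?_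
  rintro s₉ ⟨ha₉, hs17, sl', hst⟩
  exact ⟨(ha₈.mono (by simp)).trans (ha₉.mono (by simp)), Or.inl ⟨hs17, D₂, sl', hst⟩⟩

/-- The arrays that are changed by augmentations. -/
abbrev scratch : List ℕ := [4, 5, 6, 7, 8, 10, 11, 12, 13, 14, 16, 17, 18, 19, 20, 21]

/-- If every exchange fails, all vertices with positive slack are separated from `v` by tight sets
of the same `D`. By `exists_saturated_superset`, `ν` is then maximal on a set containing `v`, so
failure is a proof that no orientation exists. -/
theorem augment_runs (hn : n ≤ N) (hm : m ≤ N) (h : AugState ends r s ν D sl)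
    (hr : (r : ℕ) = 0) (hv : s 15 0 = ((v : ℕ) : ℤ)) :
    Runs N augment s fun s' => Agree scratch s s' ∧
      ((s' 17 0 = 1 ∧ ∃ D' sl', AugState ends r s' (ν + Pi.single v 1) D' sl') ∨
        (s' 17 0 = 0 ∧ (∃ D' sl', AugState ends r s' ν D' sl') ∧
          ¬ Orientable ends r (ν + Pi.single v 1))) := by
  refine .seq (.write (.for (fun k s' => Agree scratch s s' ∧ s' 2 0 = n ∧
      ((s' 17 0 = 1 ∧ ∃ D' sl', AugState ends r s' (ν + Pi.single v 1) D' sl') ∨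
        (s' 17 0 = 0 ∧ AugState ends r s' ν D sl ∧ ∀ u : Fin n, (u : ℕ) < k → 0 < sl u →
          ∃ Y, Tight D r Y ∧ u ∈ Y ∧ v ∉ Y))) hn ?_ ?_ ?_ ?_))
  · rintro k s' ⟨-, h2, -⟩
    simp [Expr.eval, h2]
  · have ha : Agree [16, 17] s ((s.set 17 ((Expr.const 0).eval s) ((Expr.const 0).eval s)).set
      16 0 0) := ((Agree.refl _ s).set (by simp) _ _).set (by simp) _ _
    exact ⟨ha.mono (by simp), by rw [ha 2 (by simp), h.vertices],
      Or.inr ⟨by simp [Expr.eval], h.of_agree ha (by simp), by simp⟩⟩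
  · rintro k hk s' ⟨ha, h2, hprog⟩ hs'
    have hset : ∀ x : ℤ, Agree [16] s' (s'.set 16 0 x) := fun x =>
      (Agree.refl _ s').set (by simp) _ _
    refine .ite (fun h1 => .ite (fun h3 => ?_) (fun h3 => .skip ⟨hs', ?_⟩))
      (fun h1 => .skip ⟨hs', ?_⟩) <;> simp only [Expr.eval] at h1
    · rcases hprog with ⟨h17, -⟩ | ⟨h17, hst, hprog⟩
      · omega
      have hsl : 0 < sl ⟨k, hk⟩ := by
        simp only [Expr.eval, hs'] at h3
        rw [hst.slack ⟨k, hk⟩] at h3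
        simpa using h3
      refine (exchange_runs (u := ⟨k, hk⟩) hn hm hst hr (by rw [ha 15 (by simp), hv]) hs' hsl
        h17).mono ?_
      rintro t ⟨ha', hres⟩
      have hset' : Agree [16] t (t.set 16 0 (k + 1)) := (Agree.refl _ t).set (by simp) _ _
      refine ⟨by rw [ha' 16 (by simp), hs'], (ha.trans (ha'.mono (by simp))).set (by simp) _ _,
        by rw [hset' 2 (by simp), ha' 2 (by simp), h2], ?_⟩
      rcases hres with ⟨h17', D', sl', hst'⟩ | ⟨h17', hst', hY⟩
      · exact Or.inl ⟨by rw [hset' 17 (by simp), h17'], D', sl', hst'.of_agree hset' (by simp)⟩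
      · refine Or.inr ⟨by rw [hset' 17 (by simp), h17'], hst'.of_agree hset' (by simp),
          fun u hu hu0 => ?_⟩
        by_cases huk : (u : ℕ) = k
        · obtain rfl : u = ⟨k, hk⟩ := Fin.ext huk
          exact hY
        · exact hprog u (by omega) hu0
    · refine ⟨ha.set (by simp) _ _, by rw [hset _ 2 (by simp), h2], ?_⟩
      rcases hprog with ⟨h17, D', sl', hst'⟩ | ⟨h17, hst, hprog⟩
      · exact Or.inl ⟨by rw [hset _ 17 (by simp), h17], D', sl', hst'.of_agree (hset _) (by simp)⟩
      · refine Or.inr ⟨by rw [hset _ 17 (by simp), h17], hst.of_agree (hset _) (by simp),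
          fun u hu hu0 => ?_⟩
        by_cases huk : (u : ℕ) = k
        · simp only [Expr.eval, hs'] at h3
          rw [← huk, hst.slack u] at h3
          exact absurd (by simpa using hu0) h3
        · exact hprog u (by omega) hu0
    · refine ⟨ha.set (by simp) _ _, by rw [hset _ 2 (by simp), h2], ?_⟩
      rcases hprog with ⟨h17, D', sl', hst'⟩ | ⟨h17, hst, hprog⟩
      · exact Or.inl ⟨by rw [hset _ 17 (by simp), h17], D', sl', hst'.of_agree (hset _) (by simp)⟩
      · omega
  · rintro s' ⟨ha, -, hprog⟩
    refine ⟨ha, ?_⟩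
    rcases hprog with h' | ⟨h17, hst, hprog⟩
    · exact Or.inl h'
    refine Or.inr ⟨h17, ⟨D, sl, hst⟩, fun hν => ?_⟩
    obtain ⟨Z, hZ, hmax⟩ := exists_saturated_superset h.orientation h.rootConnected {v}
      (μ := ν) (fun w hw u hu => by
        obtain rfl := Finset.mem_singleton.1 hw
        refine hprog u u.2 ?_
        have := h.degree u
        omega)
    have := hmax _ hν
    rw [sum_add_single, if_pos (hZ (Finset.mem_singleton_self v))] at this
    omega

end Augment

/-! ## Input and output -/

section Lists

theorem getElem?_flatMap_pair {γ : Type*} (f g : γ → ℤ) (l : List γ) (j : ℕ) :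
    (l.flatMap fun e => [f e, g e])[2 * j]? = l[j]?.map f ∧
      (l.flatMap fun e => [f e, g e])[2 * j + 1]? = l[j]?.map g := by
  induction l generalizing j with
  | nil => simp
  | cons a l ih =>
    cases j with
    | zero => simp
    | succ j => simpa [Nat.mul_succ] using ih j

theorem length_flatMap_pair {γ : Type*} (f g : γ → ℤ) (l : List γ) :
    (l.flatMap fun e => [f e, g e]).length = 2 * l.length := by
  induction l with
  | nil => rfl
  | cons a l ih => simp [ih, Nat.mul_succ]

variable (I : EdgeList) (w : Fin I.n → ℤ)

theorem EdgeList.length_encode : I.encode.length = 2 + 2 * I.m := by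
  rw [EdgeList.encode, List.length_append, length_flatMap_pair]
  simp

theorem EdgeList.getElem?_encode_append (l : List ℤ) :
    (I.encode ++ l)[0]? = some (I.n : ℤ) ∧ (I.encode ++ l)[1]? = some (I.m : ℤ) ∧
    (∀ j : Fin I.m, (I.encode ++ l)[2 + 2 * (j : ℕ)]? = some (((I.ends j).1 : ℕ) : ℤ) ∧
      (I.encode ++ l)[3 + 2 * (j : ℕ)]? = some (((I.ends j).2 : ℕ) : ℤ)) ∧
    ∀ i : ℕ, (I.encode ++ l)[2 + 2 * I.m + i]? = l[i]? := by
  refine ⟨rfl, rfl, fun j => ?_, fun i => ?_⟩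
  · have h := getElem?_flatMap_pair (fun e : Fin I.n × Fin I.n => ((e.1 : ℕ) : ℤ))
      (fun e => ((e.2 : ℕ) : ℤ)) (List.ofFn I.ends) j
    rw [List.getElem?_append_left (by rw [I.length_encode]; omega),
      List.getElem?_append_left (by rw [I.length_encode]; omega), EdgeList.encode,
      List.getElem?_append_right (by simp), List.getElem?_append_right (by simp; omega)]
    have e1 : 2 + 2 * (j : ℕ) - [(I.n : ℤ), (I.m : ℤ)].length = 2 * j := by simp
    have e2 : 3 + 2 * (j : ℕ) - [(I.n : ℤ), (I.m : ℤ)].length = 2 * j + 1 := by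
      simp only [List.length_cons, List.length_nil]
      omega
    rw [e1, e2, h.1, h.2]
    simp
  · rw [List.getElem?_append_right (by rw [I.length_encode]; omega), I.length_encode,
      Nat.add_sub_cancel_left]

theorem inputStore_apply {l : List ℤ} {k : ℕ} {x : ℤ} (h : l[k]? = some x) :
    inputStore l 0 (k : ℤ) = x := by
  simp [inputStore, h]

theorem hasOutput_of_getElem? {s : Store} {l : List ℤ}
    (h : ∀ (k : ℕ) x, l[k]? = some x → s 1 (k : ℤ) = x) : HasOutput s l := fun k =>
  h k _ (by simp)

theorem EdgeList.hasOutput {s : Store} (h0 : s 1 0 = I.n) (h1 : s 1 1 = I.m)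
    (h2 : ∀ j : Fin I.m, s 1 (2 + 2 * ((j : ℕ) : ℤ)) = (((I.ends j).1 : ℕ) : ℤ))
    (h3 : ∀ j : Fin I.m, s 1 (3 + 2 * ((j : ℕ) : ℤ)) = (((I.ends j).2 : ℕ) : ℤ))
    (h4 : ∀ i : Fin I.n, s 1 (2 + 2 * (I.m : ℤ) + ((i : ℕ) : ℤ)) = w i) :
    HasOutput s (I.encode ++ List.ofFn w) := by
  obtain ⟨e0, e1, e2, e4⟩ := I.getElem?_encode_append (List.ofFn w)
  refine hasOutput_of_getElem? fun k x hx => ?_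
  rcases Nat.lt_or_ge k (2 + 2 * I.m) with hk | hk
  · rcases Nat.even_or_odd' k with ⟨j, rfl | rfl⟩
    · cases j with
      | zero =>
        rw [Nat.mul_zero, e0, Option.some_inj] at hx
        rw [← hx]
        exact h0
      | succ j =>
        have hj : j < I.m := by omega
        have e : 2 * (j + 1) = 2 + 2 * j := by ring
        rw [e, (e2 ⟨j, hj⟩).1, Option.some_inj] at hx
        rw [← hx, ← h2 ⟨j, hj⟩, e]
        push_cast
        rfl
    · cases j with
      | zero =>
        rw [Nat.mul_zero, Nat.zero_add, e1, Option.some_inj] at hx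
        rw [← hx]
        exact h1
      | succ j =>
        have hj : j < I.m := by omega
        have e : 2 * (j + 1) + 1 = 3 + 2 * j := by ring
        rw [e, (e2 ⟨j, hj⟩).2, Option.some_inj] at hx
        rw [← hx, ← h3 ⟨j, hj⟩, e]
        push_cast
        rfl
  · obtain ⟨i, rfl⟩ := Nat.exists_eq_add_of_le hk
    rw [e4, List.getElem?_ofFn] at hx
    split_ifs at hx with hi
    rw [Option.some_inj] at hx
    rw [← hx, ← h4 ⟨i, hi⟩]
    push_cast
    rfl

theorem two_mul_length_le_bitLength (l : List ℤ) : 2 * l.length ≤ bitLength l := by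
  induction l with
  | nil => simp [bitLength]
  | cons a l ih =>
    simp only [bitLength, List.map_cons, List.sum_cons, List.length_cons] at ih ⊢
    omega

/-- Makes the bit length a valid bound for all loops, including the `m + 1` rounds of `saturate`. -/
theorem EdgeList.add_le_bitLength : I.n + I.m + 2 ≤ bitLength (I.encode ++ List.ofFn w) := by
  have := two_mul_length_le_bitLength (I.encode ++ List.ofFn w)
  rw [List.length_append, I.length_encode, List.length_ofFn] at this
  omega

end Lists

/-! ## Initialization -/

/-- Read the graph. -/
def readGraph : Program :=
  .write 2 (.const 0) (.cell 0) ;; .write 3 (.const 0) (.read 0 (.const 1)) ;;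
    .for 11 (.cell 3)
      (.write 4 (.cell 11) (.read 0 (.add (.const 2) (.add (.cell 11) (.cell 11)))) ;;
        .write 5 (.cell 11) (.read 0 (.add (.const 3) (.add (.cell 11) (.cell 11)))))

/-- Compute the numbers of arcs that the vertices could spare. -/
def initSlack : Program :=
  -- The value `-1` reserves the arc by which a vertex is reached; the root, vertex `0`, is reset
  -- because it needs none.
  .for 11 (.cell 2) (.write 14 (.cell 11) (.const (-1))) ;;
    .write 14 (.const 0) (.const 0) ;;
    .for 11 (.cell 3) (.write 14 (.read 5 (.cell 11)) (.add (.read 14 (.read 5 (.cell 11)))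
      (.const 1)))

/-- Read the graph and find a root-connected orientation. -/
def prepare : Program :=
  readGraph ;; .write 9 (.const 0) (.const 1) ;; search ;; .write 9 (.const 0) (.const 0) ;;
    initSlack ;; copyArray 4 12 ;; copyArray 5 13

section Initialize

variable {N : ℕ} {s : Store}

theorem EdgeList.forall_of_connected {I : EdgeList} (h : Connected I.toGraph) {P : Fin I.n → Prop}
    {r : Fin I.n} (hr : P r) (hP : ∀ e, P (I.ends e).1 ↔ P (I.ends e).2) (v : Fin I.n) : P v := by
  obtain ⟨p⟩ := h.preconnected (I.vert r) (I.vert v)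
  have key : ∀ x y : V(I.toGraph), I.toGraph.toSimpleGraph.Walk x y → P x.1 → P y.1 := by
    intro x y p
    induction p with
    | nil => exact id
    | cons hadj _ ih =>
      refine fun hx => ih ?_
      obtain ⟨-, e, he⟩ := hadj
      have := hP e
      rcases he with he | he <;> rw [he] at this
      · exact this.1 hx
      · exact this.2 hx
  exact key _ _ p hr

theorem readGraph_runs (I : EdgeList) (w : Fin I.n → ℤ) (hm : I.m ≤ N) :
    Runs N readGraph (inputStore (I.encode ++ List.ofFn w)) fun s =>
      Agree [2, 3, 4, 5, 11] (inputStore (I.encode ++ List.ofFn w)) s ∧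
        s 2 0 = I.n ∧ s 3 0 = I.m ∧ HoldsArcs (s 4) (s 5) I.ends := by
  obtain ⟨e0, e1, e2, -⟩ := I.getElem?_encode_append (List.ofFn w)
  set s₀ := inputStore (I.encode ++ List.ofFn w)
  have h0 : s₀ 0 0 = I.n := inputStore_apply e0
  have h1 : s₀ 0 1 = I.m := inputStore_apply e1
  refine .seq (.write (.seq (.write (.for (fun k s => Agree [2, 3, 4, 5, 11] s₀ s ∧ s 2 0 = I.n ∧
    s 3 0 = I.m ∧ ∀ j : Fin I.m, (j : ℕ) < k → s 4 ((j : ℕ) : ℤ) = (((I.ends j).1 : ℕ) : ℤ) ∧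
      s 5 ((j : ℕ) : ℤ) = (((I.ends j).2 : ℕ) : ℤ)) hm ?_ ?_ ?_ ?_))))
  · rintro k s ⟨-, -, h3, -⟩
    simp [Expr.eval, h3]
  · refine ⟨(((Agree.refl _ s₀).set (by simp) _ _).set (by simp) _ _).set (by simp) _ _, ?_, ?_,
      by simp⟩
    · simp [Expr.eval, h0]
    · simp [Expr.eval, h1]
  · rintro k hk s ⟨ha, h2, h3, hj⟩ hs
    refine .seq (.write (.write ⟨by simpa using hs,
      ((ha.set (by simp) _ _).set (by simp) _ _).set (by simp) _ _, by simpa using h2,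
      by simpa using h3, fun j hjk => ?_⟩))
    by_cases hjk' : (j : ℕ) = k
    · have e4 : s₀ 0 (2 + ((k : ℤ) + k)) = (((I.ends j).1 : ℕ) : ℤ) := by
        rw [← inputStore_apply (e2 j).1, hjk']
        push_cast
        rw [two_mul]
      have e5 : s₀ 0 (3 + ((k : ℤ) + k)) = (((I.ends j).2 : ℕ) : ℤ) := by
        rw [← inputStore_apply (e2 j).2, hjk']
        push_cast
        rw [two_mul]
      simp [Expr.eval, hs, hjk', ha 0, e4, e5]
    · have hne : ((j : ℕ) : ℤ) ≠ (k : ℤ) := by exact_mod_cast hjk'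
      simpa [Expr.eval, hs, hne] using hj j (by omega)
  · exact fun s ⟨ha, h2, h3, hj⟩ => ⟨ha, h2, h3, fun j => (hj j j.2).1, fun j => (hj j j.2).2⟩

theorem initSlack_runs {n m : ℕ} (hn : n ≤ N) (hm : m ≤ N) (hs2 : s 2 0 = n) (hs3 : s 3 0 = m)
    {r : Fin n} (hr : (r : ℕ) = 0) {D : Fin m → Fin n × Fin n}
    (h5 : Holds (s 5) fun e => (((D e).2 : ℕ) : ℤ)) :
    Runs N initSlack s fun s' => Agree [11, 14] s s' ∧
      Holds (s' 14) fun v => (indeg D v : ℤ) - if v = r then 0 else 1 := by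
  refine .seq (.for (fun k s' => Agree [11, 14] s s' ∧
    ∀ v : Fin n, (v : ℕ) < k → s' 14 ((v : ℕ) : ℤ) = -1) hn ?_ ?_ ?_ ?_)
  · rintro k s' ⟨ha, -⟩
    simp [Expr.eval, ha 2 (by simp), hs2]
  · exact ⟨(Agree.refl _ s).set (by simp) _ _, by simp⟩
  · rintro k hk s' ⟨ha, hv⟩ hs'
    refine .write ⟨by simpa using hs', (ha.set (by simp) _ _).set (by simp) _ _, fun v hvk => ?_⟩
    by_cases hvk' : (v : ℕ) = k
    · simp [Expr.eval, hs', hvk']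
    · have hne : ((v : ℕ) : ℤ) ≠ (k : ℤ) := by exact_mod_cast hvk'
      simpa [Expr.eval, hs', hne] using hv v (by omega)
  rintro s₁ ⟨ha₁, h₁⟩
  refine .seq (.write (.for (fun k s' => Agree [11, 14] s s' ∧ Holds (s' 14) fun v : Fin n =>
    ((Finset.univ.filter fun e : Fin m => (e : ℕ) < k ∧ (D e).2 = v).card : ℤ) -
      if v = r then 0 else 1) hm ?_ ?_ ?_ ?_))
  · rintro k s' ⟨ha, -⟩
    simp [Expr.eval, ha 3 (by simp), hs3]
  · refine ⟨(ha₁.set (by simp) _ _).set (by simp) _ _, fun v => ?_⟩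
    by_cases hv : v = r
    · simp [Expr.eval, hv, hr]
    · have hne : ((v : ℕ) : ℤ) ≠ 0 := by
        exact_mod_cast fun h : (v : ℕ) = 0 => hv (Fin.ext (h.trans hr.symm))
      have hne' : (v : ℕ) ≠ 0 := by exact_mod_cast hne
      simp [Expr.eval, hv, hne', h₁ v v.2]
  · rintro k hk s' ⟨ha, h14⟩ hs'
    have hd : s' 5 k = (((D ⟨k, hk⟩).2 : ℕ) : ℤ) := by
      rw [ha 5 (by simp)]
      exact h5 ⟨k, hk⟩
    refine .write ⟨by simpa using hs', (ha.set (by simp) _ _).set (by simp) _ _, ?_⟩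
    have hu := h14.update (D ⟨k, hk⟩).2 (s' 14 (((D ⟨k, hk⟩).2 : ℕ) : ℤ) + 1)
    have hfun : (fun v => ((Finset.univ.filter fun e : Fin m =>
        (e : ℕ) < k + 1 ∧ (D e).2 = v).card : ℤ) - if v = r then 0 else 1) =
        Function.update (fun v => ((Finset.univ.filter fun e : Fin m =>
          (e : ℕ) < k ∧ (D e).2 = v).card : ℤ) - if v = r then 0 else 1) (D ⟨k, hk⟩).2
          (s' 14 (((D ⟨k, hk⟩).2 : ℕ) : ℤ) + 1) := by
      funext v
      by_cases hv : v = (D ⟨k, hk⟩).2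
      · subst hv
        have : (Finset.univ.filter fun e : Fin m => (e : ℕ) < k + 1 ∧ (D e).2 = (D ⟨k, hk⟩).2) =
            insert ⟨k, hk⟩ (Finset.univ.filter fun e : Fin m =>
              (e : ℕ) < k ∧ (D e).2 = (D ⟨k, hk⟩).2) := by
          ext e
          simp only [Finset.mem_filter, Finset.mem_univ, true_and, Finset.mem_insert, Fin.ext_iff]
          constructor
          · rintro ⟨h1, h2⟩
            by_cases hek : (e : ℕ) = k
            · exact Or.inl hek
            · exact Or.inr ⟨by omega, h2⟩
          · rintro (h | h)
            · exact ⟨by omega, by rw [show e = ⟨k, hk⟩ from Fin.ext h]⟩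
            · exact ⟨by omega, h.2⟩
        rw [Function.update_self, h14, this, Finset.card_insert_of_notMem (by simp)]
        push_cast
        ring
      · rw [Function.update_of_ne hv]
        congr 3
        ext e
        simp only [Finset.mem_filter, Finset.mem_univ, true_and]
        refine ⟨fun ⟨h1, h2⟩ => ⟨?_, h2⟩, fun ⟨h1, h2⟩ => ⟨by omega, h2⟩⟩
        by_contra hek
        exact hv (by rw [← h2, show e = ⟨k, hk⟩ from Fin.ext (by simp; omega)])
    rw [hfun]
    simpa [Expr.eval, hs', hd] using hu
  · rintro s' ⟨ha, h14⟩
    refine ⟨ha, fun v => ?_⟩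
    rw [h14 v]
    simp [indeg]

/-- The arrays that are changed by the initialization. -/
abbrev initScratch : List ℕ := [2, 3, 4, 5, 6, 7, 9, 10, 11, 12, 13, 14, 20]

/-- When reversals are allowed, a completed search marks both ends of an edge or neither, so
connectedness makes it mark everything. The tree arcs then lead from the root to all vertices. -/
theorem prepare_runs (I : EdgeList) (w : Fin I.n → ℤ) (hconn : Connected I.toGraph)
    (hn : I.n ≤ N) (hm : I.m ≤ N) {r : Fin I.n} (hr : (r : ℕ) = 0) :
    Runs N prepare (inputStore (I.encode ++ List.ofFn w)) fun s =>
      Agree initScratch (inputStore (I.encode ++ List.ofFn w)) s ∧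
        ∃ D sl, AugState I.ends r s 0 D sl := by
  set s₀ := inputStore (I.encode ++ List.ofFn w)
  refine .seq ((readGraph_runs I w hm).mono ?_)
  rintro s₁ ⟨ha₁, h2, h3, harcs⟩
  refine .seq (.write (.seq ?_))
  -- Array `8` has not been written, so the search starts from its initial content `0`, the root.
  refine (search_runs (D₀ := I.ends) (src := r) hn hm (by simpa using h2) (by simpa using h3)
    (by simpa using harcs) (by simp [Expr.eval, ha₁ 8, hr, inputStore])).mono ?_
  rintro s₂ ⟨ha₂, D, mk, hst, hclosed⟩
  simp only [Store.set_apply, if_true, Expr.eval, Function.update_self] at hst hclosed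
  have hmk : ∀ v, 0 < mk v := by
    have horient := hst.orientation
    refine I.forall_of_connected hconn (r := r) (by rw [hst.tree.root]; exact Nat.one_pos) fun e => ?_
    have hc := hclosed e
    rcases horient e with h | h <;> rw [ClosedAt, h] at hc
    · exact ⟨hc.1, hc.2 one_pos⟩
    · exact ⟨hc.2 one_pos, hc.1⟩
  have hroot : RootConnected D r := fun v => hst.tree.reaches (hmk v)
  have hpos : ∀ v, (if v = r then 0 else 1) ≤ indeg D v := by
    intro v
    split_ifs with hv
    · exact Nat.zero_le _
    · obtain ⟨e, -, he, -⟩ := hst.tree.parent v hv (hmk v)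
      exact Finset.card_pos.2 ⟨e, by simpa using he⟩
  have h2₂ : s₂ 2 0 = I.n ∧ s₂ 3 0 = I.m := by
    rw [ha₂ 2 (by simp), ha₂ 3 (by simp)]
    simpa using ⟨h2, h3⟩
  have ha₂ : Agree [2, 3, 4, 5, 6, 7, 9, 10, 11, 20] s₀ s₂ :=
    ((ha₁.mono (by simp)).set (by simp) _ _).trans (ha₂.mono (by simp))
  refine .seq (.write (.seq ?_))
  refine (initSlack_runs (r := r) (D := D) hn hm (by simpa using h2₂.1) (by simpa using h2₂.2) hr
    (by simpa using hst.arcs.2)).mono ?_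
  rintro s₃ ⟨ha₃, h14⟩
  refine .seq ((copyArray_runs (f := fun e => (((D e).1 : ℕ) : ℤ)) hm
    (by simpa [ha₃ 3] using h2₂.2) (by simpa [ha₃ 4] using hst.arcs.1) (by simp) (by simp) (by simp)
    (by simp)).mono ?_)
  rintro s₄ ⟨ha₄, h12⟩
  refine (copyArray_runs (f := fun e => (((D e).2 : ℕ) : ℤ)) hm
    (by simpa [ha₃ 3, ha₄ 3] using h2₂.2) (by simpa [ha₃ 5, ha₄ 5] using hst.arcs.2) (by simp)
    (by simp) (by simp) (by simp)).mono ?_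
  rintro s₅ ⟨ha₅, h13⟩
  refine ⟨((((ha₂.mono (by simp)).set (by simp) _ _).trans (ha₃.mono (by simp))).trans
    (ha₄.mono (by simp))).trans (ha₅.mono (by simp)), D,
    fun v => indeg D v - if v = r then 0 else 1, ?_⟩
  refine ⟨?_, ?_, ?_, ⟨?_, h13⟩, ?_, hst.orientation, hroot, fun v => ?_⟩
  · simpa [ha₅ 2, ha₄ 2, ha₃ 2] using h2₂.1
  · simpa [ha₅ 3, ha₄ 3, ha₃ 3] using h2₂.2
  · simp [ha₅ 9, ha₄ 9, ha₃ 9, Expr.eval]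
  · simpa [ha₅ 12] using h12
  · intro v
    have e1 := h14 v
    have e2 := hpos v
    rw [ha₅ 14 (by simp), ha₄ 14 (by simp), e1]
    dsimp only
    split_ifs at e2 ⊢ <;> omega
  · have e2 := hpos v
    simp only [Pi.zero_apply]
    omega

end Initialize

/-! ## The greedy algorithm

Further arrays:
* `1`: the current vector
* `22`: the weights of the vertices that have not been processed, and `0` for the other vertices
* `23`, `24`: a vertex with maximal positive weight, or `-1`, and its weight
* `25`: counter
-/

/-- Increase the entry of the vertex in array `15` as often as possible. -/
def saturate : Program :=
  .write 17 (.const 0) (.const 1) ;;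
    .loop (.cell 17) (augment ;;
      .ite (.cell 17) (.write 1 (.cell 15) (.add (.read 1 (.cell 15)) (.const 1))) .skip)

/-- Find a vertex whose entry in array `22` is maximal and positive. -/
def selectMax : Program :=
  .write 23 (.const 0) (.const (-1)) ;; .write 24 (.const 0) (.const 0) ;;
    .for 11 (.cell 2)
      (.ite (.sub (.read 22 (.cell 11)) (.cell 24))
        (.write 23 (.const 0) (.cell 11) ;; .write 24 (.const 0) (.read 22 (.cell 11))) .skip)

/-- Read the vector that follows the graph in the input to array `22`. -/
def readVector : Program :=
  .for 11 (.cell 2) (.write 22 (.cell 11)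
    (.read 0 (.add (.add (.const 2) (.add (.cell 3) (.cell 3))) (.cell 11))))

/-- Maximize a linear function over the feasible split vectors. -/
def optimize : Program :=
  prepare ;; readVector ;;
    .for 25 (.cell 2)
      (selectMax ;; .ite (.add (.cell 23) (.const 1))
        (.write 22 (.cell 23) (.const 0) ;; .write 15 (.const 0) (.cell 23) ;; saturate) .skip)

section Optimize

variable {n m N : ℕ} {s : Store} {ends D : Fin m → Fin n × Fin n} {r u v : Fin n}
  {ν sl : Fin n → ℕ}

/-- An entry never exceeds the number `m` of edges, which leaves at most `m - ν v` successful
augmentations and one that fails. -/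
theorem saturate_runs (hn : n ≤ N) (hm : m + 1 ≤ N) (h : AugState ends r s ν D sl)
    (hr : (r : ℕ) = 0) (hv : s 15 0 = ((v : ℕ) : ℤ)) (h1 : Holds (s 1) fun v => (ν v : ℤ)) :
    Runs N saturate s fun s' => Agree (1 :: scratch) s s' ∧ ∃ ν' D' sl',
      AugState ends r s' ν' D' sl' ∧ Holds (s' 1) (fun v => (ν' v : ℤ)) ∧ ν ≤ ν' ∧
      (∀ u, u ≠ v → ν' u = ν u) ∧ ¬ Orientable ends r (ν' + Pi.single v 1) := by
  have hcard : ∀ {s' : Store} {ν' D' sl'}, AugState ends r s' ν' D' sl' → ν' v ≤ m :=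
    fun h' => by simpa using h'.orientable.le_card v
  refine .seq (.write (.loop (fun k s' => Agree (1 :: scratch) s s' ∧ ∃ ν' D' sl',
    AugState ends r s' ν' D' sl' ∧ Holds (s' 1) (fun v => (ν' v : ℤ)) ∧ ν ≤ ν' ∧
    (∀ u, u ≠ v → ν' u = ν u) ∧ (s' 17 0 = 1 ∧ ν' v + k = m + 1 ∨
      s' 17 0 = 0 ∧ ¬ Orientable ends r (ν' + Pi.single v 1))) (k := m + 1 - ν v) (by omega)
    ?_ ?_ ?_))
  · have ha : Agree [17] s (s.set 17 ((Expr.const 0).eval s) ((Expr.const 1).eval s)) :=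
      (Agree.refl _ s).set (by simp) _ _
    have := hcard h
    exact ⟨ha.mono (by simp), ν, D, sl, h.of_agree ha (by simp), by simpa using h1, le_rfl,
      fun _ _ => rfl, Or.inl ⟨by simp [Expr.eval], by omega⟩⟩
  · rintro k s₁ ⟨ha₁, ν₁, D₁, sl₁, hst₁, h1₁, hle, hne, hprog⟩ hpos
    simp only [Expr.eval] at hpos
    rcases hprog with ⟨-, hk⟩ | ⟨h17, -⟩
    swap
    · omega
    have hv₁ : s₁ 15 0 = ((v : ℕ) : ℤ) := by rw [ha₁ 15 (by simp), hv]
    have hkpos := hcard hst₁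
    refine .seq ((augment_runs hn (by omega) hst₁ hr hv₁).mono ?_)
    rintro s₂ ⟨ha₂, hres⟩
    have ha : Agree (1 :: scratch) s s₂ :=
      ha₁.trans (ha₂.mono fun a ha => List.mem_cons_of_mem _ ha)
    rcases hres with ⟨h17, D₂, sl₂, hst₂⟩ | ⟨h17, ⟨D₂, sl₂, hst₂⟩, hnot⟩
    · have hv₂ : s₂ 15 0 = ((v : ℕ) : ℤ) := by rw [ha₂ 15 (by simp), hv₁]
      refine .ite (fun _ => .write ⟨k - 1, by omega, ha.set (by simp) _ _,
        ν₁ + Pi.single v 1, D₂, sl₂, ?_, ?_, hle.trans le_self_add, fun u hu => ?_, Or.inl ⟨?_, ?_⟩⟩)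
        (fun h => absurd h (by simp [Expr.eval, h17]))
      · exact hst₂.of_agree (L := [1]) ((Agree.refl _ s₂).set (by simp) _ _) (by simp)
      · have hf : (fun u => (((ν₁ + Pi.single v 1 : Fin n → ℕ) u : ℕ) : ℤ)) =
            Function.update (fun u => (ν₁ u : ℤ)) v ((ν₁ v : ℤ) + 1) := by
          funext u
          by_cases hu : u = v
          · subst hu
            simp
          · simp [hu]
        rw [hf]
        have := h1₁.update v ((ν₁ v : ℤ) + 1)
        simpa [Expr.eval, hv₂, ha₂ 1, h1₁ v] using this
      · simpa [hu] using hne u hu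
      · simp [h17]
      · simp only [Pi.add_apply, Pi.single_eq_same]
        omega
    · refine .ite (fun h => absurd h (by simp [Expr.eval, h17])) (fun _ => .skip
        ⟨k - 1, by omega, ha, ν₁, D₂, sl₂, hst₂, ?_, hle, hne, Or.inr ⟨h17, hnot⟩⟩)
      rw [ha₂ 1 (by simp)]
      exact h1₁
  · rintro k s₁ ⟨ha₁, ν₁, D₁, sl₁, hst₁, h1₁, hle, hne, hprog⟩ hpos
    simp only [Expr.eval] at hpos
    rcases hprog with ⟨h17, -⟩ | ⟨-, hnot⟩
    · omega
    · exact ⟨ha₁, ν₁, D₁, sl₁, hst₁, h1₁, hle, hne, hnot⟩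

theorem selectMax_runs (hn : n ≤ N) (hs2 : s 2 0 = n) {g : Fin n → ℤ} (h22 : Holds (s 22) g) :
    Runs N selectMax s fun s' => Agree [11, 23, 24] s s' ∧
      ((s' 23 0 = -1 ∧ ∀ u, g u ≤ 0) ∨
        ∃ v : Fin n, s' 23 0 = ((v : ℕ) : ℤ) ∧ 0 < g v ∧ ∀ u, g u ≤ g v) := by
  refine .seq (.write (.seq (.write (.for (fun k s' => Agree [11, 23, 24] s s' ∧
    ((s' 23 0 = -1 ∧ s' 24 0 = 0 ∧ ∀ u : Fin n, (u : ℕ) < k → g u ≤ 0) ∨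
      ∃ v : Fin n, s' 23 0 = ((v : ℕ) : ℤ) ∧ s' 24 0 = g v ∧ 0 < g v ∧
        ∀ u : Fin n, (u : ℕ) < k → g u ≤ g v)) hn ?_ ?_ ?_ ?_))))
  · rintro k s' ⟨ha, -⟩
    simp [Expr.eval, ha 2 (by simp), hs2]
  · exact ⟨(((Agree.refl _ s).set (by simp) _ _).set (by simp) _ _).set (by simp) _ _,
      Or.inl (by simp [Expr.eval])⟩
  · rintro k hk s' ⟨ha, hres⟩ hs'
    have hg : s' 22 k = g ⟨k, hk⟩ := by
      rw [ha 22 (by simp)]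
      exact h22 ⟨k, hk⟩
    have hlt : ∀ {u : Fin n} {x : ℤ}, (u : ℕ) < k + 1 → ((u : ℕ) < k → g u ≤ x) →
        g ⟨k, hk⟩ ≤ x → g u ≤ x := by
      intro u x hu h1 h2
      by_cases huk : (u : ℕ) = k
      · rwa [show u = ⟨k, hk⟩ from Fin.ext huk]
      · exact h1 (by omega)
    refine .ite (fun h1 => .seq (.write (.write ⟨by simpa using hs',
      ((ha.set (by simp) _ _).set (by simp) _ _).set (by simp) _ _, Or.inr ⟨⟨k, hk⟩, ?_, ?_, ?_, ?_⟩⟩)))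
      (fun h1 => .skip ⟨hs', ha.set (by simp) _ _, ?_⟩) <;>
      simp only [Expr.eval, hs', hg] at h1
    · simp [Expr.eval, hs']
    · simp [Expr.eval, hs', hg]
    · rcases hres with ⟨-, h24, -⟩ | ⟨v, -, h24, hv, -⟩ <;> omega
    · intro u hu
      refine hlt hu (fun hu => ?_) le_rfl
      rcases hres with ⟨-, h24, hall⟩ | ⟨v, -, h24, hv, hall⟩
      · have := hall u hu
        omega
      · have := hall u hu
        omega
    · rcases hres with ⟨h23, h24, hall⟩ | ⟨v, h23, h24, hv, hall⟩
      · exact Or.inl ⟨by simpa using h23, by simpa using h24,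
          fun u hu => hlt hu (hall u) (by omega)⟩
      · exact Or.inr ⟨v, by simpa using h23, by simpa using h24, hv,
          fun u hu => hlt hu (hall u) (by omega)⟩
  · rintro s' ⟨ha, ⟨h23, -, hall⟩ | ⟨v, h23, -, hv, hall⟩⟩
    · exact ⟨ha, Or.inl ⟨h23, fun u => hall u u.2⟩⟩
    · exact ⟨ha, Or.inr ⟨v, h23, hv, fun u => hall u u.2⟩⟩

theorem readVector_runs (I : EdgeList) (w : Fin I.n → ℤ) (hn : I.n ≤ N) (hs2 : s 2 0 = I.n)
    (hs3 : s 3 0 = I.m) (h0 : s 0 = inputStore (I.encode ++ List.ofFn w) 0) :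
    Runs N readVector s fun s' => Agree [11, 22] s s' ∧ Holds (s' 22) w := by
  refine .for (fun k s' => Agree [11, 22] s s' ∧
    ∀ v : Fin I.n, (v : ℕ) < k → s' 22 ((v : ℕ) : ℤ) = w v) hn ?_ ?_ ?_ ?_
  · rintro k s' ⟨ha, -⟩
    simp [Expr.eval, ha 2 (by simp), hs2]
  · exact ⟨(Agree.refl _ s).set (by simp) _ _, by simp⟩
  · rintro k hk s' ⟨ha, hv⟩ hs'
    refine .write ⟨by simpa using hs', (ha.set (by simp) _ _).set (by simp) _ _, fun v hvk => ?_⟩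
    by_cases hvk' : (v : ℕ) = k
    · have hw : s 0 (2 + ((I.m : ℤ) + I.m) + k) = w v := by
        rw [h0, ← inputStore_apply (((I.getElem?_encode_append (List.ofFn w)).2.2.2 v).trans
          (List.getElem?_ofFn.trans (dif_pos v.2))), hvk']
        push_cast
        rw [two_mul]
      simp [Expr.eval, hs', ha 3, hs3, ha 0, hw, hvk']
    · have hne : ((v : ℕ) : ℤ) ≠ (k : ℤ) := by exact_mod_cast hvk'
      simpa [Expr.eval, hs', hne] using hv v (by omega)
  · exact fun s' ⟨ha, hv⟩ => ⟨ha, fun v => hv v v.2⟩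

/-- The state of the greedy algorithm after the vertices in `A` have been processed. -/
structure GreedyState (ends : Fin m → Fin n × Fin n) (r : Fin n) (w : Fin n → ℤ) (s : Store)
    (A : Finset (Fin n)) (ν : Fin n → ℕ) : Prop where
  state : ∃ D sl, AugState ends r s ν D sl
  vector : Holds (s 1) fun v => (ν v : ℤ)
  weights : Holds (s 22) fun v => if v ∈ A then 0 else w v
  pos : ∀ a ∈ A, 0 < w a
  le : ∀ a ∈ A, ∀ b ∉ A, w b ≤ w a
  zero : ∀ v ∉ A, ν v = 0
  saturated : ∀ v ∈ A, ¬ Orientable ends r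
    ((fun u => if w v ≤ w u then ν u else 0) + Pi.single v 1)

theorem GreedyState.of_agree {w : Fin n → ℤ} {A : Finset (Fin n)} {s' : Store}
    (h : GreedyState ends r w s A ν) {L : List ℕ} (ha : Agree L s s')
    (hL : ∀ a ∈ L, a ∉ [1, 2, 3, 9, 12, 13, 14, 22]) : GreedyState ends r w s' A ν := by
  obtain ⟨D, sl, hst⟩ := h.state
  refine ⟨⟨D, sl, hst.of_agree ha fun a haL => ?_⟩, ?_, ?_, h.pos, h.le, h.zero, h.saturated⟩
  · have := hL a haL
    simp only [List.mem_cons, not_or] at this ⊢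
    tauto
  · rw [ha 1 fun h => hL 1 h (by simp)]
    exact h.vector
  · rw [ha 22 fun h => hL 22 h (by simp)]
    exact h.weights

/-- The new vector vanishes outside `insert v A`, where all weights are at least `w v`, so
truncation at the level of `v` loses nothing. Entries processed before remain saturated as the
vector grows. -/
theorem greedyStep_runs (hn : n ≤ N) (hm : m + 1 ≤ N) {w : Fin n → ℤ} {A : Finset (Fin n)}
    (h : GreedyState ends r w s A ν) (hr : (r : ℕ) = 0) (hv : v ∉ A) (hw : 0 < w v)
    (hmax : ∀ u ∉ A, w u ≤ w v) (h23 : s 23 0 = ((v : ℕ) : ℤ)) :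
    Runs N (.write 22 (.cell 23) (.const 0) ;; .write 15 (.const 0) (.cell 23) ;; saturate) s
      fun s' => Agree (1 :: 15 :: 22 :: scratch) s s' ∧
        ∃ ν', GreedyState ends r w s' (insert v A) ν' := by
  obtain ⟨D, sl, hst⟩ := h.state
  refine .seq (.write (.seq (.write ?_)))
  set s₁ := (s.set 22 ((Expr.cell 23).eval s) ((Expr.const 0).eval s)) with hs₁
  set s₂ := s₁.set 15 ((Expr.const 0).eval s₁) ((Expr.cell 23).eval s₁) with hs₂
  have ha : Agree [15, 22] s s₂ := ((Agree.refl _ s).set (by simp) _ _).set (by simp) _ _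
  refine (saturate_runs (v := v) hn hm (hst.of_agree ha (by simp)) hr
    (by simp [hs₂, hs₁, Expr.eval, h23]) (by rw [ha 1 (by simp)]; exact h.vector)).mono ?_
  rintro s₃ ⟨ha₃, ν', D', sl', hst', h1', hle, hne, hnot⟩
  refine ⟨(ha.mono (by simp)).trans (ha₃.mono (by simp)), ν', ⟨D', sl', hst'⟩, h1', ?_, ?_, ?_, ?_,
    ?_⟩
  · have hf : (fun u => if u ∈ insert v A then 0 else w u) =
        Function.update (fun u => if u ∈ A then 0 else w u) v 0 := by
      funext u
      by_cases hu : u = v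
      · simp [hu]
      · simp [hu]
    rw [hf, ha₃ 22 (by simp)]
    have := h.weights.update v 0
    simpa [hs₂, hs₁, Expr.eval, h23] using this
  · intro a ha
    rcases Finset.mem_insert.1 ha with rfl | ha
    · exact hw
    · exact h.pos a ha
  · intro a ha b hb
    rw [Finset.mem_insert, not_or] at hb
    rcases Finset.mem_insert.1 ha with rfl | ha
    · exact hmax b hb.2
    · exact h.le a ha b hb.2
  · intro u hu
    rw [Finset.mem_insert, not_or] at hu
    rw [hne u hu.1, h.zero u hu.2]
  · intro a ha hor
    rcases Finset.mem_insert.1 ha with rfl | ha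
    · refine hnot (hor.mono (add_le_add (fun u => ?_) le_rfl))
      dsimp only
      split_ifs with hu
      · exact le_rfl
      · have huv : u ≠ a := fun h => hu (h ▸ le_rfl)
        have huA : u ∉ A := fun huA => hu (h.le u huA a hv)
        rw [hne u huv, h.zero u huA]
    · refine h.saturated a ha (hor.mono (add_le_add (fun u => ?_) le_rfl))
      dsimp only
      split_ifs
      · exact hle u
      · exact le_rfl

theorem optimize_runs (I : EdgeList) (w : Fin I.n → ℤ) (hconn : Connected I.toGraph)
    {r : Fin I.n} (hr : (r : ℕ) = 0) :
    Runs (bitLength (I.encode ++ List.ofFn w)) optimize (inputStore (I.encode ++ List.ofFn w))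
      fun s => ∃ ν : Fin I.n → ℕ, Holds (s 1) (fun v => (ν v : ℤ)) ∧ Orientable I.ends r ν ∧
        (∀ v, w v ≤ 0 → ν v = 0) ∧ ∀ v, 0 < w v → ¬ Orientable I.ends r
          ((fun u => if w v ≤ w u then ν u else 0) + Pi.single v 1) := by
  have hN := I.add_le_bitLength w
  refine .seq ((prepare_runs I w hconn (by omega) (by omega) hr).mono ?_)
  rintro s₁ ⟨ha₁, D₁, sl₁, hst₁⟩
  refine .seq ((readVector_runs I w (by omega) hst₁.vertices hst₁.edges (ha₁ 0 (by simp))).mono ?_)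
  rintro s₂ ⟨ha₂, h22⟩
  -- Array `1` is still in its initial state and therefore holds the zero vector.
  have hg : GreedyState I.ends r w s₂ ∅ 0 :=
    ⟨⟨D₁, sl₁, hst₁.of_agree ha₂ (by simp)⟩, fun v => by
      simp [ha₂ 1, ha₁ 1, inputStore], by simpa using h22, by simp, by simp, by simp, by simp⟩
  refine .for (fun k s => ∃ A ν, GreedyState I.ends r w s A ν ∧
    (k ≤ A.card ∨ ∀ v ∉ A, w v ≤ 0)) (K := I.n) (by omega) ?_ ?_ ?_ ?_
  · rintro k s ⟨A, ν, h, -⟩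
    obtain ⟨D, sl, hst⟩ := h.state
    exact hst.vertices
  · exact ⟨∅, 0, hg.of_agree (L := [25]) ((Agree.refl _ s₂).set (by simp) _ _) (by simp),
      Or.inl (by simp)⟩
  · rintro k hk s ⟨A, ν, h, hprog⟩ hs
    obtain ⟨D, sl, hst⟩ := h.state
    have hset : ∀ {s : Store} {x : ℤ}, Agree [25] s (s.set 25 0 x) :=
      fun {s x} => (Agree.refl _ s).set (by simp) _ _
    refine .seq ((selectMax_runs (by omega) hst.vertices h.weights).mono ?_)
    rintro s' ⟨ha, ⟨h23, hall⟩ | ⟨v, h23, hpos, hmax⟩⟩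
    · refine .ite (fun h => absurd h (by simp [Expr.eval, h23])) (fun _ => .skip
        ⟨by rw [ha 25 (by simp), hs], A, ν, (h.of_agree ha (by simp)).of_agree hset (by simp),
          Or.inr fun v hv => ?_⟩)
      simpa [hv] using hall v
    · have hv : v ∉ A := fun hv => by simp [hv] at hpos
      rw [if_neg hv] at hpos hmax
      refine .ite (fun _ => ?_) (fun h => absurd h (by simp [Expr.eval, h23]))
      refine (greedyStep_runs (by omega) (by omega) (h.of_agree ha (by simp)) hr hv hpos
        (fun u hu => by simpa [hu] using hmax u) h23).mono ?_
      rintro s'' ⟨ha', ν', h'⟩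
      refine ⟨by rw [ha' 25 (by simp), ha 25 (by simp), hs], insert v A, ν',
        h'.of_agree hset (by simp), Or.inl ?_⟩
      rw [Finset.card_insert_of_notMem hv]
      rcases hprog with hk | hk
      · omega
      · exact absurd (hk v hv) (not_le.2 hpos)
  · rintro s ⟨A, ν, h, hprog⟩
    obtain ⟨D, sl, hst⟩ := h.state
    have hA : ∀ v, 0 < w v → v ∈ A := by
      intro v hv
      rcases hprog with hk | hk
      · have : A = Finset.univ := by
          rw [← Finset.card_eq_iff_eq_univ, Fintype.card_fin]
          exact le_antisymm (by simpa using A.card_le_univ) hk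
        simp [this]
      · by_contra hvA
        exact absurd (hk v hvA) (not_le.2 hv)
    exact ⟨ν, h.vector, hst.orientable,
      fun v hv => h.zero v fun hvA => absurd (h.pos v hvA) (not_lt.2 hv),
      fun v hv => h.saturated v (hA v hv)⟩

end Optimize

/-! ## Construction of a certificate

Further arrays:
* `1`: the output
* `22`: the numbers of copies of the vertices that are still wanted
* `23`: the number of copies so far, `24`: whether the current arc can be used to split its head
* `25`, `26`: counters
-/

/-- Find an orientation for the vector in array `22`. -/
def orient : Program :=
  .for 25 (.cell 2) (.for 26 (.read 22 (.cell 25)) (.write 15 (.const 0) (.cell 25) ;; augment))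

/-- Search the orientation that was found, and let the root have no parent arc. -/
def searchTree : Program :=
  copyArray 12 4 ;; copyArray 13 5 ;; .write 8 (.const 0) (.const 0) ;; search ;;
    .write 7 (.const 0) (.const (-1))

/-- The address of the `e`-th vertex label in the output. -/
abbrev labelAddr (e : Expr) : Expr := .add (.add (.const 2) (.add (.cell 3) (.cell 3))) e

/-- The address of the tail (`c = 2`) or the head (`c = 3`) of an arc in the output. -/
abbrev arcAddr (c : ℤ) : Expr := .add (.const c) (.add (.cell 11) (.cell 11))

/-- Attach the current arc to a new copy of its head. -/
def splitHead : Program :=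
  .write 1 (arcAddr 3) (.cell 23) ;; .write 1 (labelAddr (.cell 23)) (.read 5 (.cell 11)) ;;
    .write 22 (.read 5 (.cell 11)) (.sub (.read 22 (.read 5 (.cell 11))) (.const 1)) ;;
    .write 23 (.const 0) (.add (.cell 23) (.const 1))

/-- Attach the current arc to the main copy of its head. -/
def keepHead : Program :=
  .write 1 (arcAddr 3) (.read 5 (.cell 11))

/-- Output the endpoints of the current arc. -/
def outputArc : Program :=
  .write 1 (arcAddr 2) (.read 4 (.cell 11)) ;;
    .write 24 (.const 0) (.const 0) ;;
    .ite (.sub (.read 7 (.read 5 (.cell 11))) (.cell 11)) (.write 24 (.const 0) (.const 1)) .skip ;;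
    .ite (.sub (.cell 11) (.read 7 (.read 5 (.cell 11)))) (.write 24 (.const 0) (.const 1)) .skip ;;
    .ite (.cell 24) (.ite (.read 22 (.read 5 (.cell 11))) splitHead keepHead) keepHead

/-- Output the graph obtained by splitting vertices. -/
def outputSplit : Program :=
  .write 23 (.const 0) (.cell 2) ;;
    .for 11 (.cell 2) (.write 1 (labelAddr (.cell 11)) (.cell 11)) ;;
    .for 11 (.cell 3) outputArc ;;
    .write 1 (.const 0) (.cell 23) ;; .write 1 (.const 1) (.cell 3)

/-- Construct a certificate for a feasible split vector. -/
def construct : Program :=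
  prepare ;; readVector ;; orient ;; searchTree ;; outputSplit

section Split

variable {n m N : ℕ} {s : Store} {ends D : Fin m → Fin n × Fin n} {r : Fin n} {μ : Fin n → ℕ}

/-- All vectors on the way are below `μ`, hence orientable, so no augmentation can fail. -/
theorem orient_runs (hn : n ≤ N) (hm : m ≤ N) (hr : (r : ℕ) = 0)
    (h : ∃ D sl, AugState ends r s 0 D sl) (hμ : Orientable ends r μ)
    (h22 : Holds (s 22) fun v => (μ v : ℤ)) :
    Runs N orient s fun s' => Agree (15 :: 25 :: 26 :: scratch) s s' ∧
      ∃ D sl, AugState ends r s' μ D sl := by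
  obtain ⟨D₀, sl₀, hst₀⟩ := h
  have hset : ∀ {s : Store} {ν D sl} {a : ℕ} {k x : ℤ}, AugState ends r s ν D sl →
      a ∈ [15, 25, 26] → AugState ends r (s.set a k x) ν D sl := by
    intro s ν D sl a k x h ha
    refine h.of_agree (L := [a]) ((Agree.refl _ s).set (by simp) _ _) ?_
    simp only [List.mem_cons, List.not_mem_nil, or_false] at ha ⊢
    omega
  refine .for (fun k s' => Agree (15 :: 25 :: 26 :: scratch) s s' ∧ ∃ D sl,
    AugState ends r s' (fun v : Fin n => if (v : ℕ) < k then μ v else 0) D sl) hn ?_ ?_ ?_ ?_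
  · rintro k s' ⟨-, D, sl, hst⟩
    exact hst.vertices
  · refine ⟨(Agree.refl _ s).set (by simp) _ _, D₀, sl₀, ?_⟩
    simp only [Nat.not_lt_zero, if_false]
    exact hset hst₀ (by simp)
  · rintro k hk s₁ ⟨ha₁, D₁, sl₁, hst₁⟩ hs₁
    have hμm : μ ⟨k, hk⟩ ≤ m := by simpa using hμ.le_card ⟨k, hk⟩
    refine .for (fun l s' => Agree (15 :: 25 :: 26 :: scratch) s s' ∧ s' 25 0 = k ∧ ∃ D sl,
      AugState ends r s' (fun v : Fin n =>
        if (v : ℕ) < k then μ v else if (v : ℕ) = k then l else 0) D sl)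
      (hμm.trans hm) ?_ ?_ ?_ ?_
    · rintro l s' ⟨ha, h25, -⟩
      simp only [Expr.eval, h25, ha 22 (by simp)]
      exact h22 ⟨k, hk⟩
    · refine ⟨ha₁.set (by simp) _ _, by simpa using hs₁, D₁, sl₁, ?_⟩
      simp only [ite_self]
      exact hset hst₁ (by simp)
    · rintro l hl s₂ ⟨ha₂, h25, D₂, sl₂, hst₂⟩ hs₂
      refine .seq (.write ?_)
      refine (augment_runs (v := ⟨k, hk⟩) hn hm (hset hst₂ (by simp)) hr
        (by simp [Expr.eval, h25])).mono ?_
      rintro s₃ ⟨ha₃, hres⟩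
      have hν : (fun v : Fin n => if (v : ℕ) < k then μ v else if (v : ℕ) = k then l else 0) +
          Pi.single ⟨k, hk⟩ 1 =
            fun v : Fin n => if (v : ℕ) < k then μ v else if (v : ℕ) = k then l + 1 else 0 := by
        funext v
        simp only [Pi.add_apply, Pi.single_apply, Fin.ext_iff]
        split_ifs <;> omega
      rw [hν] at hres
      have h26 : s₃ 26 0 = l := by
        rw [ha₃ 26 (by simp)]
        simpa using hs₂
      have h25₃ : s₃ 25 0 = k := by
        rw [ha₃ 25 (by simp)]
        simpa using h25
      rcases hres with ⟨-, D₃, sl₃, hst₃⟩ | ⟨-, -, hnot⟩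
      · exact ⟨h26, (((ha₂.set (by simp) _ _).trans (ha₃.mono fun a ha => by simp [ha]))).set
          (by simp) _ _, by simpa using h25₃, D₃, sl₃, hset hst₃ (by simp)⟩
      · refine absurd (hμ.mono fun v => ?_) hnot
        dsimp only
        split_ifs with h1 h2
        · exact le_rfl
        · rw [show v = ⟨k, hk⟩ from Fin.ext h2]
          omega
        · exact Nat.zero_le _
    · rintro s' ⟨ha, h25, D, sl, hst⟩
      refine ⟨h25, ha.set (by simp) _ _, D, sl, ?_⟩
      have hν : (fun v : Fin n => if (v : ℕ) < k then μ v else if (v : ℕ) = k then μ ⟨k, hk⟩ else 0)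
          = fun v : Fin n => if (v : ℕ) < k + 1 then μ v else 0 := by
        funext v
        by_cases hvk : (v : ℕ) = k
        · simp [show v = ⟨k, hk⟩ from Fin.ext hvk]
        · have : (v : ℕ) < k + 1 ↔ (v : ℕ) < k := by omega
          simp [hvk, this]
      rw [← hν]
      exact hset hst (by simp)
  · rintro s' ⟨ha, D, sl, hst⟩
    refine ⟨ha, D, sl, ?_⟩
    have hν : (fun v : Fin n => if (v : ℕ) < n then μ v else 0) = μ := funext fun v => if_pos v.2
    rwa [hν] at hst

theorem searchTree_runs (hn : n ≤ N) (hm : m ≤ N) (hr : (r : ℕ) = 0) {sl : Fin n → ℕ}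
    (h : AugState ends r s μ D sl) :
    Runs N searchTree s fun s' => Agree [4, 5, 6, 7, 8, 10, 11, 20] s s' ∧
      HoldsArcs (s' 4) (s' 5) D ∧ s' 7 0 = -1 ∧
      ∃ mk, SearchTree D r mk (s' 7) ∧ ∀ v, 0 < mk v := by
  refine .seq ((copyArray_runs hm h.edges h.arcs.1 (by simp) (by simp) (by simp)
    (by simp)).mono fun s₁ ⟨ha₁, h4⟩ => .seq ?_)
  refine (copyArray_runs (f := fun e => (((D e).2 : ℕ) : ℤ)) hm (by rw [ha₁ 3 (by simp), h.edges])
    (by rw [ha₁ 13 (by simp)]; exact h.arcs.2) (by simp) (by simp) (by simp) (by simp)).mono ?_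
  rintro s₂ ⟨ha₂, h5⟩
  have h4₂ : HoldsArcs (s₂ 4) (s₂ 5) D := ⟨by rw [ha₂ 4 (by simp)]; exact h4, h5⟩
  refine .seq (.write (.seq ?_))
  have ha₃ : Agree [4, 5, 8, 11] s (s₂.set 8 ((Expr.const 0).eval s₂) ((Expr.const 0).eval s₂)) :=
    ((ha₁.mono (by simp)).trans (ha₂.mono (by simp))).set (by simp) _ _
  refine (search_runs (D₀ := D) (src := r) hn hm (by rw [ha₃ 2 (by simp), h.vertices])
    (by rw [ha₃ 3 (by simp), h.edges]) (by simpa using h4₂) (by simp [Expr.eval, hr])).mono ?_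
  rintro s₄ ⟨ha₄, D', mk, hst, hclosed⟩
  rw [ha₃ 9 (by simp), h.noSwap] at hst hclosed
  obtain rfl : D' = D := hst.fixed le_rfl
  refine .write ⟨((ha₃.mono (by simp)).trans (ha₄.mono (by simp))).set (by simp) _ _,
    by simpa using hst.arcs, by simp [Expr.eval], mk,
    ⟨hst.tree.root, hst.tree.le_card, fun v hv h0 => ?_⟩,
    fun v => (hst.pos_iff_reaches le_rfl hclosed v).2 (h.rootConnected v)⟩
  obtain ⟨e, h1, h2⟩ := hst.tree.parent v hv h0
  refine ⟨e, ?_, h2⟩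
  -- The final write concerns cell `0` only, which belongs to the root.
  have hne : (v : ℕ) ≠ 0 := fun h => hv (Fin.ext (h.trans hr.symm))
  simpa [Expr.eval, hne] using h1

/-! ### Splitting heads arc by arc -/

/-- The result of splitting heads of the first `k` arcs: there are `K` vertices, the vertex `i` is a
copy of `φ i`, the arc `e` enters `hd e`, and `rem v` further copies of `v` are wanted. The arcs in
`T` are not used for splitting. -/
structure Splitting (D : Fin m → Fin n × Fin n) (T : Fin m → Prop) (μ : Fin n → ℕ) (k K : ℕ)
    (φ : ℕ → Fin n) (hd : Fin m → ℕ) (rem : Fin n → ℕ) : Prop where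
  le : n ≤ K
  main : ∀ v : Fin n, φ v = v
  head_lt : ∀ e : Fin m, (e : ℕ) < k → hd e < K
  head : ∀ e : Fin m, (e : ℕ) < k → φ (hd e) = (D e).2
  tree : ∀ e : Fin m, (e : ℕ) < k → T e → hd e = (D e).2
  copy : ∀ i, n ≤ i → i < K → ∃ e : Fin m, (e : ℕ) < k ∧ hd e = i
  count : ∀ v, ((Finset.range K).filter fun i => φ i = v).card + rem v = μ v + 1
  rem_le : ∀ v, rem v ≤ {e : Fin m | k ≤ (e : ℕ) ∧ ¬ T e ∧ (D e).2 = v}.ncard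

theorem Splitting.init {T : Fin m → Prop} (hμ : ∀ v, μ v ≤ {e | ¬ T e ∧ (D e).2 = v}.ncard)
    {φ : ℕ → Fin n} (hφ : ∀ v : Fin n, φ v = v) (hd : Fin m → ℕ) :
    Splitting D T μ 0 n φ hd μ := by
  refine ⟨le_rfl, hφ, by simp, by simp, by simp, fun i h1 h2 => by omega, fun v => ?_,
    by simpa using hμ⟩
  have : (Finset.range n).filter (fun i => φ i = v) = {(v : ℕ)} := by
    ext i
    simp only [Finset.mem_filter, Finset.mem_range, Finset.mem_singleton]
    constructor
    · rintro ⟨hi, h⟩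
      have := hφ ⟨i, hi⟩
      rw [← h, this]
    · rintro rfl
      exact ⟨v.2, hφ v⟩
  rw [this, Finset.card_singleton, add_comm]

/-- At the head of the arc, both sides of `rem_le` drop by one: one copy fewer is wanted, and one
usable arc fewer remains. -/
theorem Splitting.split {T : Fin m → Prop} {k K : ℕ} {φ : ℕ → Fin n} {hd : Fin m → ℕ}
    {rem : Fin n → ℕ} (h : Splitting D T μ k K φ hd rem) (hk : k < m) (hT : ¬ T ⟨k, hk⟩)
    (hrem : 0 < rem (D ⟨k, hk⟩).2) :
    Splitting D T μ (k + 1) (K + 1) (Function.update φ K (D ⟨k, hk⟩).2)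
      (Function.update hd ⟨k, hk⟩ K)
      (Function.update rem (D ⟨k, hk⟩).2 (rem (D ⟨k, hk⟩).2 - 1)) := by
  have hcases : ∀ e : Fin m, (e : ℕ) < k + 1 → e = ⟨k, hk⟩ ∨ (e : ℕ) < k ∧ e ≠ ⟨k, hk⟩ := by
    intro e he
    by_cases hek : (e : ℕ) = k
    · exact Or.inl (Fin.ext hek)
    · exact Or.inr ⟨by omega, fun h => hek (by rw [h])⟩
  refine ⟨h.le.trans (Nat.le_succ K), fun v => ?_, fun e he => ?_, fun e he => ?_, fun e he hTe => ?_,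
    fun i h1 h2 => ?_, fun v => ?_, fun v => ?_⟩
  · have : (v : ℕ) ≠ K := by
      have := h.le
      omega
    rw [Function.update_of_ne this, h.main]
  · rcases hcases e he with rfl | ⟨he, hne⟩
    · simp
    · rw [Function.update_of_ne hne]
      exact (h.head_lt e he).trans (Nat.lt_succ_self K)
  · rcases hcases e he with rfl | ⟨he, hne⟩
    · simp
    · rw [Function.update_of_ne hne, Function.update_of_ne (h.head_lt e he).ne, h.head e he]
  · rcases hcases e he with rfl | ⟨he, hne⟩
    · exact absurd hTe hT
    · rw [Function.update_of_ne hne, h.tree e he hTe]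
  · by_cases hi : i = K
    · exact ⟨⟨k, hk⟩, Nat.lt_succ_self k, by simp [hi]⟩
    · obtain ⟨e, he, hei⟩ := h.copy i h1 (by omega)
      refine ⟨e, he.trans (Nat.lt_succ_self k), ?_⟩
      rw [Function.update_of_ne (fun h => by rw [h] at he; exact lt_irrefl _ he), hei]
  · have hcount := h.count v
    have hf : (Finset.range K).filter (fun i => Function.update φ K (D ⟨k, hk⟩).2 i = v) =
        (Finset.range K).filter fun i => φ i = v := by
      refine Finset.filter_congr fun i hi => ?_
      rw [Function.update_of_ne (Finset.mem_range.1 hi).ne]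
    rw [Finset.range_add_one, Finset.filter_insert, Function.update_self, hf]
    split_ifs with hv
    · rw [Finset.card_insert_of_notMem (by simp), hv, Function.update_self]
      rw [hv] at hrem
      omega
    · rw [Function.update_of_ne (Ne.symm hv), hcount]
  · have hr := h.rem_le v
    by_cases hv : v = (D ⟨k, hk⟩).2
    · subst hv
      rw [Function.update_self]
      have : {e : Fin m | k ≤ (e : ℕ) ∧ ¬ T e ∧ (D e).2 = (D ⟨k, hk⟩).2} =
          insert ⟨k, hk⟩ {e : Fin m | k + 1 ≤ (e : ℕ) ∧ ¬ T e ∧ (D e).2 = (D ⟨k, hk⟩).2} := by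
        ext e
        simp only [Set.mem_ofPred_eq, Set.mem_insert_iff]
        constructor
        · rintro ⟨h1, h2, h3⟩
          rcases Nat.eq_or_lt_of_le h1 with h1 | h1
          · exact Or.inl (Fin.ext h1.symm)
          · exact Or.inr ⟨h1, h2, h3⟩
        · rintro (rfl | ⟨h1, h2, h3⟩)
          · exact ⟨le_rfl, hT, rfl⟩
          · exact ⟨by omega, h2, h3⟩
      rw [this, Set.ncard_insert_of_notMem (by simp)] at hr
      omega
    · rw [Function.update_of_ne hv]
      refine hr.trans (Set.ncard_le_ncard ?_)
      rintro e ⟨h1, h2, h3⟩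
      refine ⟨?_, h2, h3⟩
      rcases Nat.eq_or_lt_of_le h1 with h1 | h1
      · exact absurd (by rw [← h3, show e = ⟨k, hk⟩ from Fin.ext h1.symm]) hv
      · exact h1

/-- `rem_le` survives because the arc is in `T` and was never counted, or because its head wants no
more copies. -/
theorem Splitting.keep {T : Fin m → Prop} {k K : ℕ} {φ : ℕ → Fin n} {hd : Fin m → ℕ}
    {rem : Fin n → ℕ} (h : Splitting D T μ k K φ hd rem) (hk : k < m)
    (hT : T ⟨k, hk⟩ ∨ rem (D ⟨k, hk⟩).2 = 0) :
    Splitting D T μ (k + 1) K φ (Function.update hd ⟨k, hk⟩ (D ⟨k, hk⟩).2) rem := by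
  have hcases : ∀ e : Fin m, (e : ℕ) < k + 1 → e = ⟨k, hk⟩ ∨ (e : ℕ) < k ∧ e ≠ ⟨k, hk⟩ := by
    intro e he
    by_cases hek : (e : ℕ) = k
    · exact Or.inl (Fin.ext hek)
    · exact Or.inr ⟨by omega, fun h => hek (by rw [h])⟩
  refine ⟨h.le, h.main, fun e he => ?_, fun e he => ?_, fun e he hTe => ?_,
    fun i h1 h2 => ?_, h.count, fun v => ?_⟩
  · rcases hcases e he with rfl | ⟨he, hne⟩
    · rw [Function.update_self]
      exact (D _).2.2.trans_le h.le
    · rw [Function.update_of_ne hne]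
      exact h.head_lt e he
  · rcases hcases e he with rfl | ⟨he, hne⟩
    · rw [Function.update_self, h.main]
    · rw [Function.update_of_ne hne, h.head e he]
  · rcases hcases e he with rfl | ⟨he, hne⟩
    · rw [Function.update_self]
    · rw [Function.update_of_ne hne, h.tree e he hTe]
  · obtain ⟨e, he, hei⟩ := h.copy i h1 h2
    refine ⟨e, he.trans (Nat.lt_succ_self k), ?_⟩
    rw [Function.update_of_ne (fun h => by rw [h] at he; exact lt_irrefl _ he), hei]
  · by_cases hv : v = (D ⟨k, hk⟩).2 ∧ rem v = 0
    · rw [hv.2]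
      exact Nat.zero_le _
    · refine (h.rem_le v).trans (Set.ncard_le_ncard ?_)
      rintro e ⟨h1, h2, h3⟩
      refine ⟨?_, h2, h3⟩
      rcases Nat.eq_or_lt_of_le h1 with h1 | h1
      · have he : e = ⟨k, hk⟩ := Fin.ext h1.symm
        subst he
        rcases hT with hT | hT
        · exact absurd hT h2
        · exact absurd ⟨h3.symm, h3 ▸ hT⟩ hv
      · exact h1

theorem Splitting.rem_eq_zero {T : Fin m → Prop} {K : ℕ} {φ : ℕ → Fin n} {hd : Fin m → ℕ}
    {rem : Fin n → ℕ} (h : Splitting D T μ m K φ hd rem) (v : Fin n) : rem v = 0 := by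
  have := h.rem_le v
  have he : {e : Fin m | m ≤ (e : ℕ) ∧ ¬ T e ∧ (D e).2 = v} = ∅ := by
    ext e
    simp [e.2]
  rw [he, Set.ncard_empty] at this
  omega

end Split

/-! ### The split graph as a certificate -/

section Certificate

variable {I : EdgeList} {D : Fin I.m → Fin I.n × Fin I.n} {r : Fin I.n} {μ : Fin I.n → ℕ}
  {T : Fin I.m → Prop} {K : ℕ} {φ : ℕ → Fin I.n} {hd : Fin I.m → ℕ} {rem : Fin I.n → ℕ}

/-- The graph obtained by splitting vertices. -/
def Splitting.graph (h : Splitting D T μ I.m K φ hd rem) : EdgeList :=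
  ⟨K, I.m, fun e => (⟨(D e).1, (D e).1.2.trans_le h.le⟩, ⟨hd e, h.head_lt e e.2⟩)⟩

theorem EdgeList.reachable_of_ends {H : EdgeList} {e : Fin H.m} {x y : Fin H.n}
    (h : H.ends e = (x, y)) : H.toGraph.toSimpleGraph.Reachable (H.vert x) (H.vert y) := by
  by_cases hxy : H.vert x = H.vert y
  · rw [hxy]
  · exact SimpleGraph.Adj.reachable ⟨hxy, e, Or.inl h⟩

/-- Parent arcs are in `T` and thus join main copies, which are therefore connected. Every
additional copy is the head of an arc, and tails are always main copies. The edges are those of `I`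
throughout, so the edge counts agree. -/
theorem Splitting.certifies (h : Splitting D T μ I.m K φ hd rem) (hD : IsOrientation I.ends D)
    {mk : Fin I.n → ℕ} {pr : ℤ → ℤ} (htree : SearchTree D r mk pr) (hmk : ∀ v, 0 < mk v)
    (hT : ∀ e : Fin I.m, pr (((D e).2 : ℕ) : ℤ) = ((e : ℕ) : ℤ) → T e) :
    Certifies I.toGraph (I.vec fun v => μ v + 1) h.graph.toGraph
      (h.graph.vec fun w => I.vert (φ w)) := by
  let H := h.graph
  let main : Fin I.n → Fin H.n := fun v => ⟨v, v.2.trans_le h.le⟩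
  have hmain : ∀ k v, mk v = k →
      H.toGraph.toSimpleGraph.Reachable (H.vert (main r)) (H.vert (main v)) := by
    intro k
    induction k using Nat.strong_induction_on with
    | _ k ih =>
      intro v hv
      by_cases hvr : v = r
      · rw [hvr]
      · obtain ⟨e, h1, h2, h3, h4⟩ := htree.parent v hvr (hmk v)
        refine (ih _ (hv ▸ h4) _ rfl).trans (EdgeList.reachable_of_ends (H := H) (e := e) ?_)
        refine Prod.ext rfl (Fin.ext ?_)
        change hd e = v
        rw [h.tree e e.2 (hT e (by rw [h2, h1])), h2]
  have hall : ∀ w : Fin H.n, H.toGraph.toSimpleGraph.Reachable (H.vert (main r)) (H.vert w) := by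
    intro w
    rcases Nat.lt_or_ge w I.n with hw | hw
    · exact hmain _ ⟨w, hw⟩ rfl
    · obtain ⟨e, -, he⟩ := h.copy w hw w.2
      refine (hmain _ (D e).1 rfl).trans (EdgeList.reachable_of_ends (H := H) (e := e) ?_)
      exact Prod.ext rfl (Fin.ext he)
  refine ⟨?_, ⟨fun v => ⟨H.vert (main v.1), ?_⟩, fun u v => ?_⟩, fun v => ?_⟩
  · have : Nonempty V(H.toGraph) := ⟨H.vert (main r)⟩
    exact ⟨fun x y => (hall x.1).symm.trans (hall y.1)⟩
  · exact congrArg I.vert (h.main v.1)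
  · congr 1
    ext e
    have hφ : φ (hd e) = (D e).2 := h.head e e.2
    have hφ' : φ (D e).1 = (D e).1 := h.main _
    constructor
    · intro he
      have hD' : D e = (u.1, v.1) ∨ D e = (v.1, u.1) := by
        have he : I.ends e = (u.1, v.1) ∨ I.ends e = (v.1, u.1) := he
        rcases hD e with h1 | h1 <;> rcases he with h2 | h2 <;> simp [h1, h2]
      rcases hD' with h1 | h1
      · refine ⟨H.vert (H.ends e).1, H.vert (H.ends e).2, Or.inl rfl, ?_, ?_⟩
        · exact Subtype.ext (hφ'.trans (by rw [h1]))
        · exact Subtype.ext (hφ.trans (by rw [h1]))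
      · refine ⟨H.vert (H.ends e).2, H.vert (H.ends e).1, Or.inr rfl, ?_, ?_⟩
        · exact Subtype.ext (hφ.trans (by rw [h1]))
        · exact Subtype.ext (hφ'.trans (by rw [h1]))
    · rintro ⟨x, y, hxy, hx, hy⟩
      have hx : φ (x.1 : ℕ) = u.1 := congrArg Subtype.val hx
      have hy : φ (y.1 : ℕ) = v.1 := congrArg Subtype.val hy
      have hD' : D e = (u.1, v.1) ∨ D e = (v.1, u.1) := by
        rcases hxy with hxy | hxy
        · have e1 : ((D e).1 : ℕ) = x.1 := congrArg (fun p => (p.1 : ℕ)) hxy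
          have e2 : hd e = y.1 := congrArg (fun p => (p.2 : ℕ)) hxy
          left
          rw [← hx, ← hy, ← e1, ← e2, hφ, hφ']
        · have e1 : ((D e).1 : ℕ) = y.1 := congrArg (fun p => (p.1 : ℕ)) hxy
          have e2 : hd e = x.1 := congrArg (fun p => (p.2 : ℕ)) hxy
          right
          rw [← hx, ← hy, ← e1, ← e2, hφ, hφ']
      change I.ends e = (u.1, v.1) ∨ I.ends e = (v.1, u.1)
      rcases hD e with h1 | h1
      · rwa [← h1]
      · rw [h1] at hD'
        rcases hD' with h2 | h2
        · right
          simpa using congrArg Prod.swap h2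
        · left
          simpa using congrArg Prod.swap h2
  · let A : Finset (Fin H.n) := Finset.univ.filter fun i => φ i = v.1
    have hpre : (h.graph.vec fun w => I.vert (φ w)) ⁻¹' {v} = H.vert '' (A : Set (Fin H.n)) := by
      ext w
      constructor
      · intro hw
        exact ⟨w.1, Finset.mem_coe.2 (Finset.mem_filter.2
          ⟨Finset.mem_univ _, congrArg Subtype.val hw⟩), rfl⟩
      · rintro ⟨i, hi, rfl⟩
        exact Subtype.ext (Finset.mem_filter.1 (Finset.mem_coe.1 hi)).2
    have hcard : A.card = μ v.1 + 1 := by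
      rw [← h.count v.1, h.rem_eq_zero, Finset.card_filter, Finset.card_filter]
      exact Fin.sum_univ_eq_sum_range (fun i => if φ i = v.1 then 1 else 0) K
    have hinj : Function.Injective H.vert := fun i j hij => congrArg Subtype.val hij
    rw [hpre, hinj.encard_image, Set.encard_coe_eq_coe_finsetCard, hcard]
    rfl

end Certificate

/-! ### Writing the certificate -/

section Output

variable {n m N : ℕ} {s₀ s : Store} {D : Fin m → Fin n × Fin n} {r : Fin n} {μ : Fin n → ℕ}

/-- The store while the arcs are output. -/
structure OutputState (s₀ : Store) (D : Fin m → Fin n × Fin n) (μ : Fin n → ℕ) (s : Store) (k : ℕ)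
    (K : ℕ) (φ : ℕ → Fin n) (hd : Fin m → ℕ) (rem : Fin n → ℕ) : Prop where
  agree : Agree [1, 11, 22, 23, 24] s₀ s
  copies : s 23 0 = K
  wanted : Holds (s 22) fun v => (rem v : ℤ)
  arcs : ∀ e : Fin m, (e : ℕ) < k →
    s 1 (2 + (((e : ℕ) : ℤ) + ((e : ℕ) : ℤ))) = (((D e).1 : ℕ) : ℤ) ∧
      s 1 (3 + (((e : ℕ) : ℤ) + ((e : ℕ) : ℤ))) = (hd e : ℤ)
  labels : ∀ i : ℕ, i < K → s 1 (2 + ((m : ℤ) + (m : ℤ)) + (i : ℤ)) = ((φ i : ℕ) : ℤ)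
  splitting : Splitting D (fun e => s₀ 7 (((D e).2 : ℕ) : ℤ) = ((e : ℕ) : ℤ)) μ k K φ hd rem

theorem OutputState.of_agree {k K : ℕ} {φ : ℕ → Fin n} {hd : Fin m → ℕ} {rem : Fin n → ℕ}
    (h : OutputState s₀ D μ s k K φ hd rem) {s' : Store} (ha : Agree [11, 24] s s') :
    OutputState s₀ D μ s' k K φ hd rem := by
  refine ⟨h.agree.trans (ha.mono (by simp)), ?_, ?_, ?_, ?_, h.splitting⟩
  · rw [ha 23 (by simp), h.copies]
  · rw [ha 22 (by simp)]
    exact h.wanted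
  · rw [ha 1 (by simp)]
    exact h.arcs
  · rw [ha 1 (by simp)]
    exact h.labels

variable {k K : ℕ} {φ : ℕ → Fin n} {hd : Fin m → ℕ} {rem : Fin n → ℕ}

theorem splitHead_runs (h : OutputState s₀ D μ s k K φ hd rem) (hk : k < m)
    (harcs : HoldsArcs (s₀ 4) (s₀ 5) D) (hs3 : s₀ 3 0 = m) (hs : s 11 0 = k)
    (htail : s 1 (2 + ((k : ℤ) + k)) = (((D ⟨k, hk⟩).1 : ℕ) : ℤ))
    (hT : s₀ 7 (((D ⟨k, hk⟩).2 : ℕ) : ℤ) ≠ k) (hrem : 0 < rem (D ⟨k, hk⟩).2) :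
    Runs N splitHead s fun s' => s' 11 0 = k ∧
      ∃ K φ hd rem, OutputState s₀ D μ s' (k + 1) K φ hd rem := by
  have hd5 : s 5 k = (((D ⟨k, hk⟩).2 : ℕ) : ℤ) := by
    rw [h.agree 5 (by simp)]
    exact harcs.2 ⟨k, hk⟩
  have hs3' : s 3 0 = m := by rw [h.agree 3 (by simp), hs3]
  refine .seq (.write (.seq (.write (.seq (.write (.write ⟨by simpa using hs, K + 1, _, _, _,
    ?_, ?_, ?_, fun e he => ?_, fun i hi => ?_, h.splitting.split hk hT hrem⟩))))))
  · exact ((((h.agree.set (by simp) _ _).set (by simp) _ _).set (by simp) _ _).set (by simp) _ _)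
  · simp [Expr.eval, h.copies]
  · have hf : (fun v => ((Function.update rem (D ⟨k, hk⟩).2 (rem (D ⟨k, hk⟩).2 - 1) v : ℕ) : ℤ)) =
        Function.update (fun v => (rem v : ℤ)) (D ⟨k, hk⟩).2 ((rem (D ⟨k, hk⟩).2 : ℤ) - 1) := by
      funext v
      by_cases hv : v = (D ⟨k, hk⟩).2
      · subst hv
        simp only [Function.update_self]
        omega
      · simp [hv]
    rw [hf]
    have := h.wanted.update (D ⟨k, hk⟩).2 ((rem (D ⟨k, hk⟩).2 : ℤ) - 1)
    simpa [Expr.eval, hs, hd5, h.wanted _] using this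
  -- Arcs occupy cells `2` to `2 * m + 1` of the output and labels the cells from `2 + 2 * m` on, so
  -- the writes do not interfere.
  · have h1 : ((e : ℕ) : ℤ) < m := by exact_mod_cast e.2
    simp only [Expr.eval, Store.set_apply, if_true, if_false, hs, hs3', hd5, h.copies,
      Function.update_apply, Nat.reduceEqDiff, OfNat.one_ne_ofNat, OfNat.ofNat_ne_one]
    by_cases hek : (e : ℕ) = k
    · obtain rfl : e = ⟨k, hk⟩ := Fin.ext hek
      simp only [htail]
      constructor
      · rw [if_neg (by omega), if_neg (by omega)]
      · rw [if_neg (by omega)]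
        simp
    · have hlt : (e : ℕ) < k := by omega
      rw [if_neg (by omega), if_neg (by omega), if_neg (by omega), if_neg (by omega),
        if_neg (fun h => hek (by rw [h]))]
      exact h.arcs e hlt
  · have h1 : (k : ℤ) < m := by exact_mod_cast hk
    simp only [Expr.eval, Store.set_apply, if_true, if_false, hs, hs3', hd5, h.copies,
      Function.update_apply, Nat.reduceEqDiff, OfNat.one_ne_ofNat, OfNat.ofNat_ne_one]
    by_cases hiK : i = K
    · rw [if_pos (by omega), if_pos hiK]
    · rw [if_neg (by omega), if_neg (by omega), if_neg hiK]
      exact h.labels i (by omega)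

theorem keepHead_runs (h : OutputState s₀ D μ s k K φ hd rem) (hk : k < m)
    (harcs : HoldsArcs (s₀ 4) (s₀ 5) D) (hs : s 11 0 = k)
    (htail : s 1 (2 + ((k : ℤ) + k)) = (((D ⟨k, hk⟩).1 : ℕ) : ℤ))
    (hT : s₀ 7 (((D ⟨k, hk⟩).2 : ℕ) : ℤ) = k ∨ rem (D ⟨k, hk⟩).2 = 0) :
    Runs N keepHead s fun s' => s' 11 0 = k ∧
      ∃ K φ hd rem, OutputState s₀ D μ s' (k + 1) K φ hd rem := by
  have hd5 : s 5 k = (((D ⟨k, hk⟩).2 : ℕ) : ℤ) := by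
    rw [h.agree 5 (by simp)]
    exact harcs.2 ⟨k, hk⟩
  refine .write ⟨by simpa using hs, K, _, _, _, h.agree.set (by simp) _ _, by simpa using h.copies,
    by simpa using h.wanted, fun e he => ?_, fun i hi => ?_, h.splitting.keep hk hT⟩
  · simp only [Expr.eval, Store.set_apply, if_true, hs, hd5, Function.update_apply]
    by_cases hek : (e : ℕ) = k
    · obtain rfl : e = ⟨k, hk⟩ := Fin.ext hek
      simp only [htail]
      constructor
      · rw [if_neg (by omega)]
      · simp
    · have hlt : (e : ℕ) < k := by omega
      rw [if_neg (by omega), if_neg (by omega), if_neg (fun h => hek (by rw [h]))]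
      exact h.arcs e hlt
  · have h1 : (k : ℤ) < m := by exact_mod_cast hk
    simp only [Expr.eval, Store.set_apply, if_true, hs, hd5, Function.update_apply]
    rw [if_neg (by omega)]
    exact h.labels i hi

/-- Tests have the form `0 < e`, so whether the arc differs from the parent arc of its head is
decided by two one-sided comparisons that set the flag in array `24`. -/
theorem outputArc_runs (h : OutputState s₀ D μ s k K φ hd rem) (hk : k < m)
    (harcs : HoldsArcs (s₀ 4) (s₀ 5) D) (hs3 : s₀ 3 0 = m) (hs : s 11 0 = k) :
    Runs N outputArc s fun s' => s' 11 0 = k ∧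
      ∃ K φ hd rem, OutputState s₀ D μ s' (k + 1) K φ hd rem := by
  have hd4 : s 4 k = (((D ⟨k, hk⟩).1 : ℕ) : ℤ) := by
    rw [h.agree 4 (by simp)]
    exact harcs.1 ⟨k, hk⟩
  have hd5 : s 5 k = (((D ⟨k, hk⟩).2 : ℕ) : ℤ) := by
    rw [h.agree 5 (by simp)]
    exact harcs.2 ⟨k, hk⟩
  refine .seq (.write (.seq (.write ?_)))
  set s₁ := s.set 1 ((arcAddr 2).eval s) ((Expr.read 4 (.cell 11)).eval s) with hs₁
  set s₂ := s₁.set 24 ((Expr.const 0).eval s₁) ((Expr.const 0).eval s₁) with hs₂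
  have ha₂ : Agree [1, 24] s s₂ := ((Agree.refl _ s).set (by simp) _ _).set (by simp) _ _
  have h1 : s₂ 1 = Function.update (s 1) (2 + ((k : ℤ) + k)) (((D ⟨k, hk⟩).1 : ℕ) : ℤ) := by
    simp [hs₂, hs₁, Expr.eval, hs, hd4]
  have hst₂ : OutputState s₀ D μ s₂ k K φ hd rem := by
    refine ⟨h.agree.trans (ha₂.mono (by simp)), ?_, ?_, fun e he => ?_, fun i hi => ?_, h.splitting⟩
    · rw [ha₂ 23 (by simp), h.copies]
    · rw [ha₂ 22 (by simp)]
      exact h.wanted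
    · rw [h1, Function.update_of_ne (by omega), Function.update_of_ne (by omega)]
      exact h.arcs e he
    · have : (k : ℤ) < m := by exact_mod_cast hk
      rw [h1, Function.update_of_ne (by omega)]
      exact h.labels i hi
  have hpr : ∀ {t : Store}, Agree [24] s₂ t → t 11 0 = k ∧ t 5 k = (((D ⟨k, hk⟩).2 : ℕ) : ℤ) ∧
      t 7 = s₀ 7 := fun ha => by
    rw [ha 11 (by simp), ha 5 (by simp), ha 7 (by simp), ha₂ 11 (by simp), ha₂ 5 (by simp),
      ha₂ 7 (by simp), h.agree 7 (by simp)]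
    exact ⟨hs, hd5, rfl⟩
  have hzero : s₂ 24 0 = 0 := by simp [hs₂, Expr.eval]
  refine .seq (Runs.mono (Q := fun t => Agree [24] s₂ t ∧
    (t 24 0 = 1 ∧ (k : ℤ) < s₀ 7 (((D ⟨k, hk⟩).2 : ℕ) : ℤ) ∨
      t 24 0 = 0 ∧ s₀ 7 (((D ⟨k, hk⟩).2 : ℕ) : ℤ) ≤ k)) (.ite (fun h0 => .write ⟨?_, Or.inl ⟨?_, ?_⟩⟩)
      (fun h0 => .skip ⟨Agree.refl _ _, Or.inr ⟨hzero, ?_⟩⟩)) ?_)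
  · exact (Agree.refl _ _).set (by simp) _ _
  · simp [Expr.eval]
  · obtain ⟨e1, e2, e3⟩ := hpr (Agree.refl _ _)
    simp only [Expr.eval, e1, e2, e3] at h0
    omega
  · obtain ⟨e1, e2, e3⟩ := hpr (Agree.refl _ _)
    simp only [Expr.eval, e1, e2, e3] at h0
    omega
  rintro s₃ ⟨ha₃, h24⟩
  obtain ⟨e1, e2, e3⟩ := hpr ha₃
  refine .seq (Runs.mono (Q := fun t => Agree [24] s₂ t ∧
    (t 24 0 = 1 ∧ s₀ 7 (((D ⟨k, hk⟩).2 : ℕ) : ℤ) ≠ k ∨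
      t 24 0 = 0 ∧ s₀ 7 (((D ⟨k, hk⟩).2 : ℕ) : ℤ) = k)) (.ite (fun h0 => .write ⟨?_, Or.inl ⟨?_, ?_⟩⟩)
      (fun h0 => .skip ⟨ha₃, ?_⟩)) ?_)
  · exact ha₃.set (by simp) _ _
  · simp [Expr.eval]
  · simp only [Expr.eval, e1, e2, e3] at h0
    omega
  · simp only [Expr.eval, e1, e2, e3] at h0
    rcases h24 with ⟨h24, h⟩ | ⟨h24, h⟩
    · exact Or.inl ⟨h24, by omega⟩
    · exact Or.inr ⟨h24, by omega⟩
  rintro s₄ ⟨ha₄, h24⟩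
  obtain ⟨e1, e2, -⟩ := hpr ha₄
  have hst := hst₂.of_agree (ha₄.mono (by simp))
  have htail : s₄ 1 (2 + ((k : ℤ) + k)) = (((D ⟨k, hk⟩).1 : ℕ) : ℤ) := by
    rw [ha₄ 1 (by simp), h1, Function.update_self]
  refine .ite (fun h0 => .ite (fun h2 => ?_) (fun h2 => ?_)) (fun h0 => ?_) <;>
    simp only [Expr.eval] at h0
  · simp only [Expr.eval, e1, e2, hst.wanted _] at h2
    exact splitHead_runs hst hk harcs hs3 e1 htail (by omega) (by omega)
  · simp only [Expr.eval, e1, e2, hst.wanted _] at h2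
    exact keepHead_runs hst hk harcs e1 htail (Or.inr (by omega))
  · exact keepHead_runs hst hk harcs e1 htail (Or.inl (by omega))

/-- Each vertex has enough entering arcs that are not parent arcs. -/
theorem le_ncard_of_degree {pr : ℤ → ℤ} (hr : (r : ℕ) = 0) (hpr : pr 0 = -1)
    (hdeg : ∀ v, μ v + (if v = r then 0 else 1) ≤ indeg D v) (v : Fin n) :
    μ v ≤ {e : Fin m | ¬ pr (((D e).2 : ℕ) : ℤ) = ((e : ℕ) : ℤ) ∧ (D e).2 = v}.ncard := by
  have h1 : indeg D v = {e : Fin m | (D e).2 = v}.ncard := by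
    rw [indeg, ← Set.ncard_coe_finset]
    simp
  have h2 : {e : Fin m | (D e).2 = v} =
      {e | pr (((D e).2 : ℕ) : ℤ) = ((e : ℕ) : ℤ) ∧ (D e).2 = v} ∪
        {e | ¬ pr (((D e).2 : ℕ) : ℤ) = ((e : ℕ) : ℤ) ∧ (D e).2 = v} := by
    ext e
    simp only [Set.mem_ofPred_eq, Set.mem_union]
    tauto
  -- The entry `-1` is not the index of an arc, so the root has no parent arc; elsewhere `pr`
  -- determines the arc.
  have h3 : {e : Fin m | pr (((D e).2 : ℕ) : ℤ) = ((e : ℕ) : ℤ) ∧ (D e).2 = v}.ncard ≤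
      if v = r then 0 else 1 := by
    split_ifs with hv
    · rw [Nat.le_zero, Set.ncard_eq_zero]
      ext e
      simp only [Set.mem_ofPred_eq, Set.mem_empty_iff_false, iff_false, not_and]
      intro h4 h5
      rw [h5, hv, hr, Nat.cast_zero, hpr] at h4
      omega
    · rw [Set.ncard_le_one]
      rintro e ⟨h4, h5⟩ e' ⟨h4', h5'⟩
      rw [h5] at h4
      rw [h5', h4] at h4'
      exact Fin.ext (by exact_mod_cast h4')
  have h4 := Set.ncard_union_le {e : Fin m | pr (((D e).2 : ℕ) : ℤ) = ((e : ℕ) : ℤ) ∧ (D e).2 = v}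
    {e | ¬ pr (((D e).2 : ℕ) : ℤ) = ((e : ℕ) : ℤ) ∧ (D e).2 = v}
  rw [← h2, ← h1] at h4
  have := hdeg v
  omega

theorem outputSplit_runs (I : EdgeList) {D : Fin I.m → Fin I.n × Fin I.n} {r : Fin I.n}
    {μ : Fin I.n → ℕ} (hn : I.n ≤ N) (hm : I.m ≤ N) (hr : (r : ℕ) = 0)
    (hD : IsOrientation I.ends D) (hdeg : ∀ v, μ v + (if v = r then 0 else 1) ≤ indeg D v)
    (hs2 : s 2 0 = I.n) (hs3 : s 3 0 = I.m) (harcs : HoldsArcs (s 4) (s 5) D)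
    (h22 : Holds (s 22) fun v => (μ v : ℤ)) (h7 : s 7 0 = -1) {mk : Fin I.n → ℕ}
    (htree : SearchTree D r mk (s 7)) (hmk : ∀ v, 0 < mk v) :
    Runs N outputSplit s fun s' => ∃ out, HasOutput s' out ∧
      SplitInstance.IsSolution ⟨I, μ⟩ out := by
  refine .seq (.write (.seq (.for (fun k t => Agree [1, 11, 23] s t ∧ t 23 0 = I.n ∧
    ∀ i : ℕ, i < k → t 1 (2 + ((I.m : ℤ) + (I.m : ℤ)) + (i : ℤ)) = (i : ℤ)) hn ?_ ?_ ?_ ?_)))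
  · rintro k t ⟨ha, -⟩
    simp [Expr.eval, ha 2 (by simp), hs2]
  · exact ⟨((Agree.refl _ s).set (by simp) _ _).set (by simp) _ _, by simp [Expr.eval, hs2],
      by simp⟩
  · rintro k hk t ⟨ha, h23, hl⟩ ht
    refine .write ⟨by simpa using ht, (ha.set (by simp) _ _).set (by simp) _ _,
      by simpa using h23, fun i hi => ?_⟩
    have hm3 : t 3 0 = I.m := by rw [ha 3 (by simp), hs3]
    by_cases hik : i = k
    · simp [Expr.eval, ht, hm3, hik]
    · have hne : (i : ℤ) ≠ k := by exact_mod_cast hik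
      simpa [Expr.eval, ht, hm3, hne] using hl i (by omega)
  rintro s₁ ⟨ha₁, h23, hl⟩
  let φ₀ : ℕ → Fin I.n := fun i => if h : i < I.n then ⟨i, h⟩ else r
  have hst₁ : OutputState s D μ s₁ 0 I.n φ₀ (fun _ => 0) μ := by
    refine ⟨ha₁.mono (by simp), h23, ?_, by simp, fun i hi => ?_,
      .init (le_ncard_of_degree hr h7 hdeg) (fun v => by simp [φ₀]) _⟩
    · rw [ha₁ 22 (by simp)]
      exact h22
    · rw [hl i hi]
      simp [φ₀, hi]
  refine .seq (.for (fun k t => ∃ K φ hd rem, OutputState s D μ t k K φ hd rem) hm ?_ ?_ ?_ ?_)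
  · rintro k t ⟨K, φ, hd, rem, h⟩
    simp [Expr.eval, h.agree 3 (by simp), hs3]
  · exact ⟨_, _, _, _, hst₁.of_agree ((Agree.refl _ s₁).set (by simp) _ _)⟩
  · rintro k hk t ⟨K, φ, hd, rem, h⟩ ht
    refine (outputArc_runs h hk harcs hs3 ht).mono ?_
    rintro t' ⟨ht', K', φ', hd', rem', h'⟩
    exact ⟨ht', K', φ', hd', rem', h'.of_agree ((Agree.refl _ t').set (by simp) _ _)⟩
  rintro t ⟨K, φ, hd, rem, h⟩
  have hm3 : t 3 0 = I.m := by rw [h.agree 3 (by simp), hs3]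
  -- The header comes last, since the number of vertices is known only after all splits.
  refine .seq (.write (.write ?_))
  refine ⟨_, EdgeList.hasOutput h.splitting.graph (fun i => ((φ i : ℕ) : ℤ)) ?_ ?_ (fun e => ?_)
    (fun e => ?_) (fun i => ?_), h.splitting.graph, fun i => φ i, rfl,
    h.splitting.certifies hD htree hmk fun _ h => h⟩
  · rw [show h.splitting.graph.n = K from rfl]
    simpa [Expr.eval] using h.copies
  · rw [show h.splitting.graph.m = I.m from rfl]
    simpa [Expr.eval] using hm3
  · have := (h.arcs e e.2).1
    rw [← two_mul] at this
    simp only [Expr.eval, Store.set_apply, if_true]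
    rw [Function.update_of_ne (by omega), Function.update_of_ne (by omega), this]
    rfl
  · have := (h.arcs e e.2).2
    rw [← two_mul] at this
    simp only [Expr.eval, Store.set_apply, if_true]
    rw [Function.update_of_ne (by omega), Function.update_of_ne (by omega), this]
    rfl
  · have := h.labels i i.2
    rw [← two_mul] at this
    simp only [Expr.eval, Store.set_apply, if_true]
    rw [Function.update_of_ne (by omega), Function.update_of_ne (by omega)]
    exact this

theorem construct_runs (I : EdgeList) {μ : Fin I.n → ℕ} (hconn : Connected I.toGraph) {r : Fin I.n}
    (hr : (r : ℕ) = 0) (hμ : Orientable I.ends r μ) :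
    Runs (bitLength (SplitInstance.encode ⟨I, μ⟩)) construct
      (inputStore (SplitInstance.encode ⟨I, μ⟩)) fun s => ∃ out, HasOutput s out ∧
        SplitInstance.IsSolution ⟨I, μ⟩ out := by
  have hN := I.add_le_bitLength fun v => (μ v : ℤ)
  change Runs (bitLength (I.encode ++ List.ofFn fun v => (μ v : ℤ))) construct
    (inputStore (I.encode ++ List.ofFn fun v => (μ v : ℤ))) _
  refine .seq ((prepare_runs I _ hconn (by omega) (by omega) hr).mono ?_)
  rintro s₁ ⟨ha₁, D₁, sl₁, hst₁⟩
  refine .seq ((readVector_runs I _ (by omega) hst₁.vertices hst₁.edges (ha₁ 0 (by simp))).mono ?_)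
  rintro s₂ ⟨ha₂, h22⟩
  refine .seq ((orient_runs (by omega) (by omega) hr ⟨D₁, sl₁, hst₁.of_agree ha₂ (by simp)⟩ hμ
    h22).mono ?_)
  rintro s₃ ⟨ha₃, D, sl, hst⟩
  refine .seq ((searchTree_runs (by omega) (by omega) hr hst).mono ?_)
  rintro s₄ ⟨ha₄, harcs, h7, mk, htree, hmk⟩
  refine outputSplit_runs I (by omega) (by omega) hr hst.orientation (fun v => ?_)
    (by rw [ha₄ 2 (by simp), hst.vertices]) (by rw [ha₄ 3 (by simp), hst.edges]) harcs ?_ h7 htree hmk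
  · have := hst.degree v
    omega
  · rw [ha₄ 22 (by simp), ha₃ 22 (by simp)]
    exact h22

end Output

/-! ## Feasible split vectors of coded graphs -/

theorem EdgeList.zero_lt_n {I : EdgeList} (h : IsAdmissible I.toGraph) : 0 < I.n := by
  obtain ⟨v⟩ := h.connected.nonempty
  exact v.1.pos

/-- The orientation is taken from the final store of `prepare`. -/
theorem EdgeList.orientable_zero {I : EdgeList} (hconn : Connected I.toGraph) {r : Fin I.n}
    (hr : (r : ℕ) = 0) : Orientable I.ends r 0 := by
  obtain ⟨_, _, _, _, -, _, _, h⟩ :=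
    prepare_runs (N := I.n + I.m) I 0 hconn (by omega) (by omega) hr
  exact h.orientable

/-- The certificate needed for the converse is the output of `construct`. -/
theorem EdgeList.isFeasibleSplit_iff {I : EdgeList} (hconn : Connected I.toGraph) {r : Fin I.n}
    (hr : (r : ℕ) = 0) (μ : Fin I.n → ℕ) :
    IsFeasibleSplit I.toGraph (I.vec μ) ↔ Orientable I.ends r μ := by
  refine ⟨fun h => I.coding.orientable h r, fun h => ?_⟩
  obtain ⟨_, _, _, _, _, _, H, φ, -, hH⟩ := construct_runs I hconn hr h
  exact ⟨_, _, _, _, hH⟩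

variable {α β : Type*} {G : Graph α β} {I : EdgeList}

theorem Coding.connected (C : Coding G I) (h : Connected G) : Connected I.toGraph := by
  have : Nonempty V(I.toGraph) := by
    obtain ⟨v⟩ := h.nonempty
    exact ⟨I.vert (C.vert.symm v)⟩
  refine ⟨fun x y => ?_⟩
  have key : ∀ a b : V(G), G.toSimpleGraph.Walk a b →
      I.toGraph.toSimpleGraph.Reachable (I.vert (C.vert.symm a)) (I.vert (C.vert.symm b)) := by
    intro a b p
    induction p with
    | nil => exact .refl _
    | @cons a b _ hadj _ ih =>
      refine .trans ?_ ih
      obtain ⟨-, e, he⟩ := hadj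
      have := (C.isLink_iff (C.edge.symm ⟨e, he.edge_mem⟩) (C.vert.symm a) (C.vert.symm b)).1
        (by simpa using he)
      rcases this with h | h
      · exact EdgeList.reachable_of_ends h
      · exact (EdgeList.reachable_of_ends h).symm
  obtain ⟨p⟩ := h.preconnected (C.vert x.1) (C.vert y.1)
  have := key _ _ p
  rwa [Equiv.symm_apply_apply, Equiv.symm_apply_apply] at this

theorem Coding.isFeasibleSplit_iff (C : Coding G I) (h : Connected G) {r : Fin I.n}
    (hr : (r : ℕ) = 0) (μ : V(G) → ℕ) : IsFeasibleSplit G μ ↔ Orientable I.ends r (μ ∘ C.vert) :=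
  ⟨fun h => C.orientable h r, fun ho =>
    C.isFeasibleSplit ((EdgeList.isFeasibleSplit_iff (C.connected h) hr _).2 ho)⟩

/-! ## The three parts of the theorem -/

section Polytope

variable {α β : Type*} {G : Graph α β} {I : EdgeList}

theorem Coding.splitPoints_eq (C : Coding G I) (h : Connected G) {r : Fin I.n}
    (hr : (r : ℕ) = 0) : splitPoints G = realPoints {μ | Orientable I.ends r (μ ∘ C.vert)} := by
  ext x
  exact exists_congr fun μ => and_congr_left' (C.isFeasibleSplit_iff h hr μ)

theorem isPolymatroid_splitPolytope (hG : IsAdmissible G) :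
    IsPolymatroid (splitPolytope G) ∧ integralPoints (splitPolytope G) = splitPoints G := by
  classical
  obtain ⟨I, ⟨C⟩⟩ := exists_coding hG.finite_vertexSet hG.finite_edgeSet
  have := hG.finite_vertexSet.fintype
  obtain ⟨v⟩ := hG.connected.nonempty
  let r : Fin I.n := ⟨0, (C.vert.symm v).pos⟩
  have h0 := EdgeList.orientable_zero (C.connected hG.connected) (r := r) rfl
  have hF : IsSaturable {μ : V(G) → ℕ | Orientable I.ends r (μ ∘ C.vert)} :=
    h0.isSaturable.comp_equiv C.vert
  rw [splitPolytope, C.splitPoints_eq hG.connected (r := r) rfl]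
  exact ⟨hF.isPolymatroid, hF.integralPoints_eq⟩

end Polytope

theorem EdgeList.vec_mem_splitPolytope {I : EdgeList} (hconn : Connected I.toGraph) {r : Fin I.n}
    (hr : (r : ℕ) = 0) {ν : Fin I.n → ℕ} (hν : Orientable I.ends r ν) :
    I.vec (fun v => (ν v : ℝ)) ∈ splitPolytope I.toGraph :=
  subset_convexHull ℝ _ ⟨I.vec ν, (EdgeList.isFeasibleSplit_iff hconn hr ν).2 hν, fun _ => rfl⟩

theorem EdgeList.le_of_mem_splitPolytope {I : EdgeList} {r : Fin I.n} {w : Fin I.n → ℝ} {c : ℝ}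
    (h : ∀ μ, Orientable I.ends r μ → ∑ v, w v * (μ v : ℝ) ≤ c) {y : V(I.toGraph) → ℝ}
    (hy : y ∈ splitPolytope I.toGraph) : ∑ v, w v * y (I.vert v) ≤ c := by
  refine convexHull_min (t := {y | ∑ v, w v * y (I.vert v) ≤ c}) ?_ ?_ hy
  · rintro y ⟨μ, hμ, hy⟩
    simp only [Set.mem_ofPred_eq, hy]
    exact h _ (I.coding.orientable hμ r)
  · refine convex_halfSpace_le ⟨fun x y => ?_, fun a x => ?_⟩ c
    · simp [mul_add, Finset.sum_add_distrib]
    · simp [Finset.mul_sum, mul_left_comm]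

theorem optimize_solves : SolvableInPolyTime OptInstance.encode
    (fun i => IsAdmissible i.graph.toGraph) OptInstance.IsSolution := by
  refine solvableInPolyTime_of_runs optimize fun ⟨I, w⟩ hI => ?_
  let r : Fin I.n := ⟨0, EdgeList.zero_lt_n hI⟩
  refine (optimize_runs I w hI.connected (r := r) rfl).mono ?_
  rintro s ⟨ν, hout, hν, h0, hsat⟩
  have hF := (EdgeList.orientable_zero hI.connected (r := r) rfl).isSaturable
  refine ⟨List.ofFn fun v => (ν v : ℤ), ?_, fun v => (ν v : ℤ), rfl, ?_, fun y hy => ?_⟩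
  · intro k
    have := hout ⟨k, by simpa using k.2⟩
    simpa using this
  · simpa using EdgeList.vec_mem_splitPolytope hI.connected (r := r) rfl hν
  -- A linear bound extends from the feasible split vectors to their hull, so only orientable
  -- vectors have to be compared with the greedy vector.
  · refine EdgeList.le_of_mem_splitPolytope (r := r) (fun μ hμ => ?_) hy
    simp only [Int.cast_natCast]
    refine hF.greedy_optimal hν (fun v hv => h0 v (by exact_mod_cast hv)) (fun v hv => ?_)
      (fun v => by positivity) fun S => by exact_mod_cast hF.sum_le_rank hμ S
    simpa using hsat v (by exact_mod_cast hv)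

theorem construct_solves : SolvableInPolyTime SplitInstance.encode
    (fun i => IsAdmissible i.graph.toGraph ∧
      IsFeasibleSplit i.graph.toGraph (i.graph.vec i.split)) SplitInstance.IsSolution := by
  refine solvableInPolyTime_of_runs construct fun ⟨I, μ⟩ ⟨hI, hμ⟩ => ?_
  let r : Fin I.n := ⟨0, EdgeList.zero_lt_n hI⟩
  exact construct_runs I hI.connected (r := r) rfl
    ((EdgeList.isFeasibleSplit_iff hI.connected rfl μ).1 hμ)

end KTrail

theorem theorem5 :
    -- `P_G` is a polymatroid, and its integral points are the feasible split vectors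
    (∀ {α : Type*} {β : Type*} (G : Graph α β), KTrail.IsAdmissible G →
      KTrail.IsPolymatroid (KTrail.splitPolytope G) ∧
      KTrail.integralPoints (KTrail.splitPolytope G) = KTrail.splitPoints G) ∧
    -- linear functions can be maximized over `P_G` in polynomial time
    KTrail.SolvableInPolyTime KTrail.OptInstance.encode
      (fun i => KTrail.IsAdmissible i.graph.toGraph) KTrail.OptInstance.IsSolution ∧
    -- for feasible split vectors, certifying `H` and `φ` can be found in polynomial time
    KTrail.SolvableInPolyTime KTrail.SplitInstance.encode
      (fun i => KTrail.IsAdmissible i.graph.toGraph ∧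
        KTrail.IsFeasibleSplit i.graph.toGraph (i.graph.vec i.split))
      KTrail.SplitInstance.IsSolution := by
  exact ⟨fun G hG => KTrail.isPolymatroid_splitPolytope hG, KTrail.optimize_solves,
    KTrail.construct_solves⟩
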